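/- **Setting.** For $m\ge 0$ consider the harmonic chain $H=\frac12\sum_{n\in\mathbb Z}\bigl(p_n^2+m^2q_n^2+\frac14(q_n-q_{n+1})^2\bigr)$, with dispersion relation $\omega(k)=\sqrt{m^2+\sin^2(k/2)}$. Its ground state two-point functions are $$\langle p_ip_j\rangle=\frac1{2\pi}\int_{-\pi}^{\pi}\frac{\omega(k)}2\cos(k(i-j))\,dk,\qquad \langle q_iq_j\rangle=\frac1{2\pi}\int_{-\pi}^{\pi}\frac{1}{2\omega(k)}\cos(k(i-j))\,dk\quad(m>0).$$ The renormalized dispersion relations are $\omega^{(0)}=\omega$, $\omega^{(l+1)}(k)=\omega^{(l)}(\frac k2)\,\omega^{(l)}(\frac k2+\pi)/\omega^{(l)}(\pi)^2$. **Filters.** Let $g^{(l)}_s,h^{(l)}_s$ ($l\in\mathbb Z$, larger $l$ is coarser; the layers $l=0,1,\dots$ are used in the circuit) be real filters on $\mathbb Z$, each supported in an interval of at most $M$ integers, with Fourier transforms $a(k)=\sum_n a[n]e^{-ikn}$ satisfying $g^{(l)}_s(0)=h^{(l)}_s(0)=\sqrt2$ and $g^{(l)}_s(k)\overline{h^{(l)}_s(k)}+g^{(l)}_s(k+\pi)\overline{h^{(l)}_s(k+\pi)}=2$.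 Put $g_w^{(l)}(k)=e^{-ik}\overline{h_s^{(l)}(k+\pi)}$, $h_w^{(l)}(k)=e^{-ik}\overline{g_s^{(l)}(k+\pi)}$, and $\tilde g^{(l)}_w(k)=\frac{\omega^{(l)}(k)}{\omega^{(l)}(\pi)}h^{(l)}_w(k)$, $\tilde g^{(l)}_s(k)=\frac{\omega^{(l)}(\pi)}{\omega^{(l)}(k+\pi)}h^{(l)}_s(k)$. For a filter pair $a=(a_s,a_w)$ let $W_af=f^{\rm low}\oplus f^{\rm high}$, $f^{\rm low}[n]=\sum_r a_s[r]f[2n+r]$, $f^{\rm high}[n]=\sum_r a_w[r]f[2n+r]$. **MERA.** Let $R_{g^{(l)}}=\sqrt{\omega^{(l)}(\pi)}\,W_{g^{(l)}}$, $R_{h^{(l)}}=W_{h^{(l)}}/\sqrt{\omega^{(l)}(\pi)}$, and let $R_a^{(\mathcal L)}=(R_{a^{(\mathcal L-1)}}\oplus\mathbb 1)\circ\dots\circ(R_{a^{(1)}}\oplus\mathbb 1)\circ R_{a^{(0)}}$, each layer acting on the low-frequency output of the previous one. The $\mathcal L$-layer MERA two-point functions are $$\langle p_ip_j\rangle_{\rm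 MERA}=\tfrac12\bigl(R_g^{(\mathcal L)\mathsf T}R_g^{(\mathcal L)}\bigr)_{ij},\qquad \langle q_iq_j\rangle_{\rm MERA}=\tfrac12\bigl(R_h^{(\mathcal L)\mathsf T}R_h^{(\mathcal L)}\bigr)_{ij}.$$ **Theorem.** Let $M\in\mathbb N$, $B\in\mathbb R$ and $D\ge1$. There is a constant $C>0$, depending only on $M,B,D$, such that the following holds for all $m\ge0$, $0<\varepsilon\le\frac12$, $\mathcal L\ge1$ and all filter families as above that satisfy: 1. (stable scaling functions) for $a=g,h$ and $0\le l\le\mathcal L$ the generalized scaling function $\phi^a_l$, with $\hat\phi^a_l(k)=\prod_{j\ge1}a_s^{(l-j)}(2^{-j}k)/\sqrt2$, exists as an element of $L^1(\mathbb R)\cap L^2(\mathbb R)$, and $\|\phi^a_l\|_\infty\le B$; here the product converges pointwise, and also in $L^2(\mathbb R)$ in the sense that the cascade iterates, whose Fourier transforms are the partial products $\prod_{j=1}^{J}a_s^{(l-j)}(2^{-j}k)/\sqrt2$ times $\hat\chi(2^{-J}k)$ with $\chi=1_{[0,1)}$, converge to $\phi^a_l$ in $L^2(\mathbb R)$ as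 $J\to\infty$; 2. (bounded decomposition maps) for $a=g,h,\tilde g$, every composition of the decomposition maps $W_{a^{(l)}}$ of consecutive layers among $0,\dots,\mathcal L-1$ (each acting on the low-frequency output of the previous one) has $\ell^2$-operator norm at most $D$; for $a=\tilde g$ this includes that the filters $\tilde g^{(l)}$ are square summable; 3. (approximate dispersion relation) $\bigl|g^{(l)}_w(k)-\frac{\omega^{(l)}(k)}{\omega^{(l)}(\pi)}h^{(l)}_w(k)\bigr|\le\varepsilon$ for all $k\in\mathbb R$ and $0\le l<\mathcal L$. Write $\mathcal E=C\,2^{-\mathcal L/2}+C\,\varepsilon\log\frac1\varepsilon$. Then for all $i,j\in\mathbb Z$: $$\bigl|\langle p_ip_j\rangle-\langle p_ip_j\rangle_{\rm MERA}\bigr|\le\mathcal E\,\sqrt{m^2+1},$$ $$\bigl|\langle q_iq_j\rangle-\langle q_iq_j\rangle_{\rm MERA}\bigr|\le\mathcal E\,\frac1m\qquad\text{if } m>0,$$ and if $m=0$, the regulated two-point functions $\langle q_iq_j\rangle^{\rm reg}=\frac1{2\pi}\int_{-\pi}^{\pi}\frac{\cos(k(i-j))-1}{2\omega(k)}dk$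 and $\langle q_iq_j\rangle^{\rm reg}_{\rm MERA}=\langle q_iq_j\rangle_{\rm MERA}-\langle q_iq_i\rangle_{\rm MERA}$ satisfy $$\bigl|\langle q_iq_j\rangle^{\rm reg}-\langle q_iq_j\rangle^{\rm reg}_{\rm MERA}\bigr|\le\mathcal E\,\sqrt{|i-j|}.$$ -/

import Mathlib

open scoped ComplexConjugate ENNReal Topology
open MeasureTheory

noncomputable section

namespace BosonicMERA

/-! ### Translation-invariant chains and the harmonic chain -/

/-- The dispersion relation `ω(k) = √V(k)` of the quadratic Hamiltonian
`H = ½ (∑ₙ pₙ² + ∑ₙₘ qₙ V_{n-m} qₘ)`, where `V(k) = ∑ₙ Vₙ cos(n k)` is the Fourier transform of the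
even sequence `V`. -/
def dispersion (V : ℤ → ℝ) (k : ℝ) : ℝ := √(∑' n : ℤ, V n * Real.cos (n * k))

/-- The potential of the harmonic chain of mass `m`,
`H = ½ ∑ₙ (pₙ² + m² qₙ² + ¼ (qₙ - qₙ₊₁)²)`: expanding the square gives
`V₀ = m² + ½`, `V₁ = V₋₁ = -¼` and `Vₙ = 0` otherwise. -/
def chainPotential (m : ℝ) (n : ℤ) : ℝ :=
  if n = 0 then m ^ 2 + 1 / 2 else if n = 1 ∨ n = -1 then -(1 / 4) else 0

/-- The dispersion relation of the harmonic chain of mass `m`. -/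
def chainDispersion (m : ℝ) : ℝ → ℝ := dispersion (chainPotential m)

/-- The dispersion relation of the harmonic chain is `√(m² + sin²(k/2))`. -/
theorem chainDispersion_eq (m k : ℝ) :
    chainDispersion m k = √(m ^ 2 + Real.sin (k / 2) ^ 2) := by
  unfold chainDispersion dispersion
  congr 1
  rw [tsum_eq_sum (s := ({0, 1, -1} : Finset ℤ))]
  · have h : Real.cos k = 1 - 2 * Real.sin (k / 2) ^ 2 := by
      have h1 := Real.cos_two_mul (k / 2)
      have h2 := Real.sin_sq_add_cos_sq (k / 2)
      rw [show 2 * (k / 2) = k by ring] at h1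
      linarith
    rw [Finset.sum_insert (by decide), Finset.sum_insert (by decide), Finset.sum_singleton]
    simp [chainPotential, h]
    ring
  · intro n hn
    simp only [Finset.mem_insert, Finset.mem_singleton, not_or] at hn
    simp [chainPotential, hn.1, hn.2.1, hn.2.2]

/-- The renormalized dispersion relations: `ω⁽⁰⁾ = ω` and
`ω⁽ˡ⁺¹⁾(k) = (ω⁽ˡ⁾(k/2) / ω⁽ˡ⁾(π)) (ω⁽ˡ⁾(k/2 + π) / ω⁽ˡ⁾(π))`. -/
def renormDispersion (ω : ℝ → ℝ) : ℕ → ℝ → ℝ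
  | 0 => ω
  | l + 1 => fun k =>
      (renormDispersion ω l (k / 2) / renormDispersion ω l Real.pi) *
        (renormDispersion ω l (k / 2 + Real.pi) / renormDispersion ω l Real.pi)

/-- The ground state two-point function `⟨p_i p_j⟩ = γᵖ_{ij}`, with `γᵖ(k) = ω(k) / 2`. -/
def groundP (ω : ℝ → ℝ) (i j : ℤ) : ℝ :=
  1 / (2 * Real.pi) *
    ∫ k in (-Real.pi)..Real.pi, ω k / 2 * Real.cos (k * ((i : ℝ) - j))

/-- The ground state two-point function `⟨q_i q_j⟩ = γ^q_{ij}`, with `γ^q(k) = 1 / (2 ω(k))`. -/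
def groundQ (ω : ℝ → ℝ) (i j : ℤ) : ℝ :=
  1 / (2 * Real.pi) *
    ∫ k in (-Real.pi)..Real.pi, 1 / (2 * ω k) * Real.cos (k * ((i : ℝ) - j))

/-- The regulated ground state two-point function `γ^q_{ij} - γ^q_{ii}`.  The difference is taken
under the integral sign, so that it makes sense when `ω(0) = 0` and both terms diverge. -/
def groundQReg (ω : ℝ → ℝ) (i j : ℤ) : ℝ :=
  1 / (2 * Real.pi) *
    ∫ k in (-Real.pi)..Real.pi, 1 / (2 * ω k) * (Real.cos (k * ((i : ℝ) - j)) - 1)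

/-! ### Filters and wavelet decomposition maps -/

/-- Real signals on the lattice `ℤ`. -/
abbrev Signal := ℤ → ℝ

/-- The Fourier transform `a(k) = ∑ₙ a[n] e^{-ikn}` of a filter. -/
def freq (a : ℤ → ℝ) (k : ℝ) : ℂ :=
  ∑' n : ℤ, (a n : ℂ) * Complex.exp (-(Complex.I * k * n))

/-- The real sequence whose Fourier transform is `F` (for `F` square integrable on `[-π, π]` with
`F(-k)` the complex conjugate of `F(k)`). -/
def fourierSeq (F : ℝ → ℂ) (n : ℤ) : ℝ :=
  (1 / (2 * Real.pi) *
    ∫ k in (-Real.pi)..Real.pi, F k * Complex.exp (Complex.I * k * n)).re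

/-- The high-pass filter obtained from the dual low-pass filter `b`: it has Fourier transform
`e^{-ik}` times the complex conjugate of `b(k + π)`. -/
def waveletFilter (b : ℤ → ℝ) : ℤ → ℝ := fun n => (-1) ^ (1 - n) * b (1 - n)

/-- A low-pass filter together with a high-pass filter. -/
structure FilterBank where
  /-- the scaling (low-pass) filter -/
  scaling : ℤ → ℝ
  /-- the wavelet (high-pass) filter -/
  wavelet : ℤ → ℝ

/-- The filter bank with scaling filter `a`, where `b` is the scaling filter dual to `a`. -/
def bank (a b : ℤ → ℝ) : FilterBank := ⟨a, waveletFilter b⟩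

/-- Filtering followed by downsampling: `n ↦ ∑ₗ a[l] f[2n + l]`. -/
def decimate (a : ℤ → ℝ) (f : Signal) : Signal := fun n => ∑' l : ℤ, a l * f (2 * n + l)

/-- The single-layer decomposition map `W_a f = f^low ⊕ f^high`. -/
def decompose (A : FilterBank) (f : Signal) : Signal × Signal :=
  (decimate A.scaling f, decimate A.wavelet f)

/-- The low-frequency output of the layers `T s, …, T (s + n - 1)`, each of which is applied to the
low-frequency output of the previous one. -/
def lowPart (T : ℕ → Signal → Signal × Signal) (s : ℕ) : ℕ → Signal → Signal
  | 0, f => f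
  | n + 1, f => (T (s + n) (lowPart T s n f)).1

/-- The high-frequency output of the layer `T (s + n)` when the layers `T s, …, T (s + n)` are
applied successively. -/
def highPart (T : ℕ → Signal → Signal × Signal) (s n : ℕ) (f : Signal) : Signal :=
  (T (s + n) (lowPart T s n f)).2

/-- The squared `ℓ²`-norm. -/
def energy (f : Signal) : ℝ≥0∞ := ∑' n : ℤ, ENNReal.ofReal (f n ^ 2)

/-- All decomposition maps `ℓ² → ℓ² ⊕ ⋯ ⊕ ℓ²` built from consecutive layers among
`T 0, …, T (L - 1)` have operator norm at most `D`. -/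
def LayersBounded (T : ℕ → Signal → Signal × Signal) (L : ℕ) (D : ℝ) : Prop :=
  ∀ s n : ℕ, s + n ≤ L → ∀ f : Signal, Memℓp f 2 →
    energy (lowPart T s n f) + ∑ j ∈ Finset.range n, energy (highPart T s j f) ≤
      ENNReal.ofReal (D ^ 2) * energy f

/-- The Fourier transform of the scaling filter of `tildeBank`. -/
def tildeScalingSymbol (ω : ℝ → ℝ) (h : ℤ → ℝ) (k : ℝ) : ℂ :=
  ((ω Real.pi / ω (k + Real.pi) : ℝ) : ℂ) * freq h k

/-- The filters `g̃` for which `g̃_w(k) = (ω(k) / ω(π)) h_w(k)` holds exactly.  The corresponding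
scaling filter is `g̃_s(k) = (ω(π) / ω(k + π)) h_s(k)`; it is the one whose dual wavelet filter
`h̃_w(k) = e^{-ik} conj (g̃_s(k + π))` equals `(ω(π) / ω(k)) g_w(k)`. -/
def tildeBank (ω : ℝ → ℝ) (g h : ℤ → ℝ) : FilterBank where
  scaling := fourierSeq (tildeScalingSymbol ω h)
  wavelet := fourierSeq fun k => ((ω k / ω Real.pi : ℝ) : ℂ) * freq (waveletFilter g) k

/-! ### Families of filters and their scaling functions -/

/-- A family of pairs of real biorthogonal scaling filters, one for each layer `l` (larger `l` is
coarser), with supports of size at most `M` and with the usual normalization. -/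
structure IsFilterFamily (g h : ℤ → ℤ → ℝ) (M : ℕ) : Prop where
  perfect_reconstruction : ∀ (l : ℤ) (k : ℝ),
    freq (g l) k * conj (freq (h l) k) +
      freq (g l) (k + Real.pi) * conj (freq (h l) (k + Real.pi)) = 2
  normalized : ∀ l : ℤ, freq (g l) 0 = (√2 : ℝ) ∧ freq (h l) 0 = (√2 : ℝ)
  support_g : ∀ l : ℤ, ∃ s : ℤ, ∀ n : ℤ, g l n ≠ 0 → s ≤ n ∧ n < s + M
  support_h : ∀ l : ℤ, ∃ s : ℤ, ∀ n : ℤ, h l n ≠ 0 → s ≤ n ∧ n < s + M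

/-- The partial products `∏_{j=1}^J a⁽ˡ⁻ʲ⁾(2⁻ʲ k) / √2`. -/
def scalingProduct (a : ℤ → ℤ → ℝ) (l : ℤ) (J : ℕ) (k : ℝ) : ℂ :=
  ∏ j ∈ Finset.Icc 1 J, freq (a (l - (j : ℤ))) (k / 2 ^ j) / (√2 : ℝ)

/-- The cascade iterates, started from the indicator function `χ` of `[0, 1)`; the Fourier
transform of the `J`-th one is `scalingProduct a l J k` times the Fourier transform of `χ` at
`2⁻ᴶ k`. -/
def cascade (a : ℤ → ℤ → ℝ) : ℤ → ℕ → ℝ → ℝ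
  | _, 0 => Set.indicator (Set.Ico (0 : ℝ) 1) 1
  | l, J + 1 => fun x => √2 * ∑' n : ℤ, a (l - 1) n * cascade a (l - 1) J (2 * x - n)

/-- `φ` is the (generalized) scaling function of the filters `a` at layer `l`: its Fourier
transform is `∏_{j ≥ 1} a⁽ˡ⁻ʲ⁾(2⁻ʲ k) / √2`, where the product converges both pointwise and, as a
limit of cascade iterates, in `L²(ℝ)`. -/
structure IsScalingFunction (a : ℤ → ℤ → ℝ) (l : ℤ) (φ : ℝ → ℝ) : Prop where
  memLp : MemLp φ 2 volume
  integrable : Integrable φ volume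
  fourier : ∀ k : ℝ, Filter.Tendsto (fun J : ℕ => scalingProduct a l J k) Filter.atTop
    (𝓝 (∫ x : ℝ, (φ x : ℂ) * Complex.exp (-(Complex.I * k * x))))
  cascade_tendsto : Filter.Tendsto
    (fun J : ℕ => eLpNorm (fun x => cascade a l J x - φ x) 2 volume) Filter.atTop (𝓝 0)

/-- Stability of the filters `a` up to layer `L`: the scaling functions of the layers `0, …, L`
exist, are square integrable, and are bounded by `B`. -/
def ScalingBounded (a : ℤ → ℤ → ℝ) (L : ℕ) (B : ℝ) : Prop :=
  ∀ l : ℕ, l ≤ L → ∃ φ : ℝ → ℝ, IsScalingFunction a l φ ∧ ∀ᵐ x ∂volume, |φ x| ≤ B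

/-- The wavelet filters of the layers `0, …, L - 1` reproduce the renormalized dispersion relations
up to an error `ε`. -/
def ApproxDispersion (ω : ℝ → ℝ) (g h : ℤ → ℤ → ℝ) (L : ℕ) (ε : ℝ) : Prop :=
  ∀ l : ℕ, l < L → ∀ k : ℝ,
    ‖freq (waveletFilter (h l)) k -
      ((renormDispersion ω l k / renormDispersion ω l Real.pi : ℝ) : ℂ) *
        freq (waveletFilter (g l)) k‖ ≤ ε

/-- The decomposition maps of consecutive layers among `0, …, L - 1` are bounded by `D` for the
filters `g`, `h` and `g̃`.  For `g̃` this includes that the filters exist as elements of `ℓ²(ℤ)`. -/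
structure DecompositionBounded (ω : ℝ → ℝ) (g h : ℤ → ℤ → ℝ) (L : ℕ) (D : ℝ) : Prop where
  bound_g : LayersBounded (fun l => decompose (bank (g l) (h l))) L D
  bound_h : LayersBounded (fun l => decompose (bank (h l) (g l))) L D
  tilde_memLp : ∀ l : ℕ, l < L →
    MemLp (tildeScalingSymbol (renormDispersion ω l) (h l)) 2
      (volume.restrict (Set.Ioc (-Real.pi) Real.pi))
  bound_tilde :
    LayersBounded (fun l => decompose (tildeBank (renormDispersion ω l) (g l) (h l))) L D

/-! ### The MERA covariance matrices -/

/-- The unit signal at `i`. -/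
def delta (i : ℤ) : Signal := Pi.single i 1

/-- The matrix element `(Rᵀ R)_{ij} = ⟨R δ_i, R δ_j⟩` of the map `R` built from the layers
`T 0, …, T (L - 1)`. -/
def gram (T : ℕ → Signal → Signal × Signal) (L : ℕ) (i j : ℤ) : ℝ :=
  (∑' n : ℤ, lowPart T 0 L (delta i) n * lowPart T 0 L (delta j) n) +
    ∑ l ∈ Finset.range L, ∑' n : ℤ, highPart T 0 l (delta i) n * highPart T 0 l (delta j) n

/-- The layers `R_{g⁽ˡ⁾} = √(ω⁽ˡ⁾(π)) W_{g⁽ˡ⁾}`. -/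
def layerG (ω : ℝ → ℝ) (g h : ℤ → ℤ → ℝ) (l : ℕ) (f : Signal) : Signal × Signal :=
  √(renormDispersion ω l Real.pi) • decompose (bank (g l) (h l)) f

/-- The layers `R_{h⁽ˡ⁾} = (1 / √(ω⁽ˡ⁾(π))) W_{h⁽ˡ⁾}`. -/
def layerH (ω : ℝ → ℝ) (g h : ℤ → ℤ → ℝ) (l : ℕ) (f : Signal) : Signal × Signal :=
  (1 / √(renormDispersion ω l Real.pi)) • decompose (bank (h l) (g l)) f

/-- The `L`-layer MERA two-point function `⟨p_i p_j⟩`, with covariance matrix `½ R_gᵀ R_g`. -/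
def meraP (ω : ℝ → ℝ) (g h : ℤ → ℤ → ℝ) (L : ℕ) (i j : ℤ) : ℝ :=
  1 / 2 * gram (layerG ω g h) L i j

/-- The `L`-layer MERA two-point function `⟨q_i q_j⟩`, with covariance matrix `½ R_hᵀ R_h`. -/
def meraQ (ω : ℝ → ℝ) (g h : ℤ → ℤ → ℝ) (L : ℕ) (i j : ℤ) : ℝ :=
  1 / 2 * gram (layerH ω g h) L i j

/-- The regulated MERA two-point function. -/
def meraQReg (ω : ℝ → ℝ) (g h : ℤ → ℤ → ℝ) (L : ℕ) (i j : ℤ) : ℝ :=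
  meraQ ω g h L i j - meraQ ω g h L i i

end BosonicMERA

end

open BosonicMERA

noncomputable section

namespace BosonicMERA

/-! ### Fourier transforms of finitely supported sequences -/

/-! Write `ρ(k) = ω⁽ˡ⁾(k) / ω⁽ˡ⁾(π)`. If `h_s(k + π) = ρ(k) g_s(k + π)` held exactly, perfect
reconstruction would let one layer split the quadratic form with symbol `ρ` into the unweighted form
of the high-frequency output and the form with symbol `ω⁽ˡ⁺¹⁾` of the low-frequency output, since
`ω⁽ˡ⁺¹⁾(2k) = ρ(k) ρ(k + π)`. The proof measures what is lost: a defect per layer, controlled by the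
deviation of the filters from the exact relation (`layerDefect_eq`, `integral_layer`), and at the
end the replacement of the symbol `ω⁽ᴸ⁾` by `1`. `norm_integral_sub_layers_le` adds these up.
Position correlations follow the same pattern with inverted symbols and with `g` and `h` exchanged.

The sum over layers converges because the low-frequency output of a unit signal decays. That output
is `2^{l/2}` times an integral of a layer-`l` cascade of one filter against a layer-`0` cascade of
its dual, compressed by `2 ^ l` (`lowIter_delta_eq_integral`). In the limit both factors are bounded
and the integration runs over length `O(2 ^ (-l))`, so the entries are `O(2^{-l/2})`
(`abs_lowIter_delta_le`); at most `M + 1` of them are nonzero. Two such factors make the layer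
defects `O(ε 2 ^ (-l))`, apart from weights. For momenta the weights `∏ ω⁽ʲ⁾(π)` are at most `√(m² +
1)`. For positions with `m > 0`, the inverse weight times the largest value `1 / ω⁽ˡ⁾(0)` of the
inverse symbol is exactly `1 / m`.

For `m = 0` the inverse symbol is singular, and two further facts are needed. Square summability of
`g̃` forces `h_s(π) = 0`, so `h_s(k) - |cos (k/2)| g_s(k)` vanishes at `0` and at `π`; as filters
have bounded length, its smallness then improves to `O(ε |sin k|)` (`exists_massless_defect_bound`),
which cancels the singularity. Secondly, the regulated function pairs `δ_i` with `δ_j - δ_i`.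
Dividing the latter by `|sin (k/2)|` turns the layers of `h` into those of `g̃`, up to a factor `2`
per layer (`decimate_tilde_divDispersion`). The bound `D` for `g̃` therefore gives `L²`, hence `L¹`,
control with constant `√|i - j|`, while `δ_i` contributes its uniform decay `2^{-l/2}`.

All these sums are geometric. The logarithm enters only through `ε ≤ 2 ε log (1/ε)`. -/

theorem freq_eq_sum {a : ℤ → ℝ} {s : Finset ℤ} (hs : ∀ n, a n ≠ 0 → n ∈ s) (k : ℝ) :
    freq a k = ∑ n ∈ s, (a n : ℂ) * Complex.exp (-(Complex.I * k * n)) := by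
  unfold freq
  refine tsum_eq_sum fun n hn => ?_
  have : a n = 0 := by by_contra h; exact hn (hs n h)
  simp [this]

theorem norm_exp_I_mul (x : ℝ) : ‖Complex.exp (Complex.I * x)‖ = 1 := by
  rw [mul_comm]; exact Complex.norm_exp_ofReal_mul_I x

theorem norm_freq_term (x : ℝ) (k : ℝ) (n : ℤ) :
    ‖(x : ℂ) * Complex.exp (-(Complex.I * k * n))‖ = |x| := by
  have : -(Complex.I * k * n) = Complex.I * ((-(k * n) : ℝ) : ℂ) := by push_cast; ring
  rw [norm_mul, this, norm_exp_I_mul]; simp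

theorem norm_freq_le {a : ℤ → ℝ} {s : Finset ℤ} (hs : ∀ n, a n ≠ 0 → n ∈ s) {c : ℝ}
    (hc : ∀ n, |a n| ≤ c) (k : ℝ) : ‖freq a k‖ ≤ s.card * c := by
  rw [freq_eq_sum hs, ← nsmul_eq_mul, ← Finset.sum_const]
  refine norm_sum_le_of_le s fun n _ => ?_
  rw [norm_freq_term]; exact hc n

theorem exists_finset_of_finite {a : ℤ → ℝ} (ha : (Function.support a).Finite) :
    ∃ s : Finset ℤ, ∀ n, a n ≠ 0 → n ∈ s :=
  ⟨ha.toFinset, fun _ hn => ha.mem_toFinset.2 hn⟩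

theorem continuous_freq {a : ℤ → ℝ} (ha : (Function.support a).Finite) : Continuous (freq a) := by
  obtain ⟨s, hs⟩ := exists_finset_of_finite ha
  rw [show freq a = _ from funext (freq_eq_sum hs)]
  fun_prop

theorem freq_add_two_pi (a : ℤ → ℝ) (k : ℝ) : freq a (k + 2 * Real.pi) = freq a k := by
  unfold freq
  congr 1; ext n; congr 1
  have := Complex.exp_periodic.int_mul (-n) (-(Complex.I * k * n))
  rw [← this]; congr 1; push_cast; ring

theorem conj_freq_term (x : ℝ) (k : ℝ) (n : ℤ) :
    conj ((x : ℂ) * Complex.exp (-(Complex.I * k * n))) =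
      x * Complex.exp (Complex.I * k * n) := by
  rw [map_mul, Complex.conj_ofReal, ← Complex.exp_conj]
  simp

theorem conj_freq (a : ℤ → ℝ) (k : ℝ) : conj (freq a k) = freq a (-k) := by
  unfold freq
  rw [Complex.conj_tsum]
  congr 1; ext n; rw [conj_freq_term]; simp

theorem freq_sub {a b : ℤ → ℝ} (ha : (Function.support a).Finite)
    (hb : (Function.support b).Finite) (k : ℝ) :
    freq (fun n => a n - b n) k = freq a k - freq b k := by
  obtain ⟨s, hs⟩ := exists_finset_of_finite ha
  obtain ⟨t, ht⟩ := exists_finset_of_finite hb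
  have h1 : ∀ n, a n ≠ 0 → n ∈ s ∪ t := fun n hn => Finset.mem_union_left _ (hs n hn)
  have h2 : ∀ n, b n ≠ 0 → n ∈ s ∪ t := fun n hn => Finset.mem_union_right _ (ht n hn)
  have h3 : ∀ n, a n - b n ≠ 0 → n ∈ s ∪ t := fun n hn => by
    by_cases h : a n = 0
    · exact h2 n fun h' => hn (by rw [h, h', sub_zero])
    · exact h1 n h
  rw [freq_eq_sum h1, freq_eq_sum h2, freq_eq_sum h3, ← Finset.sum_sub_distrib]
  refine Finset.sum_congr rfl fun n _ => ?_
  push_cast; ring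

theorem support_delta_finite (i : ℤ) : (Function.support (delta i)).Finite :=
  (Set.finite_singleton i).subset fun n hn => by
    by_contra h
    exact hn (by simp [delta, Pi.single_apply]; exact h)

theorem freq_delta (i : ℤ) (k : ℝ) : freq (delta i) k = Complex.exp (-(Complex.I * k * i)) := by
  rw [freq_eq_sum (s := {i})]
  · simp [delta]
  · intro n hn
    by_contra h
    exact hn (by simp [delta, Pi.single_apply]; simpa using h)

theorem freq_waveletFilter {b : ℤ → ℝ} (k : ℝ) :
    freq (waveletFilter b) k =
      Complex.exp (-(Complex.I * k)) * conj (freq b (k + Real.pi)) := by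
  unfold freq
  rw [Complex.conj_tsum, ← tsum_mul_left, ← (Equiv.subLeft (1 : ℤ)).tsum_eq]
  congr 1; ext n
  rw [conj_freq_term]
  simp only [waveletFilter, Equiv.subLeft_apply, sub_sub_cancel]
  push_cast
  have h : Complex.exp (Complex.I * (k + Real.pi) * n) =
      Complex.exp (Complex.I * k * n) * (-1) ^ n := by
    rw [show Complex.I * (k + Real.pi) * n = Complex.I * k * n + n * (Real.pi * Complex.I) by ring,
      Complex.exp_add, Complex.exp_int_mul, Complex.exp_pi_mul_I]
  rw [h, show -(Complex.I * k * (1 - (n : ℂ))) = -(Complex.I * k) + Complex.I * k * n by ring,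
    Complex.exp_add]
  ring

theorem support_waveletFilter_finite {b : ℤ → ℝ} (hb : (Function.support b).Finite) :
    (Function.support (waveletFilter b)).Finite := by
  refine (hb.preimage (f := fun n : ℤ => 1 - n) ?_).subset fun n hn => ?_
  · intro x _ y _ h; simpa using h
  · intro h
    exact hn (by simp only [waveletFilter]; rw [h]; simp)

theorem support_decimate_finite {a f : ℤ → ℝ} (ha : (Function.support a).Finite)
    (hf : (Function.support f).Finite) : (Function.support (decimate a f)).Finite := by
  have : (Function.support (decimate a f)) ⊆
      (fun n : ℤ => 2 * n) ⁻¹' (Set.image2 (fun p r => p - r) (Function.support f)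
        (Function.support a)) := by
    intro n hn
    have : ∃ l, a l * f (2 * n + l) ≠ 0 := by
      by_contra h; push Not at h
      exact hn (by simp only [decimate]; simp [h])
    obtain ⟨l, hl⟩ := this
    exact ⟨2 * n + l, right_ne_zero_of_mul hl, l, left_ne_zero_of_mul hl, by simp⟩
  exact ((hf.image2 _ ha).preimage fun x _ y _ h => by simpa using h).subset this

/-- Downsampling averages a Fourier transform over the two preimages of `2 k`. -/
theorem tsum_even_shift {f : ℤ → ℝ} (hf : (Function.support f).Finite) (r : ℤ) (k : ℝ) :
    ∑' n : ℤ, (f (2 * n + r) : ℂ) * Complex.exp (-(Complex.I * (2 * k) * n)) =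
      Complex.exp (Complex.I * k * r) * (1 / 2 * (freq f k + (-1) ^ r * freq f (k + Real.pi))) := by
  obtain ⟨s, hs⟩ := exists_finset_of_finite hf
  have hadd : Complex.exp (Complex.I * k * r) *
      (1 / 2 * (freq f k + (-1) ^ r * freq f (k + Real.pi))) =
      ∑' p : ℤ, (1 + (-1) ^ (p - r)) / 2 *
        ((f p : ℂ) * Complex.exp (-(Complex.I * k * (p - r)))) := by
    rw [freq_eq_sum hs, freq_eq_sum hs, tsum_eq_sum (s := s), Finset.mul_sum,
      ← Finset.sum_add_distrib, Finset.mul_sum, Finset.mul_sum]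
    · refine Finset.sum_congr rfl fun p _ => ?_
      have h1 : Complex.exp (-(Complex.I * ((k + Real.pi : ℝ) : ℂ) * p)) =
          Complex.exp (-(Complex.I * k * p)) * (-1) ^ p := by
        rw [show -(Complex.I * ((k + Real.pi : ℝ) : ℂ) * p) =
          -(Complex.I * k * p) + ((-p : ℤ) : ℂ) * (Real.pi * Complex.I) by push_cast; ring,
          Complex.exp_add, Complex.exp_int_mul, Complex.exp_pi_mul_I]
        congr 1
        rw [zpow_neg, ← inv_zpow]; norm_num
      have h2 : ((-1 : ℂ)) ^ (p - r) = (-1) ^ p * (-1) ^ r := by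
        rw [zpow_sub₀ (by norm_num), div_eq_mul_inv, ← inv_zpow]; norm_num
      rw [h1, h2,
        show -(Complex.I * k * (p - r)) = Complex.I * k * r + -(Complex.I * k * p) by ring,
        Complex.exp_add]
      ring
    · intro p hp
      have : f p = 0 := by by_contra h; exact hp (hs p h)
      simp [this]
  rw [hadd]
  symm
  -- The factor `(1 + (-1) ^ (p - r)) / 2` is the indicator of `p ≡ r` mod `2`, so the sum lives on
  -- the range of `n ↦ 2 * n + r`.
  have hinj : Function.Injective (fun n : ℤ => 2 * n + r) := fun x y h => by simpa using h
  rw [← hinj.tsum_eq]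
  · congr 1; ext n
    rw [show 2 * n + r - r = 2 * n by ring, zpow_mul]
    push_cast
    rw [show -(Complex.I * (k : ℂ) * (2 * n + r - r)) = -(Complex.I * (2 * k) * n) by ring]
    norm_num
  · intro p hp
    rcases Int.even_or_odd (p - r) with ⟨n, hn⟩ | ho
    · exact ⟨n, by simp only; omega⟩
    · exact absurd (by simp [ho.neg_one_zpow]) hp

theorem freq_decimate {a f : ℤ → ℝ} (ha : (Function.support a).Finite)
    (hf : (Function.support f).Finite) (k : ℝ) :
    freq (decimate a f) (2 * k) =
      1 / 2 * (conj (freq a k) * freq f k +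
        conj (freq a (k + Real.pi)) * freq f (k + Real.pi)) := by
  obtain ⟨s, hs⟩ := exists_finset_of_finite ha
  have hd : ∀ n, (decimate a f n : ℂ) = ∑ r ∈ s, (a r : ℂ) * f (2 * n + r) := fun n => by
    unfold decimate
    rw [tsum_eq_sum (s := s)]
    · push_cast; rfl
    · intro r hr
      have : a r = 0 := by by_contra h; exact hr (hs r h)
      simp [this]
  have hsum : ∀ r : ℤ, Summable fun n : ℤ =>
      (f (2 * n + r) : ℂ) * Complex.exp (-(Complex.I * (2 * k) * n)) := fun r => by
    apply summable_of_hasFiniteSupport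
    refine (hf.preimage (f := fun n : ℤ => 2 * n + r) ?_).subset fun n hn => ?_
    · intro x _ y _ h; simpa using h
    · intro h; exact hn (by simp only; rw [h]; simp)
  unfold freq
  simp_rw [hd, Finset.sum_mul]
  rw [Summable.tsum_finsetSum]
  · change _ = 1 / 2 * (conj (freq a k) * freq f k + conj (freq a (k + Real.pi)) *
      freq f (k + Real.pi))
    rw [freq_eq_sum hs, freq_eq_sum hs, map_sum, map_sum, Finset.sum_mul, Finset.sum_mul,
      ← Finset.sum_add_distrib, Finset.mul_sum]
    refine Finset.sum_congr rfl fun r _ => ?_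
    rw [conj_freq_term, conj_freq_term]
    simp_rw [mul_assoc]
    rw [tsum_mul_left]
    have := tsum_even_shift hf r k
    push_cast
    simp_rw [mul_assoc] at this ⊢
    rw [this]
    have h : Complex.exp (Complex.I * ((k + Real.pi) * r)) =
        Complex.exp (Complex.I * (k * r)) * (-1) ^ r := by
      rw [show Complex.I * ((k + Real.pi) * r) = Complex.I * (k * r) + r * (Real.pi * Complex.I) by
        ring, Complex.exp_add, Complex.exp_int_mul, Complex.exp_pi_mul_I]
    rw [h]
    ring
  · intro r _
    have := (hsum r).mul_left (a r : ℂ)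
    refine this.congr fun n => ?_
    push_cast; ring

theorem integral_exp_int (n : ℤ) :
    ∫ k in (-Real.pi)..Real.pi, Complex.exp (Complex.I * k * n) =
      if n = 0 then 2 * (Real.pi : ℂ) else 0 := by
  split_ifs with h
  · subst h; simp; ring
  · have hc : Complex.I * n ≠ 0 := by simp [h]
    have := integral_exp_mul_complex (a := -Real.pi) (b := Real.pi) hc
    rw [show (fun k : ℝ => Complex.exp (Complex.I * k * n)) =
      fun k : ℝ => Complex.exp (Complex.I * n * k) by ext k; ring_nf, this, div_eq_zero_iff]
    left
    rw [sub_eq_zero, show Complex.I * (n : ℂ) * (Real.pi : ℝ) =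
      Complex.I * n * (-Real.pi : ℝ) + n * (2 * Real.pi * Complex.I) by push_cast; ring]
    exact Complex.exp_periodic.int_mul n _

/-- Parseval's identity for finitely supported real sequences. -/
theorem integral_conj_freq_mul_freq {f g : ℤ → ℝ} (hf : (Function.support f).Finite)
    (hg : (Function.support g).Finite) :
    ∫ k in (-Real.pi)..Real.pi, conj (freq f k) * freq g k =
      2 * (Real.pi : ℂ) * ((∑' n : ℤ, f n * g n : ℝ) : ℂ) := by
  obtain ⟨s, hs⟩ := exists_finset_of_finite hf
  obtain ⟨t, ht⟩ := exists_finset_of_finite hg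
  have h : ∀ k : ℝ, conj (freq f k) * freq g k = ∑ p ∈ s, ∑ q ∈ t,
      ((f p : ℂ) * g q) * Complex.exp (Complex.I * k * ((p - q : ℤ) : ℂ)) := fun k => by
    rw [freq_eq_sum hs, freq_eq_sum ht, map_sum, Finset.sum_mul_sum]
    refine Finset.sum_congr rfl fun p _ => Finset.sum_congr rfl fun q _ => ?_
    rw [conj_freq_term, show Complex.I * k * ((p - q : ℤ) : ℂ) =
      Complex.I * k * p + -(Complex.I * k * q) by push_cast; ring, Complex.exp_add]
    ring
  simp_rw [h]
  have hint : ∀ n : ℤ, IntervalIntegrable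
      (fun k : ℝ => Complex.exp (Complex.I * k * n)) volume (-Real.pi) Real.pi := fun n =>
    Continuous.intervalIntegrable (by fun_prop) _ _
  rw [intervalIntegral.integral_finsetSum fun p _ =>
    Continuous.intervalIntegrable (by fun_prop) _ _]
  rw [tsum_eq_sum (s := s) fun n hn => by
    have : f n = 0 := by by_contra h; exact hn (hs n h)
    simp [this]]
  push_cast
  rw [Finset.mul_sum]
  refine Finset.sum_congr rfl fun p _ => ?_
  rw [intervalIntegral.integral_finsetSum fun q _ =>
    Continuous.intervalIntegrable (by fun_prop) _ _]
  simp_rw [intervalIntegral.integral_const_mul]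
  have h' : ∀ q : ℤ, ∫ k in (-Real.pi)..Real.pi, Complex.exp (Complex.I * k * ((p : ℂ) - q)) =
      if p = q then 2 * (Real.pi : ℂ) else 0 := fun q => by
    simpa [sub_eq_zero] using integral_exp_int (p - q)
  simp_rw [h', mul_ite, mul_zero]
  rw [Finset.sum_ite_eq]
  split_ifs with hp
  · ring
  · have : g p = 0 := by by_contra h; exact hp (ht p h)
    simp [this]

/-! ### Integrals of periodic functions under doubling and half-period shifts. -/

theorem intervalIntegrable_of_periodic {E : Type*} [NormedAddCommGroup E] {F : ℝ → E}
    (hF : Function.Periodic F (2 * Real.pi))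
    (hi : IntervalIntegrable F volume (-Real.pi) Real.pi) (a b : ℝ) :
    IntervalIntegrable F volume a b :=
  hF.intervalIntegrable Real.two_pi_pos.ne' (t := -Real.pi)
    (by rwa [show -Real.pi + 2 * Real.pi = Real.pi by ring]) a b

theorem integral_comp_two_mul {F : ℝ → ℂ} (hF : Function.Periodic F (2 * Real.pi))
    (hi : IntervalIntegrable F volume (-Real.pi) Real.pi) :
    ∫ k in (-Real.pi)..Real.pi, F (2 * k) = ∫ k in (-Real.pi)..Real.pi, F k := by
  rw [intervalIntegral.integral_comp_mul_left F (two_ne_zero)]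
  have h := hF.intervalIntegral_add_zsmul_eq 2 (-(2 * Real.pi))
    (intervalIntegrable_of_periodic hF hi)
  have h1 := hF.intervalIntegral_add_eq (-(2 * Real.pi)) (-Real.pi)
  rw [show -(2 * Real.pi) + (2 : ℤ) • (2 * Real.pi) = 2 * Real.pi by
    rw [zsmul_eq_mul]; push_cast; ring] at h
  rw [show -(2 * Real.pi) + 2 * Real.pi = 0 by ring,
    show -Real.pi + 2 * Real.pi = Real.pi by ring] at h1
  rw [show 2 * -Real.pi = -(2 * Real.pi) by ring, h]
  simp [h1]

theorem integral_comp_add_pi {E : Type*} [NormedAddCommGroup E] [NormedSpace ℝ E] {F : ℝ → E}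
    (hF : Function.Periodic F (2 * Real.pi)) :
    ∫ k in (-Real.pi)..Real.pi, F (k + Real.pi) = ∫ k in (-Real.pi)..Real.pi, F k := by
  rw [intervalIntegral.integral_comp_add_right]
  have h1 := hF.intervalIntegral_add_eq 0 (-Real.pi)
  rw [show -Real.pi + 2 * Real.pi = Real.pi by ring] at h1
  rw [← h1]; congr 1 <;> ring

/-! ### The renormalized dispersion relations of the harmonic chain -/

/-- The renormalized dispersion relations of the harmonic chain of mass `m`. -/
abbrev chainRenorm (m : ℝ) (l : ℕ) : ℝ → ℝ := renormDispersion (chainDispersion m) l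

/-- Renormalization preserves this shape: `(μ + sin² x)(μ + cos² x) = (4μ(μ + 1) + sin² (2x)) / 4`,
so the squared mass flows by `μ ↦ 4μ(μ + 1)`. Monotonicity, continuity and periodicity are all read
off from it. -/
theorem chainRenorm_form (m : ℝ) (l : ℕ) : ∃ A μ : ℝ, 0 < A ∧ 0 ≤ μ ∧
    ∀ k, chainRenorm m l k = A * √(μ + Real.sin (k / 2) ^ 2) := by
  induction l with
  | zero =>
    exact ⟨1, m ^ 2, one_pos, sq_nonneg m, fun k => by
      simp [chainRenorm, renormDispersion, chainDispersion_eq]⟩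
  | succ l ih =>
    obtain ⟨A, μ, hA, hμ, h⟩ := ih
    refine ⟨1 / (2 * (μ + 1)), 4 * μ * (μ + 1), by positivity, by positivity, fun k => ?_⟩
    have hpi : chainRenorm m l Real.pi = A * √(μ + 1) := by rw [h]; simp
    have hc : Real.sin ((k / 2 + Real.pi) / 2) = Real.cos (k / 2 / 2) := by
      rw [show (k / 2 + Real.pi) / 2 = k / 2 / 2 + Real.pi / 2 by ring, Real.sin_add_pi_div_two]
    have hs : Real.sin (k / 2) = 2 * Real.sin (k / 2 / 2) * Real.cos (k / 2 / 2) := by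
      rw [← Real.sin_two_mul]; ring_nf
    change chainRenorm m l (k / 2) / chainRenorm m l Real.pi *
      (chainRenorm m l (k / 2 + Real.pi) / chainRenorm m l Real.pi) = _
    rw [hpi, h, h, hc, mul_div_mul_left _ _ hA.ne', mul_div_mul_left _ _ hA.ne', div_mul_div_comm,
      Real.mul_self_sqrt (by positivity), ← Real.sqrt_mul (by positivity),
      show 4 * μ * (μ + 1) + Real.sin (k / 2) ^ 2 = 2 ^ 2 *
        ((μ + Real.sin (k / 2 / 2) ^ 2) * (μ + Real.cos (k / 2 / 2) ^ 2)) by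
        rw [hs]
        linear_combination -4 * μ * Real.sin_sq_add_cos_sq (k / 2 / 2),
      Real.sqrt_mul (show (0 : ℝ) ≤ 2 ^ 2 by norm_num), Real.sqrt_sq zero_le_two]
    field_simp

theorem chainRenorm_nonneg (m : ℝ) (l : ℕ) (k : ℝ) : 0 ≤ chainRenorm m l k := by
  obtain ⟨A, μ, hA, hμ, h⟩ := chainRenorm_form m l
  rw [h]; positivity

theorem chainRenorm_pi_pos (m : ℝ) (l : ℕ) : 0 < chainRenorm m l Real.pi := by
  obtain ⟨A, μ, hA, hμ, h⟩ := chainRenorm_form m l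
  rw [h]; simp; positivity

theorem chainRenorm_le_pi (m : ℝ) (l : ℕ) (k : ℝ) :
    chainRenorm m l k ≤ chainRenorm m l Real.pi := by
  obtain ⟨A, μ, hA, hμ, h⟩ := chainRenorm_form m l
  rw [h, h]
  gcongr A * √(μ + ?_)
  rw [Real.sin_pi_div_two, one_pow]
  exact Real.sin_sq_le_one (k / 2)

theorem chainRenorm_zero_le (m : ℝ) (l : ℕ) (k : ℝ) :
    chainRenorm m l 0 ≤ chainRenorm m l k := by
  obtain ⟨A, μ, hA, hμ, h⟩ := chainRenorm_form m l
  rw [h, h]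
  gcongr ?_ * √(_ + ?_)
  simpa using sq_nonneg (Real.sin (k / 2))

theorem continuous_chainRenorm (m : ℝ) (l : ℕ) : Continuous (chainRenorm m l) := by
  obtain ⟨A, μ, hA, hμ, h⟩ := chainRenorm_form m l
  rw [funext h]; fun_prop

theorem chainRenorm_periodic (m : ℝ) (l : ℕ) :
    Function.Periodic (chainRenorm m l) (2 * Real.pi) := by
  obtain ⟨A, μ, hA, hμ, h⟩ := chainRenorm_form m l
  intro k
  rw [h, h, show (k + 2 * Real.pi) / 2 = k / 2 + Real.pi by ring, Real.sin_add_pi, neg_sq]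

theorem chainRenorm_succ_two_mul (m : ℝ) (l : ℕ) (k : ℝ) :
    chainRenorm m (l + 1) (2 * k) = chainRenorm m l k / chainRenorm m l Real.pi *
      (chainRenorm m l (k + Real.pi) / chainRenorm m l Real.pi) := by
  simp [chainRenorm, renormDispersion]

theorem chainRenorm_ratio_le_one (m : ℝ) (l : ℕ) (k : ℝ) :
    chainRenorm m l k / chainRenorm m l Real.pi ≤ 1 :=
  div_le_one_of_le₀ (chainRenorm_le_pi m l k) (chainRenorm_nonneg _ _ _)

theorem chainRenorm_ratio_nonneg (m : ℝ) (l : ℕ) (k : ℝ) :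
    0 ≤ chainRenorm m l k / chainRenorm m l Real.pi :=
  div_nonneg (chainRenorm_nonneg _ _ _) (chainRenorm_nonneg _ _ _)

theorem chainRenorm_succ_le_one (m : ℝ) (l : ℕ) (k : ℝ) : chainRenorm m (l + 1) k ≤ 1 := by
  have := chainRenorm_succ_two_mul m l (k / 2)
  rw [mul_div_cancel₀ k two_ne_zero] at this
  rw [this]
  exact mul_le_one₀ (chainRenorm_ratio_le_one _ _ _) (chainRenorm_ratio_nonneg _ _ _)
    (chainRenorm_ratio_le_one _ _ _)

/-- The product of the normalization constants of the first `l` layers. -/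
def layerWeight (m : ℝ) (l : ℕ) : ℝ := ∏ j ∈ Finset.range l, chainRenorm m j Real.pi

theorem layerWeight_succ (m : ℝ) (l : ℕ) :
    layerWeight m (l + 1) = layerWeight m l * chainRenorm m l Real.pi :=
  Finset.prod_range_succ _ _

theorem layerWeight_pos (m : ℝ) (l : ℕ) : 0 < layerWeight m l :=
  Finset.prod_pos fun _ _ => chainRenorm_pi_pos _ _

/-- The first factor is `ω(π) = √(m² + 1)`; every later one is at most `1`. -/
theorem layerWeight_le (m : ℝ) (l : ℕ) : layerWeight m l ≤ √(m ^ 2 + 1) := by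
  induction l with
  | zero => simp [layerWeight]; positivity
  | succ l ih =>
    rw [layerWeight_succ]
    cases l with
    | zero => simp [layerWeight, chainRenorm, renormDispersion, chainDispersion_eq]
    | succ l =>
      exact (mul_le_of_le_one_right (layerWeight_pos _ _).le (chainRenorm_succ_le_one _ _ _)).trans
        ih

/-- An invariant of the flow, because `ω⁽ˡ⁺¹⁾(0) = ω⁽ˡ⁾(0) / ω⁽ˡ⁾(π)`. It is the source of the
factor `1 / m` in the position correlations. -/
theorem layerWeight_mul_zero {m : ℝ} (hm : 0 ≤ m) (l : ℕ) :
    layerWeight m l * chainRenorm m l 0 = m := by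
  induction l with
  | zero => simp [layerWeight, chainRenorm, renormDispersion, chainDispersion_eq, Real.sqrt_sq hm]
  | succ l ih =>
    have h := chainRenorm_succ_two_mul m l 0
    have hp := chainRenorm_pi_pos m l
    rw [mul_zero, zero_add, div_self hp.ne', mul_one] at h
    rw [layerWeight_succ, h, mul_assoc, mul_div_cancel₀ _ hp.ne', ih]

theorem chainRenorm_pos {m : ℝ} (hm : 0 < m) (l : ℕ) (k : ℝ) : 0 < chainRenorm m l k := by
  refine lt_of_lt_of_le ?_ (chainRenorm_zero_le m l k)
  have := layerWeight_mul_zero hm.le l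
  rw [← this] at hm
  exact pos_of_mul_pos_right hm (layerWeight_pos m l).le

/-! ### The massless chain, whose normalized dispersion relation is a fixed point. -/

theorem chainRenorm_massless_zero (k : ℝ) : chainRenorm 0 0 k = |Real.sin (k / 2)| := by
  simp [chainRenorm, renormDispersion, chainDispersion_eq, Real.sqrt_sq_eq_abs]

theorem chainRenorm_massless_succ_of_ratio {l : ℕ} (ih : ∀ k, chainRenorm 0 l k /
    chainRenorm 0 l Real.pi = |Real.sin (k / 2)|) (k : ℝ) :
    chainRenorm 0 (l + 1) k = 1 / 2 * |Real.sin (k / 2)| := by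
  have := chainRenorm_succ_two_mul 0 l (k / 2)
  rw [mul_div_cancel₀ k two_ne_zero, ih, ih,
    show (k / 2 + Real.pi) / 2 = k / 2 / 2 + Real.pi / 2 by ring, Real.sin_add_pi_div_two,
    ← abs_mul] at this
  rw [this, show Real.sin (k / 2) = 2 * (Real.sin (k / 2 / 2) * Real.cos (k / 2 / 2)) by
    rw [← mul_assoc, ← Real.sin_two_mul]; ring_nf, abs_mul 2, abs_two]
  ring

theorem chainRenorm_massless_ratio (l : ℕ) (k : ℝ) :
    chainRenorm 0 l k / chainRenorm 0 l Real.pi = |Real.sin (k / 2)| := by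
  induction l generalizing k with
  | zero => simp [chainRenorm_massless_zero]
  | succ l ih =>
    rw [chainRenorm_massless_succ_of_ratio ih, chainRenorm_massless_succ_of_ratio ih,
      Real.sin_pi_div_two, abs_one]
    ring

theorem chainRenorm_massless_succ (l : ℕ) (k : ℝ) :
    chainRenorm 0 (l + 1) k = 1 / 2 * |Real.sin (k / 2)| :=
  chainRenorm_massless_succ_of_ratio (chainRenorm_massless_ratio l) k

theorem layerWeight_massless (l : ℕ) : (1 / 2 : ℝ) ^ l ≤ layerWeight 0 l := by
  induction l with
  | zero => simp [layerWeight]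
  | succ l ih =>
    rw [layerWeight_succ, pow_succ]
    refine mul_le_mul ih ?_ (by norm_num) (layerWeight_pos _ _).le
    cases l with
    | zero => rw [chainRenorm_massless_zero]; norm_num
    | succ l => rw [chainRenorm_massless_succ]; norm_num

/-! ### The defect of a single layer -/

/-- The failure, at a pair of momenta `k`, `k + π`, of a layer with scaling filter values `a`, `a'`
and dual values `b`, `b'` to reproduce the quadratic form with symbol values `r`, `r'`. -/
def layerDefect (r r' : ℝ) (a a' b b' f f' F F' : ℂ) : ℂ :=
  1 / 2 * (r * (conj f * F) + r' * (conj f' * F')) -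
    (r * r' : ℝ) * (conj (1 / 2 * (conj a * f + conj a' * f')) *
      (1 / 2 * (conj a * F + conj a' * F'))) -
    conj (1 / 2 * (b' * f - b * f')) * (1 / 2 * (b' * F - b * F'))

/-- Inserting half the reconstruction identity into the first term makes all terms quartic in
filters and signals. Each coefficient is then a combination of the deviations `b - r' * a` and `b' -
r * a'`, so the defect vanishes for an exact dispersion relation. -/
theorem layerDefect_eq {r r' : ℝ} {a a' b b' : ℂ} (f f' F F' : ℂ)
    (h : a * conj b + a' * conj b' = 2) :
    layerDefect r r' a a' b b' f f' F F' = 1 / 4 * (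
      (r * conj a * (b - r' * a) - b' * conj (b' - r * a')) * (conj f * F) +
      (b * conj (b' - r * a') + r * conj a' * (b - r' * a)) * (conj f * F') +
      (b' * conj (b - r' * a) + r' * conj a * (b' - r * a')) * (conj f' * F) +
      (r' * conj a' * (b' - r * a') - b * conj (b - r' * a)) * (conj f' * F')) := by
  have h' : conj a * b + conj a' * b' = 2 := by
    have := congrArg conj h
    rwa [map_add, map_mul, map_mul, Complex.conj_conj, Complex.conj_conj, map_ofNat] at this
  simp only [layerDefect, map_mul, map_sub, map_add, Complex.conj_conj, Complex.conj_ofReal,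
    map_div₀, map_one, map_ofNat, Complex.ofReal_mul]
  linear_combination (-(1 / 4 : ℂ) * (r * (conj f * F) + r' * (conj f' * F'))) * h'

theorem norm_layerDefect_le_aux {c₁ c₂ c₃ c₄ f f' F F' : ℂ} {δ : ℝ} (h₁ : ‖c₁‖ ≤ δ) (h₂ : ‖c₂‖ ≤ δ)
    (h₃ : ‖c₃‖ ≤ δ) (h₄ : ‖c₄‖ ≤ δ) :
    ‖1 / 4 * (c₁ * (conj f * F) + c₂ * (conj f * F') + c₃ * (conj f' * F) +
      c₄ * (conj f' * F'))‖ ≤ 1 / 4 * δ * ((‖f‖ + ‖f'‖) * (‖F‖ + ‖F'‖)) := by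
  have key : ∀ {c : ℂ} (u v : ℂ), ‖c‖ ≤ δ → ‖c * (conj u * v)‖ ≤ δ * (‖u‖ * ‖v‖) := fun u v hc => by
    rw [norm_mul, norm_mul, RCLike.norm_conj]
    exact mul_le_mul_of_nonneg_right hc (by positivity)
  have := norm_add₄_le (a := c₁ * (conj f * F)) (b := c₂ * (conj f * F'))
    (c := c₃ * (conj f' * F)) (d := c₄ * (conj f' * F'))
  have e1 := key f F h₁
  have e2 := key f F' h₂
  have e3 := key f' F h₃
  have e4 := key f' F' h₄
  rw [norm_mul]
  norm_num
  nlinarith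

theorem norm_layerDefect_le {r r' S ε : ℝ} {a a' b b' : ℂ} (f f' F F' : ℂ)
    (h : a * conj b + a' * conj b' = 2) (hr : 0 ≤ r) (hr1 : r ≤ 1) (hr' : 0 ≤ r') (hr1' : r' ≤ 1)
    (ha : ‖a‖ ≤ S) (ha' : ‖a'‖ ≤ S) (hb : ‖b‖ ≤ S) (hb' : ‖b'‖ ≤ S)
    (hd : ‖b - r' * a‖ ≤ ε) (hd' : ‖b' - r * a'‖ ≤ ε) :
    ‖layerDefect r r' a a' b b' f f' F F'‖ ≤
      1 / 2 * S * ε * ((‖f‖ + ‖f'‖) * (‖F‖ + ‖F'‖)) := by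
  have hS : 0 ≤ S := (norm_nonneg _).trans ha
  have hε : 0 ≤ ε := (norm_nonneg _).trans hd
  have e1 : ∀ {u v : ℂ}, ‖u‖ ≤ S → ‖v‖ ≤ ε → ‖u * conj v‖ ≤ S * ε := fun hu hv => by
    rw [norm_mul, RCLike.norm_conj]; exact mul_le_mul hu hv (norm_nonneg _) hS
  have e2 : ∀ {t : ℝ} {u v : ℂ}, 0 ≤ t → t ≤ 1 → ‖u‖ ≤ S → ‖v‖ ≤ ε →
      ‖(t : ℂ) * conj u * v‖ ≤ S * ε := fun {t u v} ht ht1 hu hv => by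
    rw [norm_mul, norm_mul, RCLike.norm_conj, Complex.norm_real, Real.norm_of_nonneg ht]
    exact mul_le_mul ((mul_le_of_le_one_left (norm_nonneg _) ht1).trans hu) hv (norm_nonneg _) hS
  rw [layerDefect_eq f f' F F' h, show 1 / 2 * S * ε = 1 / 4 * (S * ε + S * ε) by ring]
  refine norm_layerDefect_le_aux ?_ ?_ ?_ ?_
  · exact (norm_sub_le _ _).trans (add_le_add (e2 hr hr1 ha hd) (e1 hb' hd'))
  · exact (norm_add_le _ _).trans (add_le_add (e1 hb hd') (e2 hr hr1 ha' hd))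
  · exact (norm_add_le _ _).trans (add_le_add (e1 hb' hd) (e2 hr' hr1' ha hd'))
  · exact (norm_sub_le _ _).trans (add_le_add (e2 hr' hr1' ha' hd') (e1 hb hd))

/-- With inverse symbols the two filters exchange roles, and `a - r'⁻¹ b = -r'⁻¹ (b - r' a)` reduces
the deviations to the previous ones. The price is at most `(r * r')⁻¹`, which is the inverse of the
next dispersion relation at `2k`. -/
theorem norm_layerDefect_inv_le {r r' S ε : ℝ} {a a' b b' : ℂ} (f f' F F' : ℂ)
    (h : a * conj b + a' * conj b' = 2) (hr : 0 < r) (hr1 : r ≤ 1) (hr' : 0 < r') (hr1' : r' ≤ 1)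
    (ha : ‖a‖ ≤ S) (ha' : ‖a'‖ ≤ S) (hb : ‖b‖ ≤ S) (hb' : ‖b'‖ ≤ S)
    (hd : ‖b - r' * a‖ ≤ ε) (hd' : ‖b' - r * a'‖ ≤ ε) :
    ‖layerDefect r⁻¹ r'⁻¹ b b' a a' f f' F F'‖ ≤
      1 / 2 * S * (ε * (r * r')⁻¹) * ((‖f‖ + ‖f'‖) * (‖F‖ + ‖F'‖)) := by
  have hS : 0 ≤ S := (norm_nonneg _).trans ha
  have hε : 0 ≤ ε := (norm_nonneg _).trans hd
  have h' : b * conj a + b' * conj a' = 2 := by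
    have := congrArg conj h
    rw [map_add, map_mul, map_mul, Complex.conj_conj, Complex.conj_conj, map_ofNat] at this
    rw [← this]; ring
  have q1 : a - (r'⁻¹ : ℝ) * b = -((r'⁻¹ : ℝ) : ℂ) * (b - r' * a) := by
    have : (r' : ℂ) ≠ 0 := by exact_mod_cast hr'.ne'
    push_cast; field_simp; ring
  have q2 : a' - (r⁻¹ : ℝ) * b' = -((r⁻¹ : ℝ) : ℂ) * (b' - r * a') := by
    have : (r : ℂ) ≠ 0 := by exact_mod_cast hr.ne'
    push_cast; field_simp; ring
  have le1 : r⁻¹ ≤ (r * r')⁻¹ := by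
    rw [mul_inv]; exact le_mul_of_one_le_right (by positivity) (one_le_inv_iff₀.2 ⟨hr', hr1'⟩)
  have le2 : r'⁻¹ ≤ (r * r')⁻¹ := by
    rw [mul_inv]; exact le_mul_of_one_le_left (by positivity) (one_le_inv_iff₀.2 ⟨hr, hr1⟩)
  have e1 : ∀ {t : ℝ} {u v : ℂ}, 0 < t → t⁻¹ ≤ (r * r')⁻¹ → ‖u‖ ≤ S → ‖v‖ ≤ ε →
      ‖u * conj (-((t⁻¹ : ℝ) : ℂ) * v)‖ ≤ S * (ε * (r * r')⁻¹) := fun {t u v} ht ht1 hu hv => by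
    rw [norm_mul, RCLike.norm_conj, norm_mul, norm_neg, Complex.norm_real,
      Real.norm_of_nonneg (by positivity), mul_comm t⁻¹]
    gcongr
  have e2 : ∀ {s t : ℝ} {u v : ℂ}, 0 < s → 0 < t → s⁻¹ * t⁻¹ = (r * r')⁻¹ → ‖u‖ ≤ S → ‖v‖ ≤ ε →
      ‖((s⁻¹ : ℝ) : ℂ) * conj u * (-((t⁻¹ : ℝ) : ℂ) * v)‖ ≤ S * (ε * (r * r')⁻¹) :=
    fun {s t u v} hs ht hst hu hv => by
    rw [norm_mul, norm_mul, RCLike.norm_conj, norm_mul, norm_neg, Complex.norm_real,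
      Complex.norm_real, Real.norm_of_nonneg (by positivity), Real.norm_of_nonneg (by positivity),
      ← hst, show s⁻¹ * ‖u‖ * (t⁻¹ * ‖v‖) = ‖u‖ * (‖v‖ * (s⁻¹ * t⁻¹)) by ring]
    gcongr
  have hst : r⁻¹ * r'⁻¹ = (r * r')⁻¹ := (mul_inv _ _).symm
  have hst' : r'⁻¹ * r⁻¹ = (r * r')⁻¹ := by rw [mul_comm, hst]
  rw [layerDefect_eq f f' F F' h', q1, q2,
    show 1 / 2 * S * (ε * (r * r')⁻¹) =
      1 / 4 * (S * (ε * (r * r')⁻¹) + S * (ε * (r * r')⁻¹)) by ring]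
  refine norm_layerDefect_le_aux ?_ ?_ ?_ ?_
  · exact (norm_sub_le _ _).trans (add_le_add (e2 hr hr' hst hb hd) (e1 hr le1 ha' hd'))
  · exact (norm_add_le _ _).trans (add_le_add (e1 hr le1 ha hd') (e2 hr hr' hst hb' hd))
  · exact (norm_add_le _ _).trans (add_le_add (e1 hr' le2 ha' hd) (e2 hr' hr hst' hb hd'))
  · exact (norm_sub_le _ _).trans (add_le_add (e2 hr' hr hst' hb' hd') (e1 hr' le2 ha hd))

/-! ### One renormalization step as an identity of integrals. -/

theorem intervalIntegrable_comp_add_pi {E : Type*} [NormedAddCommGroup E] {F : ℝ → E}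
    (hF : Function.Periodic F (2 * Real.pi))
    (hi : IntervalIntegrable F volume (-Real.pi) Real.pi) :
    IntervalIntegrable (fun k => F (k + Real.pi)) volume (-Real.pi) Real.pi := by
  have := (intervalIntegrable_of_periodic hF hi (-Real.pi + Real.pi)
    (Real.pi + Real.pi)).comp_add_right Real.pi
  simpa using this

theorem intervalIntegrable_comp_two_mul {E : Type*} [NormedAddCommGroup E] {F : ℝ → E}
    (hF : Function.Periodic F (2 * Real.pi))
    (hi : IntervalIntegrable F volume (-Real.pi) Real.pi) :
    IntervalIntegrable (fun k => F (2 * k)) volume (-Real.pi) Real.pi := by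
  have := (intervalIntegrable_of_periodic hF hi (2 * -Real.pi)
    (2 * Real.pi)).comp_mul_left (c := 2)
  rwa [mul_div_cancel_left₀ _ two_ne_zero, mul_div_cancel_left₀ _ two_ne_zero] at this

/-- The identity behind a single renormalization step, with its error as an integral. -/
theorem integral_layer {ρ σ : ℝ → ℝ} (hρ : Function.Periodic ρ (2 * Real.pi))
    (hσ : Function.Periodic σ (2 * Real.pi)) (hσρ : ∀ k, σ (2 * k) = ρ k * ρ (k + Real.pi))
    {a b f F : ℤ → ℝ} (ha : (Function.support a).Finite) (hb : (Function.support b).Finite)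
    (hf : (Function.support f).Finite) (hF : (Function.support F).Finite)
    (hi : IntervalIntegrable (fun k => (ρ k : ℂ) * (conj (freq f k) * freq F k)) volume
      (-Real.pi) Real.pi)
    (hi' : IntervalIntegrable (fun k => (σ k : ℂ) * (conj (freq (decimate a f) k) *
      freq (decimate a F) k)) volume (-Real.pi) Real.pi) :
    (∫ k in (-Real.pi)..Real.pi, (ρ k : ℂ) * (conj (freq f k) * freq F k)) -
      (∫ k in (-Real.pi)..Real.pi, (σ k : ℂ) * (conj (freq (decimate a f) k) *
        freq (decimate a F) k)) -
      (∫ k in (-Real.pi)..Real.pi, conj (freq (decimate (waveletFilter b) f) k) *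
        freq (decimate (waveletFilter b) F) k) =
    ∫ k in (-Real.pi)..Real.pi, layerDefect (ρ k) (ρ (k + Real.pi)) (freq a k)
      (freq a (k + Real.pi)) (freq b k) (freq b (k + Real.pi)) (freq f k) (freq f (k + Real.pi))
      (freq F k) (freq F (k + Real.pi)) := by
  have hw := support_waveletFilter_finite hb
  have cont : ∀ {u : ℤ → ℝ}, (Function.support u).Finite → Continuous (freq u) :=
    fun h => continuous_freq h
  have p1 : Function.Periodic (fun k => (ρ k : ℂ) * (conj (freq f k) * freq F k))
      (2 * Real.pi) := fun k => by simp only [hρ k, freq_add_two_pi]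
  have p2 : Function.Periodic (fun k => (σ k : ℂ) * (conj (freq (decimate a f) k) *
      freq (decimate a F) k)) (2 * Real.pi) := fun k => by simp only [hσ k, freq_add_two_pi]
  have p3 : Function.Periodic (fun k => conj (freq (decimate (waveletFilter b) f) k) *
      freq (decimate (waveletFilter b) F) k) (2 * Real.pi) := fun k => by
    simp only [freq_add_two_pi]
  have i3 : IntervalIntegrable (fun k => conj (freq (decimate (waveletFilter b) f) k) *
      freq (decimate (waveletFilter b) F) k) volume (-Real.pi) Real.pi := by
    refine Continuous.intervalIntegrable ?_ _ _
    exact (Complex.continuous_conj.comp (cont (support_decimate_finite hw hf))).mul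
      (cont (support_decimate_finite hw hF))
  have e1 := integral_comp_add_pi p1
  have j1 := intervalIntegrable_comp_add_pi p1 hi
  rw [← integral_comp_two_mul p2 hi', ← integral_comp_two_mul p3 i3]
  -- Downsampling folds `k` and `k + π` together. This integral is therefore averaged over the pair,
  -- while the integrals of the two outputs are evaluated at `2k`.
  have split : ∫ k in (-Real.pi)..Real.pi, (ρ k : ℂ) * (conj (freq f k) * freq F k) =
      ∫ k in (-Real.pi)..Real.pi, 1 / 2 * ((ρ k : ℂ) * (conj (freq f k) * freq F k) +
        (ρ (k + Real.pi) : ℂ) * (conj (freq f (k + Real.pi)) * freq F (k + Real.pi))) := by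
    rw [intervalIntegral.integral_const_mul, intervalIntegral.integral_add hi j1, e1]
    ring
  rw [split, ← intervalIntegral.integral_sub ((hi.add j1).const_mul _)
    (intervalIntegrable_comp_two_mul p2 hi'), ← intervalIntegral.integral_sub
    (((hi.add j1).const_mul _).sub (intervalIntegrable_comp_two_mul p2 hi'))
    (intervalIntegrable_comp_two_mul p3 i3)]
  refine intervalIntegral.integral_congr fun k _ => ?_
  -- The shift by one in the wavelet filter contributes only a common phase, which cancels in the
  -- product with a conjugate (`hph`).
  have hwav : ∀ u : ℤ → ℝ, (Function.support u).Finite →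
      freq (decimate (waveletFilter b) u) (2 * k) = Complex.exp (Complex.I * k) *
        (1 / 2 * (freq b (k + Real.pi) * freq u k - freq b k * freq u (k + Real.pi))) := by
    intro u hu
    rw [freq_decimate hw hu, freq_waveletFilter, freq_waveletFilter, map_mul, map_mul,
      Complex.conj_conj, Complex.conj_conj, ← Complex.exp_conj, ← Complex.exp_conj,
      show k + Real.pi + Real.pi = k + 2 * Real.pi by ring, freq_add_two_pi]
    simp only [map_neg, map_mul, Complex.conj_I, Complex.conj_ofReal]
    rw [show -(-Complex.I * ((k + Real.pi : ℝ) : ℂ)) = Complex.I * k + Real.pi * Complex.I by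
      push_cast; ring, Complex.exp_add, Complex.exp_pi_mul_I]
    ring_nf
  have hph : conj (Complex.exp (Complex.I * k)) * Complex.exp (Complex.I * k) = 1 := by
    rw [← Complex.exp_conj, ← Complex.exp_add]; simp
  rw [hwav f hf, hwav F hF, hσρ, freq_decimate ha hf, freq_decimate ha hF, layerDefect]
  rw [map_mul (starRingEnd ℂ) (Complex.exp _)]
  linear_combination (-(conj (1 / 2 * (freq b (k + Real.pi) * freq f k -
    freq b k * freq f (k + Real.pi))) * (1 / 2 * (freq b (k + Real.pi) * freq F k -
    freq b k * freq F (k + Real.pi))))) * hph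

/-! ### Cascades and the size of the low-frequency output -/

/-- The low-frequency output of the filters `a 0, …, a (n - 1)`. -/
def lowIter (a : ℕ → ℤ → ℝ) : ℕ → Signal → Signal
  | 0, f => f
  | n + 1, f => decimate (a n) (lowIter a n f)

/-- `a` vanishes outside an interval of `N` integers. -/
def SupportedIn (a : ℤ → ℝ) (N : ℕ) : Prop := ∃ s : ℤ, ∀ n : ℤ, a n ≠ 0 → s ≤ n ∧ n < s + N

theorem SupportedIn.exists_finset {a : ℤ → ℝ} {N : ℕ} (h : SupportedIn a N) :
    ∃ s : Finset ℤ, s.card = N ∧ ∀ n, a n ≠ 0 → n ∈ s := by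
  obtain ⟨s, hs⟩ := h
  exact ⟨Finset.Ico s (s + N), by simp, fun n hn => Finset.mem_Ico.2 (hs n hn)⟩

theorem SupportedIn.finite {a : ℤ → ℝ} {N : ℕ} (h : SupportedIn a N) :
    (Function.support a).Finite := by
  obtain ⟨s, -, hs⟩ := h.exists_finset
  exact s.finite_toSet.subset fun n hn => hs n hn

/-- A length `M + 1` does not grow under the layers: filtering adds less than `M` to it and
downsampling halves the sum. This keeps the number of nonzero coefficients uniform in the layer. -/
theorem supportedIn_decimate {a f : ℤ → ℝ} {M : ℕ} (ha : SupportedIn a M)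
    (hf : SupportedIn f (M + 1)) : SupportedIn (decimate a f) (M + 1) := by
  obtain ⟨s, hs⟩ := ha
  obtain ⟨t, ht⟩ := hf
  refine ⟨(t - s - M + 2) / 2, fun n hn => ?_⟩
  have : ∃ l, a l * f (2 * n + l) ≠ 0 := by
    by_contra h; push Not at h
    exact hn (by simp only [decimate]; simp [h])
  obtain ⟨l, hl⟩ := this
  have h1 := hs l (left_ne_zero_of_mul hl)
  have h2 := ht _ (right_ne_zero_of_mul hl)
  push_cast at h2 ⊢
  omega

theorem supportedIn_delta (i : ℤ) (M : ℕ) : SupportedIn (delta i) (M + 1) := by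
  refine ⟨i, fun n hn => ?_⟩
  have : n = i := by
    by_contra h
    exact hn (by simp [delta, Pi.single_apply]; exact h)
  subst this; push_cast; omega

theorem supportedIn_lowIter {a : ℕ → ℤ → ℝ} {M : ℕ} (ha : ∀ l, SupportedIn (a l) M) (l : ℕ)
    (i : ℤ) : SupportedIn (lowIter a l (delta i)) (M + 1) := by
  induction l with
  | zero => exact supportedIn_delta i M
  | succ l ih => exact supportedIn_decimate (ha l) ih

theorem cascade_succ_eq_sum {a : ℤ → ℤ → ℝ} {l : ℤ} {s : Finset ℤ}
    (hs : ∀ n, a (l - 1) n ≠ 0 → n ∈ s) (J : ℕ) (x : ℝ) :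
    cascade a l (J + 1) x = √2 * ∑ n ∈ s, a (l - 1) n * cascade a (l - 1) J (2 * x - n) := by
  have : ∑' n : ℤ, a (l - 1) n * cascade a (l - 1) J (2 * x - n) =
      ∑ n ∈ s, a (l - 1) n * cascade a (l - 1) J (2 * x - n) := tsum_eq_sum fun n hn => by
    have : a (l - 1) n = 0 := by by_contra h; exact hn (hs n h)
    simp [this]
  rw [← this, cascade]

theorem measurable_cascade {a : ℤ → ℤ → ℝ} (ha : ∀ l, (Function.support (a l)).Finite) (J : ℕ)
    (l : ℤ) : Measurable (cascade a l J) := by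
  induction J generalizing l with
  | zero => exact measurable_one.indicator measurableSet_Ico
  | succ J ih =>
    obtain ⟨s, hs⟩ := exists_finset_of_finite (ha (l - 1))
    rw [show cascade a l (J + 1) = _ from funext (cascade_succ_eq_sum hs J)]
    refine Measurable.const_mul (Finset.measurable_fun_sum _ fun n _ => ?_) _
    exact ((ih (l - 1)).comp (by fun_prop)).const_mul _

/-- Here `K` depends on `J`, so this serves integrability only. Uniform bounds come from the
limiting scaling functions. -/
theorem exists_cascade_le {a : ℤ → ℤ → ℝ} (ha : ∀ l, (Function.support (a l)).Finite) (J : ℕ)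
    (l : ℤ) : ∃ K : ℝ, ∀ x, |cascade a l J x| ≤ K := by
  induction J generalizing l with
  | zero =>
    refine ⟨1, fun x => ?_⟩
    rw [cascade, Set.indicator_apply]
    split_ifs <;> simp
  | succ J ih =>
    obtain ⟨s, hs⟩ := exists_finset_of_finite (ha (l - 1))
    obtain ⟨K, hK⟩ := ih (l - 1)
    refine ⟨√2 * ∑ n ∈ s, |a (l - 1) n| * K, fun x => ?_⟩
    rw [cascade_succ_eq_sum hs, abs_mul, abs_of_nonneg (Real.sqrt_nonneg _)]
    gcongr
    refine (Finset.abs_sum_le_sum_abs _ _).trans (Finset.sum_le_sum fun n _ => ?_)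
    rw [abs_mul]
    gcongr
    exact hK _

theorem exists_cascade_support {a : ℤ → ℤ → ℝ} {M : ℕ} (ha : ∀ l, SupportedIn (a l) M) (J : ℕ)
    (l : ℤ) : ∃ t : ℝ, ∀ x, cascade a l J x ≠ 0 → x ∈ Set.Icc t (t + (M + 1)) := by
  induction J generalizing l with
  | zero =>
    refine ⟨0, fun x hx => ?_⟩
    have := Set.mem_of_indicator_ne_zero hx
    exact ⟨this.1, by have := this.2; have : (0 : ℝ) ≤ M := by positivity
                      linarith⟩
  | succ J ih =>
    obtain ⟨t, ht⟩ := ih (l - 1)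
    obtain ⟨s, hs⟩ := ha (l - 1)
    refine ⟨(t + s) / 2, fun x hx => ?_⟩
    have : ∃ n, a (l - 1) n * cascade a (l - 1) J (2 * x - n) ≠ 0 := by
      by_contra h; push Not at h
      exact hx (by rw [cascade]; simp [h])
    obtain ⟨n, hn⟩ := this
    have h1 := hs n (left_ne_zero_of_mul hn)
    have h2 := ht _ (right_ne_zero_of_mul hn)
    have h3 : (s : ℝ) ≤ n := by exact_mod_cast h1.1
    have h4 : (n : ℝ) + 1 ≤ s + M := by
      have := Int.add_one_le_iff.2 h1.2
      exact_mod_cast this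
    have h5 := h2.1
    have h6 := h2.2
    constructor <;> linarith

theorem integrable_cascade {a : ℤ → ℤ → ℝ} {M : ℕ} (ha : ∀ l, SupportedIn (a l) M) (J : ℕ)
    (l : ℤ) : Integrable (cascade a l J) := by
  obtain ⟨K, hK⟩ := exists_cascade_le (fun l => (ha l).finite) J l
  obtain ⟨t, ht⟩ := exists_cascade_support ha J l
  have : cascade a l J = Set.indicator (Set.Icc t (t + (M + 1))) (cascade a l J) := by
    rw [eq_comm, Set.indicator_eq_self]
    exact fun x hx => ht x hx
  rw [this, integrable_indicator_iff measurableSet_Icc]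
  exact Measure.integrableOn_of_bounded (by simp)
    (measurable_cascade (fun l => (ha l).finite) J l).aestronglyMeasurable
    (Filter.Eventually.of_forall hK)

/-- Perfect reconstruction says that the Fourier transform of the left-hand side is the constant
`1`; Parseval against unit signals recovers the coefficients. -/
theorem decimate_eq_delta {g h : ℤ → ℝ} (hg : (Function.support g).Finite)
    (hh : (Function.support h).Finite) (pr : ∀ k, freq g k * conj (freq h k) +
      freq g (k + Real.pi) * conj (freq h (k + Real.pi)) = 2) (p : ℤ) :
    decimate h g p = if p = 0 then 1 else 0 := by
  have hu := support_decimate_finite hh hg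
  have h1 : ∀ k, freq (decimate h g) k = freq (delta 0) k := fun k => by
    have e := freq_decimate hh hg (k / 2)
    rw [mul_div_cancel₀ _ two_ne_zero] at e
    rw [e, freq_delta]
    have := pr (k / 2)
    simp only [Int.cast_zero, mul_zero, neg_zero, Complex.exp_zero]
    linear_combination 1 / 2 * this
  have e1 := integral_conj_freq_mul_freq (support_delta_finite p) hu
  simp_rw [h1] at e1
  rw [integral_conj_freq_mul_freq (support_delta_finite p) (support_delta_finite 0)] at e1
  have hpi : (2 * (Real.pi : ℂ)) ≠ 0 := by
    simp
  have e2 := mul_left_cancel₀ hpi e1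
  have e3 : ∀ u : ℤ → ℝ, ∑' n, delta p n * u n = u p := fun u => by
    rw [tsum_eq_single p fun n hn => by simp [delta, hn]]
    simp [delta]
  rw [e3, e3] at e2
  rw [← Complex.ofReal_inj.1 e2]
  simp [delta, Pi.single_apply]

theorem integrable_cascade_mul_comp {a b : ℤ → ℤ → ℝ} {M : ℕ}
    (hb : ∀ l, SupportedIn (b l) M) (J J' : ℕ) (l l' : ℤ) {A A' : ℝ → ℝ}
    (hA : Measurable A') (hA' : Integrable (fun x => cascade a l J (A x))) :
    Integrable fun x => cascade a l J (A x) * cascade b l' J' (A' x) := by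
  obtain ⟨K, hK⟩ := exists_cascade_le (fun l => (hb l).finite) J' l'
  exact hA'.mul_bdd (c := K)
    ((measurable_cascade (fun l => (hb l).finite) J' l').comp hA).aestronglyMeasurable
    (Filter.Eventually.of_forall fun x => hK (A' x))

/-- At stage `0` this is orthonormality of the translates of `[0, 1)`. Refining both factors
replaces the pairing by `∑ h[q] g[2p + q]`, which `decimate_eq_delta` evaluates. -/
theorem cascade_biorthogonal {g h : ℤ → ℤ → ℝ} {M : ℕ} (hF : IsFilterFamily g h M) (J : ℕ)
    (l p : ℤ) : ∫ x, cascade g l J x * cascade h l J (x - p) = if p = 0 then 1 else 0 := by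
  have hg : ∀ l, SupportedIn (g l) M := hF.support_g
  have hh : ∀ l, SupportedIn (h l) M := hF.support_h
  induction J generalizing l p with
  | zero =>
    have e : ∀ x : ℝ, cascade g l 0 x * cascade h l 0 (x - p) =
        Set.indicator (Set.Ico (0 : ℝ) 1) (fun _ => if p = 0 then (1 : ℝ) else 0) x := by
      intro x
      simp only [cascade, Set.indicator_apply, Set.mem_Ico, Pi.one_apply]
      by_cases hx : 0 ≤ x ∧ x < 1
      · by_cases hp : p = 0
        · subst hp; simp [hx.1, hx.2]
        · have : ¬ (0 ≤ x - p ∧ x - p < 1) := fun hxp => by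
            have h1 : (p : ℝ) < 1 := by linarith [hxp.1, hx.2]
            have h2 : (-1 : ℝ) < p := by linarith [hxp.2, hx.1]
            have h1' : p < 1 := by exact_mod_cast h1
            have h2' : -1 < p := by exact_mod_cast h2
            omega
          rw [if_pos hx, if_neg this, mul_zero, if_pos hx, if_neg hp]
      · simp [hx]
    simp_rw [e]
    rw [integral_indicator measurableSet_Ico]
    simp
  | succ J ih =>
    obtain ⟨s, -, hs⟩ := (hg (l - 1)).exists_finset
    obtain ⟨t, -, ht⟩ := (hh (l - 1)).exists_finset
    have e : ∀ x : ℝ, cascade g l (J + 1) x * cascade h l (J + 1) (x - p) =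
        ∑ q ∈ t, ∑ r ∈ s, 2 * (h (l - 1) q * g (l - 1) r) *
          (cascade g (l - 1) J (2 * x - r) *
            cascade h (l - 1) J (2 * x - r - ((2 * p + q - r : ℤ) : ℝ))) := by
      intro x
      rw [cascade_succ_eq_sum hs, cascade_succ_eq_sum ht, mul_mul_mul_comm,
        Real.mul_self_sqrt zero_le_two, Finset.sum_mul_sum, Finset.sum_comm, Finset.mul_sum]
      refine Finset.sum_congr rfl fun q _ => ?_
      rw [Finset.mul_sum]
      refine Finset.sum_congr rfl fun r _ => ?_
      rw [show 2 * x - r - ((2 * p + q - r : ℤ) : ℝ) = 2 * (x - p) - q by push_cast; ring]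
      ring
    have hint : ∀ r : ℤ, Integrable fun x : ℝ => cascade g (l - 1) J (2 * x - r) := fun r =>
      ((integrable_cascade hg J (l - 1)).comp_sub_right (r : ℝ)).comp_mul_left' two_ne_zero
    have hint2 : ∀ q r : ℤ, Integrable fun x : ℝ => 2 * (h (l - 1) q * g (l - 1) r) *
          (cascade g (l - 1) J (2 * x - r) *
            cascade h (l - 1) J (2 * x - r - ((2 * p + q - r : ℤ) : ℝ))) := fun q r =>
      (integrable_cascade_mul_comp hh J J _ _ (by fun_prop) (hint r)).const_mul _
    simp_rw [e]
    rw [integral_finsetSum _ fun q _ => integrable_finsetSum _ fun r _ => hint2 q r]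
    simp_rw [integral_finsetSum _ fun r _ => hint2 _ r, integral_const_mul]
    have hval : ∀ q r : ℤ, ∫ x : ℝ, cascade g (l - 1) J (2 * x - r) *
        cascade h (l - 1) J (2 * x - r - ((2 * p + q - r : ℤ) : ℝ)) =
        1 / 2 * if r = 2 * p + q then 1 else 0 := fun q r => by
      have e1 := Measure.integral_comp_mul_left (fun y : ℝ => cascade g (l - 1) J (y - r) *
        cascade h (l - 1) J (y - r - ((2 * p + q - r : ℤ) : ℝ))) 2
      rw [e1, integral_sub_right_eq_self (fun y : ℝ => cascade g (l - 1) J y *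
        cascade h (l - 1) J (y - ((2 * p + q - r : ℤ) : ℝ))), ih]
      have : (2 * p + q - r = 0) ↔ (r = 2 * p + q) := by omega
      simp only [this]
      norm_num
    simp_rw [hval]
    rw [← decimate_eq_delta (hg (l - 1)).finite (hh (l - 1)).finite
      (hF.perfect_reconstruction (l - 1)) p, decimate, tsum_eq_sum (s := t) fun q hq => by
        have : h (l - 1) q = 0 := by by_contra h'; exact hq (ht q h')
        simp [this]]
    refine Finset.sum_congr rfl fun q _ => ?_
    simp_rw [mul_ite, mul_one, mul_zero]
    rw [Finset.sum_ite_eq']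
    split_ifs with hm
    · ring
    · have : g (l - 1) (2 * p + q) = 0 := by by_contra h'; exact hm (hs _ h')
      simp [this]

/-- Refining the cascade of `g` once reproduces the recursion that defines one more layer, and
biorthogonality is the case without layers. The identity is exact for every `J`, so `J` may later
tend to infinity. The `g`-cascade has `J + L` stages so that `J` remain once it has been refined
down to layer `0`. -/
theorem lowIter_delta_eq_integral {g h : ℤ → ℤ → ℝ} {M : ℕ} (hF : IsFilterFamily g h M)
    (J L : ℕ) (i n : ℤ) :
    lowIter (fun l => g l) L (delta i) n = √2 ^ L *
      ∫ x, cascade g L (J + L) x * cascade h 0 J (2 ^ L * (x + n) - i) := by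
  have hg : ∀ l, SupportedIn (g l) M := hF.support_g
  have hh : ∀ l, SupportedIn (h l) M := hF.support_h
  induction L generalizing n with
  | zero =>
    have := cascade_biorthogonal hF J 0 (i - n)
    push_cast at this
    simp only [lowIter, pow_zero, one_mul, Nat.cast_zero, add_zero]
    simp_rw [show ∀ x : ℝ, x + n - i = x - (i - n) by intro x; ring]
    rw [this]
    simp [delta, Pi.single_apply, sub_eq_zero, eq_comm]
  | succ L ih =>
    obtain ⟨s, -, hs⟩ := (hg L).exists_finset
    have hs' : ∀ n, g (((L + 1 : ℕ) : ℤ) - 1) n ≠ 0 → n ∈ s := by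
      rw [show ((L + 1 : ℕ) : ℤ) - 1 = L by push_cast; ring]; exact hs
    have e : ∀ x : ℝ, cascade g ((L + 1 : ℕ) : ℤ) (J + (L + 1)) x *
        cascade h 0 J (2 ^ (L + 1) * (x + n) - i) =
        ∑ r ∈ s, √2 * g L r * (cascade g L (J + L) (2 * x - r) *
          cascade h 0 J (2 ^ L * (2 * x - r + ((2 * n + r : ℤ) : ℝ)) - i)) := fun x => by
      rw [← add_assoc, cascade_succ_eq_sum hs', show ((L + 1 : ℕ) : ℤ) - 1 = L by push_cast; ring,
        mul_assoc, Finset.sum_mul, Finset.mul_sum]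
      refine Finset.sum_congr rfl fun r _ => ?_
      rw [show 2 ^ L * (2 * x - r + ((2 * n + r : ℤ) : ℝ)) = 2 ^ (L + 1) * (x + n) by
        push_cast; ring]
      ring
    have hint : ∀ r : ℤ, Integrable fun x : ℝ => cascade g L (J + L) (2 * x - r) := fun r =>
      ((integrable_cascade hg (J + L) L).comp_sub_right (r : ℝ)).comp_mul_left' two_ne_zero
    simp_rw [e]
    rw [integral_finsetSum _ fun r _ =>
      (integrable_cascade_mul_comp hh _ _ _ _ (by fun_prop) (hint r)).const_mul _]
    simp_rw [integral_const_mul]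
    rw [lowIter, decimate, tsum_eq_sum (s := s) fun r hr => by
        have : g L r = 0 := by by_contra h'; exact hr (hs r h')
        simp [this], Finset.mul_sum]
    refine Finset.sum_congr rfl fun r _ => ?_
    have e1 := Measure.integral_comp_mul_left (fun y : ℝ => cascade g L (J + L) (y - r) *
        cascade h 0 J (2 ^ L * (y - r + ((2 * n + r : ℤ) : ℝ)) - i)) 2
    rw [e1, integral_sub_right_eq_self (fun y : ℝ => cascade g L (J + L) y *
        cascade h 0 J (2 ^ L * (y + ((2 * n + r : ℤ) : ℝ)) - i)), ih, pow_succ]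
    have h2 : √2 * √2 = (2 : ℝ) := Real.mul_self_sqrt zero_le_two
    norm_num
    linear_combination (-(1 / 2) * √2 ^ L * g L r * (∫ y, cascade g L (J + L) y *
        cascade h 0 J (2 ^ L * (y + (2 * n + r)) - i))) * h2

theorem integral_sq_eq_eLpNorm {u : ℝ → ℝ} (hu : MemLp u 2 volume) :
    ∫ x, u x ^ 2 = (eLpNorm u 2 volume).toReal ^ 2 := by
  rw [hu.eLpNorm_eq_integral_rpow_norm two_ne_zero ENNReal.ofNat_ne_top,
    ENNReal.toReal_ofReal (by positivity), ← Real.rpow_natCast, ← Real.rpow_mul (by positivity)]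
  simp

/-- A square integrable approximation of a bounded function is small on small sets. -/
theorem setIntegral_sq_le {f φ : ℝ → ℝ} {B : ℝ} (hf : MemLp f 2 volume) (hφ : MemLp φ 2 volume)
    (hB : ∀ᵐ x, |φ x| ≤ B) {S : Set ℝ} (hS : volume S ≠ ⊤) :
    ∫ x in S, f x ^ 2 ≤ 2 * B ^ 2 * volume.real S +
      2 * (eLpNorm (fun x => f x - φ x) 2 volume).toReal ^ 2 := by
  have hd : MemLp (fun x => f x - φ x) 2 volume := hf.sub hφ
  rw [← integral_sq_eq_eLpNorm hd]
  have hdi := hd.integrable_sq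
  calc ∫ x in S, f x ^ 2 ≤ ∫ x in S, (2 * B ^ 2 + 2 * (f x - φ x) ^ 2) := by
        refine integral_mono_ae hf.integrable_sq.integrableOn ?_ ?_
        · exact (integrableOn_const hS).add (hdi.const_mul 2).integrableOn
        · filter_upwards [ae_restrict_of_ae hB] with x hx
          have := sq_le_sq' (by linarith [abs_nonneg (φ x), neg_abs_le (φ x)])
            ((le_abs_self _).trans hx)
          -- Equivalent to `f² ≤ 2 φ² + 2 (f - φ)²`.
          nlinarith [sq_nonneg (f x - 2 * φ x)]
    _ = 2 * B ^ 2 * volume.real S + ∫ x in S, 2 * (f x - φ x) ^ 2 := by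
        rw [integral_add (integrableOn_const hS :
          IntegrableOn (fun _ : ℝ => 2 * B ^ 2) S volume) (hdi.const_mul 2).integrableOn]
        simp; ring
    _ ≤ _ := by
        gcongr
        rw [← integral_const_mul]
        exact setIntegral_le_integral (hdi.const_mul 2)
          (Filter.Eventually.of_forall fun x => by positivity)

theorem memLp_cascade {a : ℤ → ℤ → ℝ} {M : ℕ} (ha : ∀ l, SupportedIn (a l) M) (J : ℕ)
    (l : ℤ) : MemLp (cascade a l J) 2 volume := by
  have hm := measurable_cascade (fun l => (ha l).finite) J l
  rw [memLp_two_iff_integrable_sq hm.aestronglyMeasurable]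
  have := integrable_cascade_mul_comp ha J J l l (A := id) measurable_id
    (integrable_cascade ha J l)
  exact this.congr (Filter.Eventually.of_forall fun x => (sq _).symm)

/-- The cascades approach `φ` and `ψ` only in `L²`, so sup bounds cannot be applied to them
directly. Instead the product is bounded by half the sum of squares on the interval `S`, of length
`(M + 1) / 2 ^ L`, that carries the compressed cascade. Each square is then compared with its
bounded limit by `setIntegral_sq_le`. -/
theorem abs_integral_cascade_le {g h : ℤ → ℤ → ℝ} {M : ℕ} (hg : ∀ l, SupportedIn (g l) M)
    (hh : ∀ l, SupportedIn (h l) M) {φ ψ : ℝ → ℝ} {B : ℝ} (hφ : MemLp φ 2 volume)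
    (hψ : MemLp ψ 2 volume) (hφB : ∀ᵐ x, |φ x| ≤ B) (hψB : ∀ᵐ x, |ψ x| ≤ B) (l : ℤ)
    (J J' L : ℕ) (i n : ℤ) :
    |∫ x, cascade g l J x * cascade h 0 J' (2 ^ L * (x + n) - i)| ≤
      2 * B ^ 2 * (M + 1) / 2 ^ L +
        ((eLpNorm (fun x => cascade g l J x - φ x) 2 volume).toReal ^ 2 +
          (eLpNorm (fun x => cascade h 0 J' x - ψ x) 2 volume).toReal ^ 2 / 2 ^ L) := by
  obtain ⟨t, ht⟩ := exists_cascade_support hh J' 0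
  have hp : (0 : ℝ) < 2 ^ L := by positivity
  set S := Set.Icc ((t + i) / 2 ^ L - n) ((t + (M + 1) + i) / 2 ^ L - n) with hSdef
  set T := Set.Icc t (t + (M + 1)) with hTdef
  set u := cascade g l J with hu
  set c := cascade h 0 J' with hc
  have hS : ∀ x : ℝ, c (2 ^ L * (x + n) - i) ≠ 0 → x ∈ S := fun x hx => by
    have := ht _ hx
    constructor
    · rw [sub_le_iff_le_add, div_le_iff₀ hp]; linarith [this.1]
    · rw [le_sub_iff_add_le, le_div_iff₀ hp]; linarith [this.2]
  have hSv : volume.real S = (M + 1) / 2 ^ L := by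
    rw [hSdef, Real.volume_real_Icc_of_le]
    · ring
    · gcongr; linarith
  have hTv : volume.real T = M + 1 := by
    rw [hTdef, Real.volume_real_Icc_of_le]
    · ring
    · linarith
  have hu2 := memLp_cascade hg J l
  have hc2 := memLp_cascade hh J' 0
  have b1 := setIntegral_sq_le hu2 hφ hφB (S := S) (by simp [hSdef])
  have b2 := setIntegral_sq_le hc2 hψ hψB (S := T) (by simp [hTdef])
  have hcT : ∫ x in T, c x ^ 2 = ∫ x, c x ^ 2 :=
    setIntegral_eq_integral_of_forall_compl_eq_zero fun x hx => by
      have : c x = 0 := by by_contra h; exact hx (ht x h)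
      simp [this]
  have hci : Integrable fun x : ℝ => c (2 ^ L * (x + n) - i) ^ 2 := by
    have := ((hc2.integrable_sq.comp_sub_right (i : ℝ)).comp_mul_left' hp.ne').comp_add_right
      (n : ℝ)
    exact this
  have hcv : ∫ x : ℝ, c (2 ^ L * (x + n) - i) ^ 2 = (∫ x, c x ^ 2) / 2 ^ L := by
    rw [integral_add_right_eq_self (fun x : ℝ => c (2 ^ L * x - i) ^ 2),
      Measure.integral_comp_mul_left (fun y : ℝ => c (y - i) ^ 2),
      integral_sub_right_eq_self (fun y : ℝ => c y ^ 2), smul_eq_mul,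
      abs_of_pos (inv_pos.2 hp)]
    ring
  have huS : Integrable (S.indicator fun x => u x ^ 2) :=
    hu2.integrable_sq.indicator measurableSet_Icc
  have main : |∫ x, u x * c (2 ^ L * (x + n) - i)| ≤
      ∫ x, (1 / 2 * S.indicator (fun x => u x ^ 2) x + 1 / 2 * c (2 ^ L * (x + n) - i) ^ 2) := by
    rw [← Real.norm_eq_abs]
    refine norm_integral_le_of_norm_le ((huS.const_mul _).add (hci.const_mul _))
      (Filter.Eventually.of_forall fun x => ?_)
    by_cases hx : x ∈ S
    · rw [Set.indicator_of_mem hx, Real.norm_eq_abs, abs_le]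
      constructor <;> nlinarith [sq_nonneg (u x - c (2 ^ L * (x + n) - i)),
        sq_nonneg (u x + c (2 ^ L * (x + n) - i))]
    · have : c (2 ^ L * (x + n) - i) = 0 := by by_contra h; exact hx (hS x h)
      simp [this, Set.indicator_of_notMem hx]
  rw [integral_add (huS.const_mul _) (hci.const_mul _), integral_const_mul, integral_const_mul,
    integral_indicator measurableSet_Icc, hcv, ← hcT] at main
  rw [hSv] at b1
  rw [hTv] at b2
  have b3 := div_le_div_of_nonneg_right b2 hp.le
  refine main.trans ?_
  calc _ ≤ 1 / 2 * (2 * B ^ 2 * ((M + 1) / 2 ^ L) +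
        2 * (eLpNorm (fun x => u x - φ x) 2 volume).toReal ^ 2) +
        1 / 2 * ((2 * B ^ 2 * (M + 1) +
          2 * (eLpNorm (fun x => c x - ψ x) 2 volume).toReal ^ 2) / 2 ^ L) := by gcongr
    _ = _ := by ring

/-- As `J → ∞` the two `L²` errors vanish while the left-hand side does not depend on `J`. What
remains is `√2 ^ L` times a quantity of order `2 ^ (-L)`. -/
theorem abs_lowIter_delta_le {g h : ℤ → ℤ → ℝ} {M : ℕ} (hF : IsFilterFamily g h M) {N : ℕ}
    {B : ℝ} (hg : ScalingBounded g N B) (hh : ScalingBounded h N B) {L : ℕ} (hL : L ≤ N)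
    (i n : ℤ) :
    |lowIter (fun l => g l) L (delta i) n| ≤ 2 * B ^ 2 * (M + 1) / √2 ^ L := by
  obtain ⟨φ, hφ, hφB⟩ := hg L hL
  obtain ⟨ψ, hψ, hψB⟩ := hh 0 (Nat.zero_le _)
  have h2 : (0 : ℝ) < √2 := by positivity
  have h22 : (2 : ℝ) ^ L = √2 ^ L * √2 ^ L := by
    rw [← mul_pow, Real.mul_self_sqrt zero_le_two]
  have key : ∀ J : ℕ, |lowIter (fun l => g l) L (delta i) n| ≤ √2 ^ L *
      (2 * B ^ 2 * (M + 1) / 2 ^ L +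
        ((eLpNorm (fun x => cascade g L (J + L) x - φ x) 2 volume).toReal ^ 2 +
          (eLpNorm (fun x => cascade h 0 J x - ψ x) 2 volume).toReal ^ 2 / 2 ^ L)) := fun J => by
    rw [lowIter_delta_eq_integral hF J L i n, abs_mul, abs_of_nonneg (by positivity)]
    gcongr
    exact abs_integral_cascade_le hF.support_g hF.support_h hφ.memLp hψ.memLp hφB hψB _ _ _ _ _ _
  have l1 : Filter.Tendsto (fun J : ℕ =>
      (eLpNorm (fun x => cascade g L (J + L) x - φ x) 2 volume).toReal) Filter.atTop (𝓝 0) := by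
    have := (ENNReal.tendsto_toReal ENNReal.zero_ne_top).comp
      (hφ.cascade_tendsto.comp (Filter.tendsto_add_atTop_nat L))
    exact this
  have l2 : Filter.Tendsto (fun J : ℕ =>
      (eLpNorm (fun x => cascade h 0 J x - ψ x) 2 volume).toReal) Filter.atTop (𝓝 0) := by
    have := (ENNReal.tendsto_toReal ENNReal.zero_ne_top).comp hψ.cascade_tendsto
    exact this
  have lim := (((l1.pow 2).add ((l2.pow 2).div_const (2 ^ L))).const_add
    (2 * B ^ 2 * (M + 1) / 2 ^ L)).const_mul (√2 ^ L)
  have := ge_of_tendsto' lim key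
  refine this.trans (le_of_eq ?_)
  rw [h22]
  field_simp
  ring

/-! ### The layered covariance matrices in momentum space -/

theorem decimate_smul (a : ℤ → ℝ) (c : ℝ) (f : Signal) :
    decimate a (c • f) = c • decimate a f := by
  ext n
  simp only [decimate, Pi.smul_apply, smul_eq_mul]
  rw [← tsum_mul_left]
  congr 1; ext l; ring

theorem decimate_sub {a : ℤ → ℝ} (ha : (Function.support a).Finite) (f F : Signal) :
    decimate a (fun n => f n - F n) = fun n => decimate a f n - decimate a F n := by
  ext n
  have hs : ∀ u : Signal, Summable fun l => a l * u (2 * n + l) := fun u =>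
    summable_of_hasFiniteSupport (ha.subset fun l hl => left_ne_zero_of_mul hl)
  simp only [decimate]
  rw [← (hs f).tsum_sub (hs F)]
  congr 1; ext l; ring

theorem lowPart_scaled (A : ℕ → FilterBank) (c : ℕ → ℝ) (l : ℕ) (f : Signal) :
    lowPart (fun l f => c l • decompose (A l) f) 0 l f =
      (∏ j ∈ Finset.range l, c j) • lowIter (fun l => (A l).scaling) l f := by
  induction l with
  | zero => simp [lowPart, lowIter]
  | succ l ih =>
    rw [lowPart, ih, lowIter, zero_add, Finset.prod_range_succ]
    simp only [decompose, Prod.smul_fst, decimate_smul, smul_smul]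
    rw [mul_comm]

theorem highPart_scaled (A : ℕ → FilterBank) (c : ℕ → ℝ) (l : ℕ) (f : Signal) :
    highPart (fun l f => c l • decompose (A l) f) 0 l f =
      (∏ j ∈ Finset.range (l + 1), c j) •
        decimate (A l).wavelet (lowIter (fun l => (A l).scaling) l f) := by
  rw [highPart, lowPart_scaled, zero_add, Finset.prod_range_succ]
  simp only [decompose, Prod.smul_snd, decimate_smul, smul_smul]
  rw [mul_comm]

theorem gram_scaled (A : ℕ → FilterBank) (c : ℕ → ℝ) (L : ℕ) (i j : ℤ) :
    gram (fun l f => c l • decompose (A l) f) L i j =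
      (∏ j ∈ Finset.range L, c j ^ 2) * (∑' n : ℤ, lowIter (fun l => (A l).scaling) L (delta i) n *
        lowIter (fun l => (A l).scaling) L (delta j) n) +
      ∑ l ∈ Finset.range L, (∏ j ∈ Finset.range (l + 1), c j ^ 2) *
        ∑' n : ℤ, decimate (A l).wavelet (lowIter (fun l => (A l).scaling) l (delta i)) n *
          decimate (A l).wavelet (lowIter (fun l => (A l).scaling) l (delta j)) n := by
  have e : ∀ (t : ℝ) (u v : Signal), ∑' n : ℤ, (t • u) n * (t • v) n =
      t ^ 2 * ∑' n : ℤ, u n * v n := fun t u v => by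
    rw [← tsum_mul_left]
    congr 1; ext n
    simp only [Pi.smul_apply, smul_eq_mul]; ring
  simp only [gram, lowPart_scaled, highPart_scaled, e, Finset.prod_pow]

/-- Telescoping over the layers: the quadratic form with symbol `W 0 * τ 0` agrees with the layered
one up to the sum of the single-layer defects and an error at the coarsest scale. -/
theorem norm_integral_sub_layers_le {a b f F : ℕ → ℤ → ℝ}
    (ha : ∀ l, (Function.support (a l)).Finite) (hb : ∀ l, (Function.support (b l)).Finite)
    (hf : ∀ l, (Function.support (f l)).Finite) (hF : ∀ l, (Function.support (F l)).Finite)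
    (hfs : ∀ l, f (l + 1) = decimate (a l) (f l)) (hFs : ∀ l, F (l + 1) = decimate (a l) (F l))
    {W : ℕ → ℝ} {τ ρ : ℕ → ℝ → ℝ} (hW : ∀ l, 0 < W l)
    (hτ : ∀ l, Function.Periodic (τ l) (2 * Real.pi)) (hρ : ∀ l k, W l * τ l k = W (l + 1) * ρ l k)
    (hτρ : ∀ l k, τ (l + 1) (2 * k) = ρ l k * ρ l (k + Real.pi)) {L : ℕ}
    (hi : ∀ l ≤ L, IntervalIntegrable (fun k => (τ l k : ℂ) * (conj (freq (f l) k) *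
      freq (F l) k)) volume (-Real.pi) Real.pi) {e : ℕ → ℝ} {e' : ℝ}
    (he : ∀ l < L, ‖∫ k in (-Real.pi)..Real.pi, layerDefect (ρ l k) (ρ l (k + Real.pi))
      (freq (a l) k) (freq (a l) (k + Real.pi)) (freq (b l) k) (freq (b l) (k + Real.pi))
      (freq (f l) k) (freq (f l) (k + Real.pi)) (freq (F l) k) (freq (F l) (k + Real.pi))‖ ≤ e l)
    (he' : ‖∫ k in (-Real.pi)..Real.pi, ((τ L k - 1 : ℝ) : ℂ) * (conj (freq (f L) k) *
      freq (F L) k)‖ ≤ e') :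
    ‖(W 0 : ℂ) * (∫ k in (-Real.pi)..Real.pi, (τ 0 k : ℂ) * (conj (freq (f 0) k) *
      freq (F 0) k)) - 2 * Real.pi * ((W L * (∑' n : ℤ, f L n * F L n) +
        ∑ l ∈ Finset.range L, W (l + 1) * ∑' n : ℤ, decimate (waveletFilter (b l)) (f l) n *
          decimate (waveletFilter (b l)) (F l) n : ℝ) : ℂ)‖ ≤
      ∑ l ∈ Finset.range L, W (l + 1) * e l + W L * e' := by
  set I : ℕ → ℂ := fun l => ∫ k in (-Real.pi)..Real.pi, (τ l k : ℂ) * (conj (freq (f l) k) *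
      freq (F l) k) with hI
  set H : ℕ → ℝ := fun l => ∑' n : ℤ, decimate (waveletFilter (b l)) (f l) n *
          decimate (waveletFilter (b l)) (F l) n with hH
  have hρτ : ∀ l k, ρ l k = W l / W (l + 1) * τ l k := fun l k => by
    have := hρ l k
    have h0 := (hW (l + 1)).ne'
    field_simp; linarith
  have step : ∀ l < L, ‖(W l : ℂ) * I l - W (l + 1) * I (l + 1) -
      2 * Real.pi * (W (l + 1) * H l : ℝ)‖ ≤ W (l + 1) * e l := fun l hl => by
    have hρp : Function.Periodic (ρ l) (2 * Real.pi) := fun k => by rw [hρτ, hρτ, hτ l k]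
    have hiρ : IntervalIntegrable (fun k => (ρ l k : ℂ) * (conj (freq (f l) k) *
        freq (F l) k)) volume (-Real.pi) Real.pi := by
      have := (hi l hl.le).const_mul ((W l / W (l + 1) : ℝ) : ℂ)
      refine this.congr fun k _ => ?_
      simp only [hρτ, Complex.ofReal_mul]; ring
    have hi' := hi (l + 1) hl
    rw [hfs, hFs] at hi'
    have key := integral_layer hρp (hτ (l + 1)) (hτρ l) (ha l) (hb l) (hf l) (hF l) hiρ hi'
    have hw := support_waveletFilter_finite (hb l)
    rw [integral_conj_freq_mul_freq (support_decimate_finite hw (hf l))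
      (support_decimate_finite hw (hF l)), ← hfs, ← hFs] at key
    have e1 : (W (l + 1) : ℂ) * ∫ k in (-Real.pi)..Real.pi, (ρ l k : ℂ) *
        (conj (freq (f l) k) * freq (F l) k) = W l * I l := by
      rw [hI, ← intervalIntegral.integral_const_mul, ← intervalIntegral.integral_const_mul]
      refine intervalIntegral.integral_congr fun k _ => ?_
      change (W (l + 1) : ℂ) * ((ρ l k : ℂ) * (conj (freq (f l) k) * freq (F l) k)) =
        W l * ((τ l k : ℂ) * (conj (freq (f l) k) * freq (F l) k))
      rw [← mul_assoc (W (l + 1) : ℂ), ← mul_assoc (W l : ℂ), ← Complex.ofReal_mul,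
        ← Complex.ofReal_mul, ← hρ]
    rw [← e1, Complex.ofReal_mul, show ∀ x y z w c : ℂ, x * y - x * z - 2 * c * (x * w) =
      x * (y - z - 2 * c * w) by intros; ring, key, norm_mul, Complex.norm_real,
      Real.norm_of_nonneg (hW _).le]
    exact mul_le_mul_of_nonneg_left (he l hl) (hW _).le
  -- By Parseval the coarsest low-frequency output contributes the form with symbol `1` instead of
  -- `τ L`.
  have last : ‖(W L : ℂ) * I L - 2 * Real.pi * (W L * (∑' n : ℤ, f L n * F L n) : ℝ)‖ ≤
      W L * e' := by
    have e1 : I L - 2 * Real.pi * ((∑' n : ℤ, f L n * F L n : ℝ) : ℂ) =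
        ∫ k in (-Real.pi)..Real.pi, ((τ L k - 1 : ℝ) : ℂ) * (conj (freq (f L) k) *
          freq (F L) k) := by
      have hc : IntervalIntegrable (fun k => conj (freq (f L) k) * freq (F L) k) volume
          (-Real.pi) Real.pi := Continuous.intervalIntegrable ((Complex.continuous_conj.comp
            (continuous_freq (hf L))).mul (continuous_freq (hF L))) _ _
      rw [← integral_conj_freq_mul_freq (hf L) (hF L)]
      refine (intervalIntegral.integral_sub (hi L le_rfl) hc).symm.trans ?_
      refine intervalIntegral.integral_congr fun k _ => ?_
      push_cast; ring
    rw [Complex.ofReal_mul, show ∀ x y w c : ℂ, x * y - 2 * c * (x * w) = x * (y - 2 * c * w) by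
      intros; ring, e1, norm_mul, Complex.norm_real, Real.norm_of_nonneg (hW _).le]
    exact mul_le_mul_of_nonneg_left he' (hW _).le
  -- The differences `W l * I l - W (l + 1) * I (l + 1)` telescope, leaving `W L * I L` for `last`.
  have tel : (W 0 : ℂ) * I 0 - 2 * Real.pi * ((W L * (∑' n : ℤ, f L n * F L n) +
        ∑ l ∈ Finset.range L, W (l + 1) * H l : ℝ) : ℂ) =
      ∑ l ∈ Finset.range L, ((W l : ℂ) * I l - W (l + 1) * I (l + 1) -
        2 * Real.pi * (W (l + 1) * H l : ℝ)) +
      ((W L : ℂ) * I L - 2 * Real.pi * (W L * (∑' n : ℤ, f L n * F L n) : ℝ)) := by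
    rw [Finset.sum_sub_distrib, Finset.sum_range_sub' (fun l => (W l : ℂ) * I l), ← Finset.mul_sum]
    push_cast; ring
  rw [tel]
  refine (norm_add_le _ _).trans (add_le_add ?_ last)
  exact norm_sum_le_of_le _ fun l hl => step l (Finset.mem_range.1 hl)

/-! ### Bounds on the filters -/

theorem energy_delta (i : ℤ) : energy (delta i) = 1 := by
  unfold energy
  rw [tsum_eq_single i fun n hn => by simp [delta, hn]]
  simp [delta]

theorem memlp_of_finite_support {f : Signal} (hf : (Function.support f).Finite) : Memℓp f 2 :=
  memℓp_gen (summable_of_hasFiniteSupport (hf.subset fun n hn h => hn (by simp [h])))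

/-- One layer applied to the unit signal at `n` has the filter coefficient at `n` as its output at
`0`, so the operator norm bounds every coefficient. -/
theorem abs_scaling_le {A : ℕ → FilterBank} {L : ℕ} {D : ℝ} (hD : 0 ≤ D)
    (h : LayersBounded (fun l => decompose (A l)) L D) {l : ℕ} (hl : l < L) (n : ℤ) :
    |(A l).scaling n| ≤ D := by
  have h1 := h l 1 hl (delta n) (memlp_of_finite_support (support_delta_finite n))
  rw [energy_delta, mul_one] at h1
  have h2 : lowPart (fun l => decompose (A l)) l 1 (delta n) 0 = (A l).scaling n := by
    simp only [lowPart, decompose, decimate, add_zero, mul_zero, zero_add]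
    rw [tsum_eq_single n fun p hp => by simp [delta, hp]]
    simp [delta]
  have h3 : ENNReal.ofReal ((A l).scaling n ^ 2) ≤
      energy (lowPart (fun l => decompose (A l)) l 1 (delta n)) := by
    rw [← h2]; exact ENNReal.le_tsum 0
  have h4 := (h3.trans le_self_add).trans h1
  rw [ENNReal.ofReal_le_ofReal_iff (sq_nonneg D)] at h4
  exact abs_le_of_sq_le_sq h4 hD

theorem norm_freq_supportedIn_le {a : ℤ → ℝ} {N : ℕ} (ha : SupportedIn a N) {c : ℝ}
    (hc : ∀ n, |a n| ≤ c) (k : ℝ) : ‖freq a k‖ ≤ N * c := by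
  obtain ⟨s, hs, h⟩ := ha.exists_finset
  rw [← hs]; exact norm_freq_le h hc k

/-- Both wavelet filters carry the same phase `e^{-ik}` and a conjugation, neither of which changes
the norm. -/
theorem ApproxDispersion.norm_sub_le {ω : ℝ → ℝ} {g h : ℤ → ℤ → ℝ} {L : ℕ} {ε : ℝ}
    (H : ApproxDispersion ω g h L ε) {l : ℕ} (hl : l < L) (k : ℝ) :
    ‖freq (h l) (k + Real.pi) - ((renormDispersion ω l k / renormDispersion ω l Real.pi : ℝ) : ℂ) *
      freq (g l) (k + Real.pi)‖ ≤ ε := by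
  have := H l hl k
  rw [freq_waveletFilter, freq_waveletFilter,
    show ∀ x y z w : ℂ, x * y - z * (x * w) = x * (y - z * w) by intros; ring, norm_mul,
    show -(Complex.I * (k : ℂ)) = Complex.I * ((-k : ℝ) : ℂ) by push_cast; ring,
    norm_exp_I_mul, one_mul, ← RCLike.norm_conj] at this
  rwa [map_sub, map_mul, Complex.conj_conj, Complex.conj_conj, Complex.conj_ofReal] at this

theorem ApproxDispersion.norm_sub_le' {m : ℝ} {g h : ℤ → ℤ → ℝ} {L : ℕ} {ε : ℝ}
    (H : ApproxDispersion (chainDispersion m) g h L ε) {l : ℕ} (hl : l < L) (k : ℝ) :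
    ‖freq (h l) k - ((chainRenorm m l (k + Real.pi) / chainRenorm m l Real.pi : ℝ) : ℂ) *
      freq (g l) k‖ ≤ ε := by
  have := H.norm_sub_le hl (k + Real.pi)
  rwa [show k + Real.pi + Real.pi = k + 2 * Real.pi by ring, freq_add_two_pi, freq_add_two_pi]
    at this

theorem gram_layerG (m : ℝ) (g h : ℤ → ℤ → ℝ) (L : ℕ) (i j : ℤ) :
    gram (layerG (chainDispersion m) g h) L i j =
      layerWeight m L * (∑' n : ℤ, lowIter (fun l => g l) L (delta i) n *
        lowIter (fun l => g l) L (delta j) n) +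
      ∑ l ∈ Finset.range L, layerWeight m (l + 1) *
        ∑' n : ℤ, decimate (waveletFilter (h l)) (lowIter (fun l => g l) l (delta i)) n *
          decimate (waveletFilter (h l)) (lowIter (fun l => g l) l (delta j)) n := by
  have e : ∀ l, ∏ j ∈ Finset.range l, √(chainRenorm m j Real.pi) ^ 2 = layerWeight m l :=
    fun l => Finset.prod_congr rfl fun j _ => Real.sq_sqrt (chainRenorm_nonneg _ _ _)
  have := gram_scaled (fun l => bank (g l) (h l)) (fun l => √(chainRenorm m l Real.pi)) L i j
  simp only [e, bank] at this
  exact this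

theorem gram_layerH (m : ℝ) (g h : ℤ → ℤ → ℝ) (L : ℕ) (i j : ℤ) :
    gram (layerH (chainDispersion m) g h) L i j =
      (layerWeight m L)⁻¹ * (∑' n : ℤ, lowIter (fun l => h l) L (delta i) n *
        lowIter (fun l => h l) L (delta j) n) +
      ∑ l ∈ Finset.range L, (layerWeight m (l + 1))⁻¹ *
        ∑' n : ℤ, decimate (waveletFilter (g l)) (lowIter (fun l => h l) l (delta i)) n *
          decimate (waveletFilter (g l)) (lowIter (fun l => h l) l (delta j)) n := by
  have e : ∀ l, ∏ j ∈ Finset.range l, (1 / √(chainRenorm m j Real.pi)) ^ 2 =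
      (layerWeight m l)⁻¹ := fun l => by
    rw [layerWeight, ← Finset.prod_inv_distrib]
    refine Finset.prod_congr rfl fun j _ => ?_
    rw [div_pow, one_pow, Real.sq_sqrt (chainRenorm_nonneg _ _ _), one_div]
  have := gram_scaled (fun l => bank (h l) (g l)) (fun l => 1 / √(chainRenorm m l Real.pi)) L i j
  simp only [e, bank] at this
  exact this

theorem norm_integral_le_two_pi {F : ℝ → ℂ} {c : ℝ} (h : ∀ k, ‖F k‖ ≤ c) :
    ‖∫ k in (-Real.pi)..Real.pi, F k‖ ≤ 2 * Real.pi * c := by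
  have := intervalIntegral.norm_integral_le_of_norm_le_const (a := -Real.pi) (b := Real.pi)
    fun k _ => h k
  rw [sub_neg_eq_add, abs_of_pos (by positivity)] at this
  linarith

theorem re_conj_freq_delta_mul (i j : ℤ) (k : ℝ) :
    (conj (freq (delta i) k) * freq (delta j) k).re = Real.cos (k * ((i : ℝ) - j)) := by
  rw [freq_delta, freq_delta, ← Complex.exp_conj, ← Complex.exp_add]
  simp only [map_neg, map_mul, Complex.conj_I, Complex.conj_ofReal, map_intCast]
  rw [show -(-Complex.I * k * i) + -(Complex.I * k * j) = ((k * ((i : ℝ) - j) : ℝ) : ℂ) * Complex.I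
    by push_cast; ring, Complex.exp_ofReal_mul_I_re]

theorem re_integral_mul {τ : ℝ → ℝ} {G : ℝ → ℂ}
    (hi : IntervalIntegrable (fun k => (τ k : ℂ) * G k) volume (-Real.pi) Real.pi) :
    (∫ k in (-Real.pi)..Real.pi, (τ k : ℂ) * G k).re =
      ∫ k in (-Real.pi)..Real.pi, τ k * (G k).re := by
  have := Complex.reCLM.intervalIntegral_comp_comm hi
  simp only [Complex.reCLM_apply, Complex.re_ofReal_mul] at this
  exact this.symm

/-! ### Momentum correlations, and position correlations with a mass gap -/

theorem IsFilterFamily.swap {g h : ℤ → ℤ → ℝ} {M : ℕ} (hF : IsFilterFamily g h M) :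
    IsFilterFamily h g M where
  perfect_reconstruction l k := by
    have := congrArg conj (hF.perfect_reconstruction l k)
    rw [map_add, map_mul, map_mul, Complex.conj_conj, Complex.conj_conj, map_ofNat] at this
    rw [← this]; ring
  normalized l := (hF.normalized l).symm
  support_g := hF.support_h
  support_h := hF.support_g

/-- A bound on the Fourier transform of a low-frequency output, up to a factor `2 ^ (-l / 2)`. -/
def lowBound (M : ℕ) (B : ℝ) : ℝ := (M + 1) * (2 * B ^ 2 * (M + 1))

theorem lowBound_nonneg (M : ℕ) (B : ℝ) : 0 ≤ lowBound M B := by unfold lowBound; positivity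

theorem norm_freq_lowIter_le {g h : ℤ → ℤ → ℝ} {M : ℕ} (hF : IsFilterFamily g h M) {N : ℕ}
    {B : ℝ} (hg : ScalingBounded g N B) (hh : ScalingBounded h N B) {l : ℕ} (hl : l ≤ N)
    (i : ℤ) (k : ℝ) :
    ‖freq (lowIter (fun l => g l) l (delta i)) k‖ ≤ lowBound M B / √2 ^ l := by
  have := norm_freq_supportedIn_le
    (supportedIn_lowIter (a := fun l : ℕ => g l) (fun l => hF.support_g l) l i)
    (abs_lowIter_delta_le hF hg hh hl i) k
  refine this.trans (le_of_eq ?_)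
  unfold lowBound; push_cast; ring

theorem norm_freq_scaling_le {g h : ℤ → ℤ → ℝ} {M : ℕ} (hg : ∀ l, SupportedIn (g l) M) {L : ℕ}
    {D : ℝ} (hD : 0 ≤ D) (H : LayersBounded (fun l => decompose (bank (g l) (h l))) L D) {l : ℕ}
    (hl : l < L) (k : ℝ) : ‖freq (g l) k‖ ≤ M * D :=
  norm_freq_supportedIn_le (hg l)
    (abs_scaling_le (A := fun l : ℕ => bank (g l) (h l)) hD H hl) k

theorem div_sqrt_two_pow_sq (c : ℝ) (l : ℕ) :
    (c / √2 ^ l) * (c / √2 ^ l) = c ^ 2 * (1 / 2) ^ l := by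
  rw [div_mul_div_comm, ← mul_pow, Real.mul_self_sqrt zero_le_two, one_div, inv_pow]
  ring

theorem abs_re_le_of_norm_sub_le {z : ℂ} {x c : ℝ} (h : ‖z - 2 * Real.pi * (x : ℂ)‖ ≤ c) :
    |z.re - 2 * Real.pi * x| ≤ c := by
  refine le_trans ?_ h
  refine le_trans (le_of_eq ?_) (Complex.abs_re_le_norm _)
  congr 1
  rw [Complex.sub_re]
  congr 1
  rw [show 2 * (Real.pi : ℂ) * (x : ℂ) = ((2 * Real.pi * x : ℝ) : ℂ) by push_cast; ring,
    Complex.ofReal_re]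

theorem four_pi_mul (x : ℝ) : 4 * Real.pi * (1 / (2 * Real.pi) * (x / 2)) = x := by
  have := Real.pi_ne_zero
  field_simp
  norm_num

theorem one_div_two_mul_mul (x y : ℝ) : 1 / (2 * x) * y = x⁻¹ * y / 2 := by
  rw [one_div, mul_inv]; ring

/-- The telescoping bound with weights `layerWeight m` and symbols `chainRenorm m`. Both signals are
bounded by `lowBound M B / √2 ^ l` uniformly in `k`, so layer `l` contributes `O(ε 2 ^ (-l))` and
the coarsest scale `O(2 ^ (-L))`. -/
theorem abs_groundP_sub_meraP_le {m : ℝ} {g h : ℤ → ℤ → ℝ} {M : ℕ} (hF : IsFilterFamily g h M)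
    {L : ℕ} (hL : 1 ≤ L) {B D ε : ℝ} (hD : 0 ≤ D) (hg : ScalingBounded g L B)
    (hh : ScalingBounded h L B) (hdec : DecompositionBounded (chainDispersion m) g h L D)
    (happ : ApproxDispersion (chainDispersion m) g h L ε) (i j : ℤ) :
    |groundP (chainDispersion m) i j - meraP (chainDispersion m) g h L i j| ≤
      √(m ^ 2 + 1) * (lowBound M B ^ 2 * (2 * (M * D) * ε + (1 / 2) ^ L)) := by
  have hε : 0 ≤ ε := (norm_nonneg _).trans (happ 0 (by omega) 0)
  set f : ℕ → Signal := fun l => lowIter (fun l : ℕ => g l) l (delta i) with hfdef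
  set F : ℕ → Signal := fun l => lowIter (fun l : ℕ => g l) l (delta j) with hFdef
  have hf : ∀ l, (Function.support (f l)).Finite := fun l =>
    (supportedIn_lowIter (fun l => hF.support_g l) l i).finite
  have hF' : ∀ l, (Function.support (F l)).Finite := fun l =>
    (supportedIn_lowIter (fun l => hF.support_g l) l j).finite
  have hfl : ∀ l ≤ L, ∀ k, ‖freq (f l) k‖ ≤ lowBound M B / √2 ^ l := fun l hl k =>
    norm_freq_lowIter_le hF hg hh hl i k
  have hFl : ∀ l ≤ L, ∀ k, ‖freq (F l) k‖ ≤ lowBound M B / √2 ^ l := fun l hl k =>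
    norm_freq_lowIter_le hF hg hh hl j k
  have hgS : ∀ l < L, ∀ k, ‖freq (g l) k‖ ≤ M * D := fun l hl k =>
    norm_freq_scaling_le hF.support_g hD hdec.bound_g hl k
  have hhS : ∀ l < L, ∀ k, ‖freq (h l) k‖ ≤ M * D := fun l hl k =>
    norm_freq_scaling_le hF.support_h hD hdec.bound_h hl k
  have hi : ∀ l ≤ L, IntervalIntegrable (fun k => (chainRenorm m l k : ℂ) *
      (conj (freq (f l) k) * freq (F l) k)) volume (-Real.pi) Real.pi := fun l _ =>
    Continuous.intervalIntegrable ((Complex.continuous_ofReal.comp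
      (continuous_chainRenorm m l)).mul ((Complex.continuous_conj.comp
        (continuous_freq (hf l))).mul (continuous_freq (hF' l)))) _ _
  have main := norm_integral_sub_layers_le (a := fun l => g l) (b := fun l => h l) (f := f)
    (F := F) (W := layerWeight m) (τ := chainRenorm m)
    (ρ := fun l k => chainRenorm m l k / chainRenorm m l Real.pi) (L := L)
    (fun l => SupportedIn.finite (hF.support_g l)) (fun l => SupportedIn.finite (hF.support_h l))
    hf hF' (fun l => rfl) (fun l => rfl) (layerWeight_pos m) (chainRenorm_periodic m)
    (fun l k => by
      rw [layerWeight_succ, mul_assoc, mul_div_cancel₀ _ (chainRenorm_pi_pos m l).ne'])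
    (fun l k => chainRenorm_succ_two_mul m l k) hi
    (e := fun l => 2 * Real.pi * (2 * (M * D) * ε * (lowBound M B ^ 2 * (1 / 2) ^ l)))
    (e' := 2 * Real.pi * (lowBound M B ^ 2 * (1 / 2) ^ L))
    (fun l hl => norm_integral_le_two_pi fun k => by
      refine (norm_layerDefect_le _ _ _ _ (hF.perfect_reconstruction l k)
        (chainRenorm_ratio_nonneg m l k) (chainRenorm_ratio_le_one m l k)
        (chainRenorm_ratio_nonneg m l _) (chainRenorm_ratio_le_one m l _)
        (hgS l hl k) (hgS l hl _) (hhS l hl k) (hhS l hl _) (happ.norm_sub_le' hl k)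
        (happ.norm_sub_le hl k)).trans ?_
      rw [← div_sqrt_two_pow_sq]
      have hs := (norm_nonneg _).trans (hfl l hl.le k)
      calc _ ≤ 1 / 2 * (M * D) * ε * ((lowBound M B / √2 ^ l + lowBound M B / √2 ^ l) *
            (lowBound M B / √2 ^ l + lowBound M B / √2 ^ l)) := by
            gcongr
            exacts [hfl l hl.le _, hfl l hl.le _, hFl l hl.le _, hFl l hl.le _]
        _ = _ := by ring)
    (norm_integral_le_two_pi fun k => by
      rw [norm_mul, norm_mul, RCLike.norm_conj, Complex.norm_real, ← div_sqrt_two_pow_sq]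
      -- This uses `1 ≤ L`: only after one renormalization is the dispersion relation at most `1`.
      have h1 : ‖chainRenorm m L k - 1‖ ≤ 1 := by
        obtain ⟨L', rfl⟩ : ∃ L', L = L' + 1 := ⟨L - 1, by omega⟩
        rw [Real.norm_eq_abs, abs_le]
        constructor <;> linarith [chainRenorm_nonneg m (L' + 1) k, chainRenorm_succ_le_one m L' k]
      have hs := (norm_nonneg _).trans (hfl L le_rfl k)
      refine (mul_le_of_le_one_left (by positivity) h1).trans ?_
      gcongr
      exacts [hfl L le_rfl k, hFl L le_rfl k])
  have hgram := gram_layerG m g h L i j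
  rw [← hgram] at main
  have re := abs_re_le_of_norm_sub_le main
  have hE : ((layerWeight m 0 : ℂ) * ∫ k in (-Real.pi)..Real.pi, (chainRenorm m 0 k : ℂ) *
      (conj (freq (f 0) k) * freq (F 0) k)).re = 4 * Real.pi * groundP (chainDispersion m) i j := by
    rw [Complex.re_ofReal_mul, re_integral_mul (hi 0 (Nat.zero_le _))]
    simp only [hfdef, hFdef, lowIter, re_conj_freq_delta_mul, layerWeight, Finset.range_zero,
      Finset.prod_empty, one_mul, groundP, chainRenorm, renormDispersion]
    simp_rw [div_mul_eq_mul_div]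
    rw [intervalIntegral.integral_div]
    refine (four_pi_mul _).symm.trans ?_
    ring
  rw [hE] at re
  have hsum : ∑ l ∈ Finset.range L, layerWeight m (l + 1) *
      (2 * Real.pi * (2 * (M * D) * ε * (lowBound M B ^ 2 * (1 / 2) ^ l))) +
      layerWeight m L * (2 * Real.pi * (lowBound M B ^ 2 * (1 / 2) ^ L)) ≤
      4 * Real.pi * (√(m ^ 2 + 1) * (lowBound M B ^ 2 * (2 * (M * D) * ε + (1 / 2) ^ L))) := by
    calc _ ≤ ∑ l ∈ Finset.range L, √(m ^ 2 + 1) *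
          (2 * Real.pi * (2 * (M * D) * ε * (lowBound M B ^ 2 * (1 / 2) ^ l))) +
          √(m ^ 2 + 1) * (2 * Real.pi * (lowBound M B ^ 2 * (1 / 2) ^ L)) := by
          gcongr <;> exact layerWeight_le _ _
      _ = √(m ^ 2 + 1) * 2 * Real.pi * lowBound M B ^ 2 *
          (2 * (M * D) * ε * ∑ l ∈ Finset.range L, (1 / 2 : ℝ) ^ l + (1 / 2) ^ L) := by
          simp only [Finset.mul_sum, mul_add]
          congr 1
          · exact Finset.sum_congr rfl fun l _ => by ring
          · ring
      _ ≤ √(m ^ 2 + 1) * 2 * Real.pi * lowBound M B ^ 2 *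
          (2 * (M * D) * ε * 2 + 2 * (1 / 2) ^ L) := by
          gcongr
          · exact sum_geometric_two_le L
          · exact le_mul_of_one_le_left (by positivity) one_le_two
      _ = _ := by ring
  have fin := re.trans hsum
  rw [show 4 * Real.pi * groundP (chainDispersion m) i j -
    2 * Real.pi * gram (layerG (chainDispersion m) g h) L i j = 4 * Real.pi *
      (groundP (chainDispersion m) i j - meraP (chainDispersion m) g h L i j) by
      unfold meraP; ring, abs_mul, abs_of_pos (show 0 < 4 * Real.pi by positivity)] at fin
  exact le_of_mul_le_mul_left fin (by positivity)

theorem layerWeight_inv_mul (m : ℝ) (l : ℕ) (k : ℝ) :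
    (layerWeight m l)⁻¹ * (chainRenorm m l k)⁻¹ =
      (layerWeight m (l + 1))⁻¹ * (chainRenorm m l k / chainRenorm m l Real.pi)⁻¹ := by
  rw [← mul_inv, ← mul_inv, layerWeight_succ, mul_assoc,
    mul_div_cancel₀ _ (chainRenorm_pi_pos m l).ne']

/-- The momentum argument with inverse weights and symbols and with `g` and `h` exchanged. The mass
gap bounds `1 / ω⁽ˡ⁾(k)` by `1 / ω⁽ˡ⁾(0)`, and this combines with the inverse weight to `1 / m` at
every layer (`hw`). -/
theorem abs_groundQ_sub_meraQ_le {m : ℝ} (hm : 0 < m) {g h : ℤ → ℤ → ℝ} {M : ℕ}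
    (hF : IsFilterFamily g h M)
    {L : ℕ} (hL : 1 ≤ L) {B D ε : ℝ} (hD : 0 ≤ D) (hg : ScalingBounded g L B)
    (hh : ScalingBounded h L B) (hdec : DecompositionBounded (chainDispersion m) g h L D)
    (happ : ApproxDispersion (chainDispersion m) g h L ε) (i j : ℤ) :
    |groundQ (chainDispersion m) i j - meraQ (chainDispersion m) g h L i j| ≤
      1 / m * (lowBound M B ^ 2 * (2 * (M * D) * ε + (1 / 2) ^ L)) := by
  have hε : 0 ≤ ε := (norm_nonneg _).trans (happ 0 (by omega) 0)
  set f : ℕ → Signal := fun l => lowIter (fun l : ℕ => h l) l (delta i) with hfdef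
  set F : ℕ → Signal := fun l => lowIter (fun l : ℕ => h l) l (delta j) with hFdef
  have hf : ∀ l, (Function.support (f l)).Finite := fun l =>
    (supportedIn_lowIter (fun l => hF.support_h l) l i).finite
  have hF' : ∀ l, (Function.support (F l)).Finite := fun l =>
    (supportedIn_lowIter (fun l => hF.support_h l) l j).finite
  have hfl : ∀ l ≤ L, ∀ k, ‖freq (f l) k‖ ≤ lowBound M B / √2 ^ l := fun l hl k =>
    norm_freq_lowIter_le hF.swap hh hg hl i k
  have hFl : ∀ l ≤ L, ∀ k, ‖freq (F l) k‖ ≤ lowBound M B / √2 ^ l := fun l hl k =>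
    norm_freq_lowIter_le hF.swap hh hg hl j k
  have hgS : ∀ l < L, ∀ k, ‖freq (g l) k‖ ≤ M * D := fun l hl k =>
    norm_freq_scaling_le hF.support_g hD hdec.bound_g hl k
  have hhS : ∀ l < L, ∀ k, ‖freq (h l) k‖ ≤ M * D := fun l hl k =>
    norm_freq_scaling_le hF.support_h hD hdec.bound_h hl k
  have hpos := chainRenorm_pos hm
  have hrpos : ∀ l k, 0 < chainRenorm m l k / chainRenorm m l Real.pi := fun l k =>
    div_pos (hpos l k) (hpos l _)
  have hi : ∀ l ≤ L, IntervalIntegrable (fun k => ((chainRenorm m l k)⁻¹ : ℝ) *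
      (conj (freq (f l) k) * freq (F l) k)) volume (-Real.pi) Real.pi := fun l _ =>
    Continuous.intervalIntegrable ((Complex.continuous_ofReal.comp
      ((continuous_chainRenorm m l).inv₀ fun k => (hpos l k).ne')).mul
        ((Complex.continuous_conj.comp (continuous_freq (hf l))).mul
          (continuous_freq (hF' l)))) _ _
  have main := norm_integral_sub_layers_le (a := fun l => h l) (b := fun l => g l) (f := f)
    (F := F) (W := fun l => (layerWeight m l)⁻¹) (τ := fun l k => (chainRenorm m l k)⁻¹)
    (ρ := fun l k => (chainRenorm m l k / chainRenorm m l Real.pi)⁻¹) (L := L)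
    (fun l => SupportedIn.finite (hF.support_h l)) (fun l => SupportedIn.finite (hF.support_g l))
    hf hF' (fun l => rfl) (fun l => rfl) (fun l => inv_pos.2 (layerWeight_pos m l))
    (fun l k => by simp only [chainRenorm_periodic m l k])
    (fun l k => layerWeight_inv_mul m l k)
    (fun l k => by rw [chainRenorm_succ_two_mul m l k, mul_inv]) hi
    (e := fun l => 2 * Real.pi * (2 * (M * D) * (ε * (chainRenorm m (l + 1) 0)⁻¹) *
      (lowBound M B ^ 2 * (1 / 2) ^ l)))
    (e' := 2 * Real.pi * ((chainRenorm m L 0)⁻¹ * (lowBound M B ^ 2 * (1 / 2) ^ L)))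
    (fun l hl => norm_integral_le_two_pi fun k => by
      refine (norm_layerDefect_inv_le _ _ _ _ (hF.perfect_reconstruction l k)
        (hrpos l k) (chainRenorm_ratio_le_one m l k) (hrpos l _) (chainRenorm_ratio_le_one m l _)
        (hgS l hl k) (hgS l hl _) (hhS l hl k) (hhS l hl _) (happ.norm_sub_le' hl k)
        (happ.norm_sub_le hl k)).trans ?_
      rw [← div_sqrt_two_pow_sq, ← chainRenorm_succ_two_mul]
      have hs := (norm_nonneg _).trans (hfl l hl.le k)
      have h0 := hpos (l + 1) 0
      calc _ ≤ 1 / 2 * (M * D) * (ε * (chainRenorm m (l + 1) 0)⁻¹) *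
            ((lowBound M B / √2 ^ l + lowBound M B / √2 ^ l) *
            (lowBound M B / √2 ^ l + lowBound M B / √2 ^ l)) := by
            gcongr
            exacts [chainRenorm_zero_le m _ _, hfl l hl.le _, hfl l hl.le _, hFl l hl.le _,
              hFl l hl.le _]
        _ = _ := by ring)
    (norm_integral_le_two_pi fun k => by
      rw [norm_mul, norm_mul, RCLike.norm_conj, Complex.norm_real, ← div_sqrt_two_pow_sq]
      have h1 : ‖(chainRenorm m L k)⁻¹ - 1‖ ≤ (chainRenorm m L 0)⁻¹ := by
        obtain ⟨L', rfl⟩ : ∃ L', L = L' + 1 := ⟨L - 1, by omega⟩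
        have h2 := inv_anti₀ (hpos (L' + 1) 0) (chainRenorm_zero_le m (L' + 1) k)
        have h3 := (one_le_inv₀ (hpos (L' + 1) k)).2 (chainRenorm_succ_le_one m L' k)
        rw [Real.norm_eq_abs, abs_le]
        constructor <;> linarith
      have hs := (norm_nonneg _).trans (hfl L le_rfl k)
      have h0 := hpos L 0
      gcongr
      exacts [hfl L le_rfl k, hFl L le_rfl k])
  have hgram := gram_layerH m g h L i j
  rw [← hgram] at main
  have re := abs_re_le_of_norm_sub_le main
  have hE : ((((layerWeight m 0)⁻¹ : ℝ) : ℂ) * ∫ k in (-Real.pi)..Real.pi,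
      (((chainRenorm m 0 k)⁻¹ : ℝ) : ℂ) * (conj (freq (f 0) k) * freq (F 0) k)).re =
        4 * Real.pi * groundQ (chainDispersion m) i j := by
    rw [Complex.re_ofReal_mul, re_integral_mul (hi 0 (Nat.zero_le _))]
    simp only [hfdef, hFdef, lowIter, re_conj_freq_delta_mul, layerWeight, Finset.range_zero,
      Finset.prod_empty, inv_one, one_mul, groundQ, chainRenorm, renormDispersion]
    simp_rw [one_div_two_mul_mul]
    rw [intervalIntegral.integral_div]
    refine (four_pi_mul _).symm.trans ?_
    ring
  rw [hE] at re
  have hw : ∀ l, (layerWeight m l)⁻¹ * (chainRenorm m l 0)⁻¹ = 1 / m := fun l => by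
    rw [← mul_inv, layerWeight_mul_zero hm.le, one_div]
  have hsum : ∑ l ∈ Finset.range L, (layerWeight m (l + 1))⁻¹ *
      (2 * Real.pi * (2 * (M * D) * (ε * (chainRenorm m (l + 1) 0)⁻¹) *
        (lowBound M B ^ 2 * (1 / 2) ^ l))) +
      (layerWeight m L)⁻¹ *
        (2 * Real.pi * ((chainRenorm m L 0)⁻¹ * (lowBound M B ^ 2 * (1 / 2) ^ L))) ≤
      4 * Real.pi * (1 / m * (lowBound M B ^ 2 * (2 * (M * D) * ε + (1 / 2) ^ L))) := by
    calc _ = 1 / m * 2 * Real.pi * lowBound M B ^ 2 *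
          (2 * (M * D) * ε * ∑ l ∈ Finset.range L, (1 / 2 : ℝ) ^ l + (1 / 2) ^ L) := by
          simp only [Finset.mul_sum, mul_add]
          congr 1
          · exact Finset.sum_congr rfl fun l _ => by rw [← hw (l + 1)]; ring
          · rw [← hw L]; ring
      _ ≤ 1 / m * 2 * Real.pi * lowBound M B ^ 2 *
          (2 * (M * D) * ε * 2 + 2 * (1 / 2) ^ L) := by
          gcongr
          · exact sum_geometric_two_le L
          · exact le_mul_of_one_le_left (by positivity) one_le_two
      _ = _ := by ring
  have fin := re.trans hsum
  rw [show 4 * Real.pi * groundQ (chainDispersion m) i j -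
    2 * Real.pi * gram (layerH (chainDispersion m) g h) L i j = 4 * Real.pi *
      (groundQ (chainDispersion m) i j - meraQ (chainDispersion m) g h L i j) by
      unfold meraQ; ring, abs_mul, abs_of_pos (show 0 < 4 * Real.pi by positivity)] at fin
  exact le_of_mul_le_mul_left fin (by positivity)

/-! ### A division bound for trigonometric polynomials of bounded length -/

theorem exists_lipschitz_unit_disc (Q : Polynomial ℂ) : ∃ K : ℝ, 0 ≤ K ∧ ∀ z w : ℂ, ‖z‖ ≤ 1 →
    ‖w‖ ≤ 1 → ‖Q.eval z - Q.eval w‖ ≤ K * ‖z - w‖ := by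
  induction Q using Polynomial.induction_on' with
  | add p q hp hq =>
    obtain ⟨K, hK0, hK⟩ := hp
    obtain ⟨K', hK0', hK'⟩ := hq
    refine ⟨K + K', add_nonneg hK0 hK0', fun z w hz hw => ?_⟩
    rw [Polynomial.eval_add, Polynomial.eval_add, add_sub_add_comm, add_mul]
    exact norm_add_le_of_le (hK z w hz hw) (hK' z w hz hw)
  | monomial n c =>
    refine ⟨‖c‖ * n, by positivity, fun z w hz hw => ?_⟩
    have key : ∀ n : ℕ, ‖z ^ n - w ^ n‖ ≤ n * ‖z - w‖ := fun n => by
      induction n with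
      | zero => simp
      | succ n ih =>
        have h1 : ‖z * (z ^ n - w ^ n)‖ ≤ n * ‖z - w‖ := by
          rw [norm_mul]
          exact (mul_le_of_le_one_left (norm_nonneg _) hz).trans ih
        have h2 : ‖(z - w) * w ^ n‖ ≤ ‖z - w‖ := by
          rw [norm_mul, norm_pow]
          exact mul_le_of_le_one_right (norm_nonneg _) (pow_le_one₀ (norm_nonneg _) hw)
        rw [show z ^ (n + 1) - w ^ (n + 1) = z * (z ^ n - w ^ n) + (z - w) * w ^ n by ring]
        refine (norm_add_le_of_le h1 h2).trans (le_of_eq ?_)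
        push_cast; ring
    rw [Polynomial.eval_monomial, Polynomial.eval_monomial, ← mul_sub, norm_mul, mul_assoc]
    gcongr
    exact key n

/-- On polynomials of bounded degree, smallness at enough nodes controls the Lipschitz constant. -/
theorem exists_lipschitz_of_nodes {n : ℕ} {v : Fin n → ℂ} (hv : Function.Injective v) :
    ∃ K : ℝ, 0 ≤ K ∧ ∀ (P : Polynomial ℂ) (ε : ℝ), P.degree < n → (∀ j, ‖P.eval (v j)‖ ≤ ε) →
      ∀ z w : ℂ, ‖z‖ ≤ 1 → ‖w‖ ≤ 1 → ‖P.eval z - P.eval w‖ ≤ K * ε * ‖z - w‖ := by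
  -- Lagrange interpolation writes a polynomial as its nodal values times basis polynomials that
  -- depend only on the nodes, so the Lipschitz constants of the basis suffice.
  choose K hK0 hK using fun j => exists_lipschitz_unit_disc (Lagrange.basis Finset.univ v j)
  refine ⟨∑ j, K j, Finset.sum_nonneg fun j _ => hK0 j, fun P ε hP hε z w hz hw => ?_⟩
  have hint := Lagrange.eq_interpolate (s := Finset.univ) (v := v) hv.injOn (by simpa using hP)
  have ev : ∀ z, P.eval z = ∑ j, P.eval (v j) * (Lagrange.basis Finset.univ v j).eval z :=
    fun z => by
      conv_lhs => rw [hint]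
      simp [Lagrange.interpolate_apply, Polynomial.eval_finsetSum]
  rw [ev z, ev w, ← Finset.sum_sub_distrib, Finset.sum_mul, Finset.sum_mul]
  refine norm_sum_le_of_le _ fun j _ => ?_
  rw [← mul_sub, norm_mul, mul_comm (K j), mul_assoc]
  exact mul_le_mul (hε j) (hK j z w hz hw) (norm_nonneg _) ((norm_nonneg _).trans (hε j))

theorem norm_exp_I_mul_sub_le (a b : ℝ) :
    ‖Complex.exp (Complex.I * a) - Complex.exp (Complex.I * b)‖ ≤ |a - b| := by
  have h : Complex.exp (Complex.I * a) - Complex.exp (Complex.I * b) =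
      Complex.exp (Complex.I * b) * (Complex.exp (Complex.I * ((a - b : ℝ) : ℂ)) - 1) := by
    rw [mul_sub, ← Complex.exp_add, mul_one]; push_cast; ring_nf
  rw [h, norm_mul, norm_exp_I_mul, one_mul]
  exact Real.norm_exp_I_mul_ofReal_sub_one_le

/-- The left-hand side is the distance to the nearest zero of `sin (2t)` among `0`, `±π/2`. By
symmetry it suffices to take `0 ≤ x ≤ π/4`, where Jordan's inequality gives `sin (2x) ≥ 4x/π ≥ x`.
-/
theorem min_abs_le_abs_sin {t : ℝ} (ht : |t| ≤ Real.pi / 2) :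
    min |t| (Real.pi / 2 - |t|) ≤ |Real.sin (2 * t)| := by
  have hpi := Real.pi_pos
  have hpi4 := Real.pi_le_four
  have e : |Real.sin (2 * t)| = |Real.sin (2 * |t|)| := by
    rcases abs_choice t with h | h <;> rw [h]
    rw [mul_neg, Real.sin_neg, abs_neg]
  rw [e]
  set u := |t| with hu
  have hu0 : 0 ≤ u := abs_nonneg t
  have key : ∀ x : ℝ, 0 ≤ x → x ≤ Real.pi / 4 → x ≤ Real.sin (2 * x) := fun x h0 h1 => by
    have := Real.mul_le_sin (x := 2 * x) (by linarith) (by linarith)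
    refine le_trans ?_ this
    rw [div_mul_eq_mul_div, le_div_iff₀ hpi]
    nlinarith
  rcases le_total u (Real.pi / 4) with h | h
  · exact (min_le_left _ _).trans ((key u hu0 h).trans (le_abs_self _))
  · refine (min_le_right _ _).trans (le_trans ?_ (le_abs_self _))
    have := key (Real.pi / 2 - u) (by linarith) (by linarith)
    rwa [show 2 * (Real.pi / 2 - u) = Real.pi - 2 * u by ring, Real.sin_pi_sub] at this

/-- The polynomial in `e ^ (-ik/2)` which equals, up to a power of `e ^ (-ik/2)`, the difference
`h(k) - cos (k/2) g(k)`. -/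
def halfAnglePoly (g h : ℤ → ℝ) (s : ℤ) (N : ℕ) : Polynomial ℂ :=
  ∑ r ∈ Finset.range N, (Polynomial.monomial (2 * r + 1) (h (s + r) : ℂ) -
    (Polynomial.monomial (2 * r + 2) (g (s + r) / 2 : ℂ) +
      Polynomial.monomial (2 * r) (g (s + r) / 2 : ℂ)))

theorem degree_halfAnglePoly_lt (g h : ℤ → ℝ) (s : ℤ) (N : ℕ) :
    (halfAnglePoly g h s N).degree < ((2 * N + 1 : ℕ) : WithBot ℕ) := by
  have key : ∀ (p : ℕ) (c : ℂ), p < 2 * N + 1 →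
      (Polynomial.monomial p c).degree < ((2 * N + 1 : ℕ) : WithBot ℕ) := fun p c hp =>
    (Polynomial.degree_monomial_le p c).trans_lt (by exact_mod_cast hp)
  refine (Polynomial.degree_sum_le _ _).trans_lt ?_
  rw [Finset.sup_lt_iff (WithBot.bot_lt_coe _)]
  intro r hr
  have := Finset.mem_range.1 hr
  refine (Polynomial.degree_sub_le _ _).trans_lt (max_lt (key _ _ (by omega)) ?_)
  exact (Polynomial.degree_add_le _ _).trans_lt (max_lt (key _ _ (by omega)) (key _ _ (by omega)))

theorem freq_eq_sum_range {a : ℤ → ℝ} {s : ℤ} {N : ℕ} (ha : ∀ n, a n ≠ 0 → s ≤ n ∧ n < s + N)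
    (k : ℝ) : freq a k = ∑ r ∈ Finset.range N, (a (s + r) : ℂ) *
      Complex.exp (-(Complex.I * k * ((s + r : ℤ) : ℂ))) := by
  rw [freq_eq_sum (s := (Finset.range N).map ⟨fun r : ℕ => s + r, fun x y h => by
    simpa using h⟩), Finset.sum_map]
  · rfl
  · intro n hn
    have := ha n hn
    simp only [Finset.mem_map, Finset.mem_range]
    exact ⟨(n - s).toNat, by omega, by change s + ((n - s).toNat : ℤ) = n; omega⟩

theorem norm_eval_halfAnglePoly {g h : ℤ → ℝ} {s : ℤ} {N : ℕ}
    (hg : ∀ n, g n ≠ 0 → s ≤ n ∧ n < s + N) (hh : ∀ n, h n ≠ 0 → s ≤ n ∧ n < s + N) (t : ℝ) :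
    ‖(halfAnglePoly g h s N).eval (Complex.exp (Complex.I * t))‖ =
      ‖freq h (2 * -t) - (Real.cos t : ℂ) * freq g (2 * -t)‖ := by
  have e : (halfAnglePoly g h s N).eval (Complex.exp (Complex.I * t)) =
      Complex.exp (Complex.I * ((-((2 * s - 1) * t) : ℝ) : ℂ)) *
        (freq h (2 * -t) - (Real.cos t : ℂ) * freq g (2 * -t)) := by
    rw [freq_eq_sum_range hg, freq_eq_sum_range hh, halfAnglePoly, Polynomial.eval_finsetSum,
      Finset.mul_sum, ← Finset.sum_sub_distrib, Finset.mul_sum]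
    refine Finset.sum_congr rfl fun r _ => ?_
    simp only [Polynomial.eval_sub, Polynomial.eval_add, Polynomial.eval_monomial,
      ← Complex.exp_nat_mul]
    rw [Complex.ofReal_cos, Complex.cos]
    have h1 : Complex.exp (((2 * r + 1 : ℕ) : ℂ) * (Complex.I * t)) =
        Complex.exp (Complex.I * ((-((2 * s - 1) * t) : ℝ) : ℂ)) *
          Complex.exp (-(Complex.I * ((2 * -t : ℝ) : ℂ) * ((s + r : ℤ) : ℂ))) := by
      rw [← Complex.exp_add]; push_cast; ring_nf
    have h2 : Complex.exp (((2 * r + 2 : ℕ) : ℂ) * (Complex.I * t)) =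
        Complex.exp (((2 * r + 1 : ℕ) : ℂ) * (Complex.I * t)) * Complex.exp (t * Complex.I) := by
      rw [← Complex.exp_add]; push_cast; ring_nf
    have h3 : Complex.exp (((2 * r : ℕ) : ℂ) * (Complex.I * t)) =
        Complex.exp (((2 * r + 1 : ℕ) : ℂ) * (Complex.I * t)) * Complex.exp (-t * Complex.I) := by
      rw [← Complex.exp_add]; push_cast; ring_nf
    rw [h2, h3, h1]
    ring
  rw [e, norm_mul, norm_exp_I_mul, one_mul]

/-- For `|k| ≤ π` the absolute value around `cos (k/2)` can be dropped, and the deviation becomes,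
up to phase, a polynomial of degree at most `2N` in `e^{-ik/2}`. Being at most `ε` at enough nodes,
it has Lipschitz constant `K ε`, with `K` depending on `N` alone. It vanishes at `k = 0` and `k =
±π`, so it is at most `K ε` times the distance of `k/2` to `{0, ±π/2}`, hence at most `K ε |sin k|`.
-/
theorem exists_massless_defect_bound (N : ℕ) : ∃ K : ℝ, 0 ≤ K ∧ ∀ (g h : ℤ → ℝ) (s : ℤ) (ε : ℝ),
    (∀ n, g n ≠ 0 → s ≤ n ∧ n < s + N) → (∀ n, h n ≠ 0 → s ≤ n ∧ n < s + N) →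
    (∀ k, ‖freq h k - (|Real.cos (k / 2)| : ℝ) * freq g k‖ ≤ ε) → freq h Real.pi = 0 →
    freq h 0 = freq g 0 →
    ∀ k, ‖freq h k - (|Real.cos (k / 2)| : ℝ) * freq g k‖ ≤ K * ε * |Real.sin k| := by
  have hpi := Real.pi_pos
  have hpi3 := Real.pi_gt_three
  -- There are `2N + 1` nodes for degree at most `2N`. Their angles lie in `[0, 1] ⊆ [0, π/2]`, so
  -- they are distinct and the cosine is nonnegative at each of them.
  have hv : Function.Injective fun j : Fin (2 * N + 1) =>
      Complex.exp (Complex.I * ((j / (2 * N + 1) : ℝ) : ℂ)) := fun i j hij => by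
    have hb : ∀ j : Fin (2 * N + 1), (0 : ℝ) ≤ j / (2 * N + 1) ∧ (j : ℝ) / (2 * N + 1) ≤ 1 :=
      fun j => ⟨by positivity, by
        rw [div_le_one (by positivity)]; exact_mod_cast j.2.le⟩
    have him : ∀ x : ℝ, (Complex.I * (x : ℂ)).im = x := fun x => by
      rw [Complex.I_mul_im, Complex.ofReal_re]
    have := Complex.exp_inj_of_neg_pi_lt_of_le_pi (x := Complex.I * ((i / (2 * N + 1) : ℝ) : ℂ))
      (y := Complex.I * ((j / (2 * N + 1) : ℝ) : ℂ)) (by rw [him]; linarith [(hb i).1])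
      (by rw [him]; linarith [(hb i).2]) (by rw [him]; linarith [(hb j).1])
      (by rw [him]; linarith [(hb j).2])
      hij
    have h1 := mul_left_cancel₀ Complex.I_ne_zero this
    have h2 := Complex.ofReal_inj.1 h1
    rw [div_left_inj' (by positivity)] at h2
    exact Fin.ext (by exact_mod_cast h2)
  obtain ⟨K, hK0, hK⟩ := exists_lipschitz_of_nodes hv
  refine ⟨K, hK0, fun g h s ε hg hh hε hπ h0 => ?_⟩
  have hε0 : 0 ≤ ε := (norm_nonneg _).trans (hε 0)
  set P := halfAnglePoly g h s N with hP
  have hev : ∀ t : ℝ, |t| ≤ Real.pi / 2 → ‖P.eval (Complex.exp (Complex.I * t))‖ =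
      ‖freq h (2 * -t) - (|Real.cos ((2 * -t) / 2)| : ℝ) * freq g (2 * -t)‖ := fun t ht => by
    rw [norm_eval_halfAnglePoly hg hh, mul_div_cancel_left₀ _ (two_ne_zero), Real.cos_neg,
      abs_of_nonneg (Real.cos_nonneg_of_neg_pi_div_two_le_of_le (abs_le.1 ht).1 (abs_le.1 ht).2)]
  have hlip := fun a b : ℝ => hK P ε (degree_halfAnglePoly_lt g h s N) (fun j => by
      have hb0 : (0 : ℝ) ≤ j / (2 * N + 1) := by positivity
      have hb1 : (j : ℝ) / (2 * N + 1) ≤ 1 := by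
        rw [div_le_one (by positivity)]; exact_mod_cast j.2.le
      rw [hev _ (by rw [abs_of_nonneg hb0]; linarith)]
      exact hε _) (Complex.exp (Complex.I * a)) (Complex.exp (Complex.I * b))
      (norm_exp_I_mul a).le (norm_exp_I_mul b).le
  have hdist : ∀ a b : ℝ, P.eval (Complex.exp (Complex.I * b)) = 0 →
      ‖P.eval (Complex.exp (Complex.I * a))‖ ≤ K * ε * |a - b| := fun a b hb => by
    have := hlip a b
    rw [hb, sub_zero] at this
    exact this.trans (by gcongr; exact norm_exp_I_mul_sub_le a b)
  have hz0 : P.eval (Complex.exp (Complex.I * (0 : ℝ))) = 0 := by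
    rw [← norm_eq_zero, norm_eval_halfAnglePoly hg hh]; simp [h0]
  have hz1 : P.eval (Complex.exp (Complex.I * ((Real.pi / 2 : ℝ) : ℂ))) = 0 := by
    rw [← norm_eq_zero, norm_eval_halfAnglePoly hg hh, ← freq_add_two_pi,
      show 2 * -(Real.pi / 2) + 2 * Real.pi = Real.pi by ring, hπ]
    simp
  have hz2 : P.eval (Complex.exp (Complex.I * ((-(Real.pi / 2) : ℝ) : ℂ))) = 0 := by
    rw [← norm_eq_zero, norm_eval_halfAnglePoly hg hh,
      show 2 * - -(Real.pi / 2) = Real.pi by ring, hπ]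
    simp
  have main : ∀ t : ℝ, |t| ≤ Real.pi / 2 →
      ‖P.eval (Complex.exp (Complex.I * t))‖ ≤ K * ε * |Real.sin (2 * t)| := fun t ht => by
    refine le_trans ?_ (mul_le_mul_of_nonneg_left (min_abs_le_abs_sin ht) (by positivity))
    rw [mul_min_of_nonneg _ _ (by positivity), le_min_iff]
    constructor
    · have := hdist t 0 hz0
      rwa [sub_zero] at this
    · rcases le_total 0 t with h | h
      · have := hdist t _ hz1
        rw [abs_sub_comm, abs_of_nonneg (by linarith [le_abs_self t])] at this
        rwa [abs_of_nonneg h]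
      · have := hdist t _ hz2
        rw [abs_of_nonneg (by linarith [neg_le_abs t])] at this
        rw [abs_of_nonpos h]
        linarith
  intro k
  -- The polynomial describes the deviation only for `|k| ≤ π`; both sides are `2π`-periodic.
  have hper : Function.Periodic (fun k : ℝ =>
      (‖freq h k - (|Real.cos (k / 2)| : ℝ) * freq g k‖, Real.sin k)) (2 * Real.pi) := fun k => by
    simp only [freq_add_two_pi, Real.sin_add_two_pi]
    rw [show (k + 2 * Real.pi) / 2 = k / 2 + Real.pi by ring, Real.cos_add_pi, abs_neg]
  obtain ⟨y, hy, he⟩ := hper.exists_mem_Ioc Real.two_pi_pos k (-Real.pi)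
  obtain ⟨he1, he2⟩ := Prod.mk.inj he
  rw [he1, he2]
  have hyt : |-(y / 2)| ≤ Real.pi / 2 := by
    rw [abs_neg, abs_le]
    constructor <;> linarith [hy.1, hy.2]
  have := main _ hyt
  rw [hev _ hyt, show 2 * - -(y / 2) = y by ring, show 2 * -(y / 2) = -y by ring, Real.sin_neg,
    abs_neg] at this
  exact this

/-! ### Sequences with a square integrable Fourier transform -/

/-- The Fourier transforms of real square summable sequences. -/
structure IsHermitianL2 (F : ℝ → ℂ) : Prop where
  memLp : MemLp F 2 (volume.restrict (Set.Ioc (-Real.pi) Real.pi))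
  neg_eq_conj : ∀ k, F (-k) = conj (F k)

theorem neg_pi_le_pi : -Real.pi ≤ Real.pi := by linarith [Real.pi_pos]

theorem norm_exp_I_mul_mul (x y : ℝ) : ‖Complex.exp (Complex.I * x * y)‖ = 1 := by
  rw [show Complex.I * (x : ℂ) * y = Complex.I * ((x * y : ℝ) : ℂ) by push_cast; ring,
    norm_exp_I_mul]

theorem IsHermitianL2.mul_exp {F : ℝ → ℂ} (hF : IsHermitianL2 F) (n : ℤ) :
    IsHermitianL2 fun k => F k * Complex.exp (Complex.I * k * n) where
  memLp := by
    refine hF.memLp.congr_norm (hF.memLp.aestronglyMeasurable.mul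
      (Continuous.aestronglyMeasurable (by fun_prop))) (Filter.Eventually.of_forall fun k => ?_)
    have := norm_exp_I_mul_mul k n
    push_cast at this
    rw [norm_mul, this, mul_one]
  neg_eq_conj k := by
    rw [hF.neg_eq_conj, map_mul, ← Complex.exp_conj]
    simp

theorem IsHermitianL2.add {F G : ℝ → ℂ} (hF : IsHermitianL2 F) (hG : IsHermitianL2 G) :
    IsHermitianL2 fun k => F k + G k where
  memLp := hF.memLp.add hG.memLp
  neg_eq_conj k := by rw [hF.neg_eq_conj, hG.neg_eq_conj, map_add]

theorem IsHermitianL2.intervalIntegrable {F : ℝ → ℂ} (hF : IsHermitianL2 F) :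
    IntervalIntegrable F volume (-Real.pi) Real.pi := by
  rw [intervalIntegrable_iff_integrableOn_Ioc_of_le neg_pi_le_pi]
  exact hF.memLp.integrable one_le_two

theorem IsHermitianL2.intervalIntegrable_sq {F : ℝ → ℂ} (hF : IsHermitianL2 F) :
    IntervalIntegrable (fun k => ‖F k‖ ^ 2) volume (-Real.pi) Real.pi := by
  rw [intervalIntegrable_iff_integrableOn_Ioc_of_le neg_pi_le_pi]
  exact (memLp_two_iff_integrable_sq_norm hF.memLp.aestronglyMeasurable).1 hF.memLp

theorem IsHermitianL2.intervalIntegrable_conj_mul {F G : ℝ → ℂ} (hF : IsHermitianL2 F)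
    (hG : IsHermitianL2 G) :
    IntervalIntegrable (fun k => conj (F k) * G k) volume (-Real.pi) Real.pi := by
  rw [intervalIntegrable_iff_integrableOn_Ioc_of_le neg_pi_le_pi]
  exact hF.memLp.star.integrable_mul hG.memLp

theorem IsHermitianL2.im_integral {F : ℝ → ℂ} (hF : IsHermitianL2 F) :
    (∫ k in (-Real.pi)..Real.pi, F k).im = 0 := by
  rw [← Complex.conj_eq_iff_im, ← intervalIntegral.intervalIntegral_conj]
  simp_rw [← hF.neg_eq_conj]
  rw [intervalIntegral.integral_comp_neg, neg_neg]

/-- Hermitian symmetry makes the integral real, so the real part taken in `fourierSeq` discards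
nothing. -/
theorem ofReal_fourierSeq {F : ℝ → ℂ} (hF : IsHermitianL2 F) (n : ℤ) :
    (fourierSeq F n : ℂ) = 1 / (2 * Real.pi) *
      ∫ k in (-Real.pi)..Real.pi, F k * Complex.exp (Complex.I * k * n) := by
  rw [fourierSeq]
  apply Complex.ext
  · simp
  · have := (hF.mul_exp n).im_integral
    rw [Complex.ofReal_im, show (1 : ℂ) / (2 * Real.pi) = ((1 / (2 * Real.pi) : ℝ) : ℂ) by
      push_cast; ring, Complex.im_ofReal_mul, this, mul_zero]

theorem fourierSeq_add {F G : ℝ → ℂ} (hF : IsHermitianL2 F) (hG : IsHermitianL2 G) (n : ℤ) :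
    fourierSeq (fun k => F k + G k) n = fourierSeq F n + fourierSeq G n := by
  apply Complex.ofReal_injective
  rw [Complex.ofReal_add, ofReal_fourierSeq hF, ofReal_fourierSeq hG,
    ofReal_fourierSeq (hF.add hG), ← mul_add,
    ← intervalIntegral.integral_add (hF.mul_exp n).intervalIntegrable
      (hG.mul_exp n).intervalIntegrable]
  simp_rw [add_mul]

theorem hasSum_fourierSeq_sq {F : ℝ → ℂ} (hF : IsHermitianL2 F) :
    HasSum (fun n => fourierSeq F n ^ 2)
      (1 / (2 * Real.pi) * ∫ k in (-Real.pi)..Real.pi, ‖F k‖ ^ 2) := by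
  have hlt : -Real.pi < Real.pi := by linarith [Real.pi_pos]
  have h := hasSum_sq_fourierCoeffOn hlt hF.memLp
  -- `fourierCoeffOn` integrates against `e^{-ikn}`, so `fourierSeq F n` is the coefficient of index
  -- `-n`.
  rw [← (Equiv.neg ℤ).hasSum_iff] at h
  have e : ∀ n : ℤ, ‖fourierCoeffOn hlt F (-n)‖ ^ 2 = fourierSeq F n ^ 2 := fun n => by
    rw [fourierCoeffOn_eq_integral, neg_neg]
    have : ∀ x : ℝ, (fourier n (x : AddCircle (Real.pi - -Real.pi)) : ℂ) • F x =
        F x * Complex.exp (Complex.I * x * n) := fun x => by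
      rw [fourier_coe_apply, smul_eq_mul, mul_comm]
      congr 2
      have := Real.pi_ne_zero
      have h2 : (Real.pi : ℂ) ≠ 0 := by exact_mod_cast this
      push_cast
      rw [show (Real.pi : ℂ) - -Real.pi = 2 * Real.pi by ring]
      field_simp
    simp_rw [this]
    have e2 : (1 / (Real.pi - -Real.pi)) • ∫ k in (-Real.pi)..Real.pi,
        F k * Complex.exp (Complex.I * k * n) = (fourierSeq F n : ℂ) := by
      rw [ofReal_fourierSeq hF, Complex.real_smul]
      push_cast; ring
    rw [e2, Complex.norm_real, Real.norm_eq_abs, sq_abs]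
  convert h using 1
  · ext n; exact (e n).symm
  · rw [smul_eq_mul]; congr 1; rw [one_div]; congr 1; ring

/-- Polarization of the Parseval identity. -/
theorem hasSum_fourierSeq_mul {F G : ℝ → ℂ} (hF : IsHermitianL2 F) (hG : IsHermitianL2 G) :
    HasSum (fun n => fourierSeq F n * fourierSeq G n)
      (1 / (2 * Real.pi) * (∫ k in (-Real.pi)..Real.pi, conj (F k) * G k).re) := by
  have h := ((((hasSum_fourierSeq_sq (hF.add hG)).sub (hasSum_fourierSeq_sq hF)).sub
    (hasSum_fourierSeq_sq hG))).mul_left (1 / 2)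
  have hi := hF.intervalIntegrable_conj_mul hG
  have hre : (∫ k in (-Real.pi)..Real.pi, conj (F k) * G k).re =
      ∫ k in (-Real.pi)..Real.pi, (conj (F k) * G k).re :=
    (Complex.reCLM.intervalIntegral_comp_comm hi).symm
  have hsplit : ∫ k in (-Real.pi)..Real.pi, ‖F k + G k‖ ^ 2 =
      (∫ k in (-Real.pi)..Real.pi, ‖F k‖ ^ 2) + (∫ k in (-Real.pi)..Real.pi, ‖G k‖ ^ 2) +
        2 * ∫ k in (-Real.pi)..Real.pi, (conj (F k) * G k).re := by
    have hir : IntervalIntegrable (fun k => (conj (F k) * G k).re) volume (-Real.pi) Real.pi := by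
      rw [intervalIntegrable_iff_integrableOn_Ioc_of_le neg_pi_le_pi] at hi ⊢
      exact hi.re
    rw [← intervalIntegral.integral_const_mul, ← intervalIntegral.integral_add
      hF.intervalIntegrable_sq hG.intervalIntegrable_sq, ← intervalIntegral.integral_add
      (hF.intervalIntegrable_sq.add hG.intervalIntegrable_sq) (hir.const_mul 2)]
    refine intervalIntegral.integral_congr fun k _ => ?_
    simp only [← Complex.normSq_eq_norm_sq, Complex.normSq_add]
    congr 2
    simp
  rw [hsplit] at h
  rw [hre]
  have e1 : (fun n => fourierSeq F n * fourierSeq G n) = fun n => 1 / 2 *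
      (fourierSeq (fun k => F k + G k) n ^ 2 - fourierSeq F n ^ 2 - fourierSeq G n ^ 2) := by
    ext n
    rw [fourierSeq_add hF hG]; ring
  have e2 : ∀ A B X c : ℝ, 1 / 2 * (c * (A + B + 2 * X) - c * A - c * B) = c * X := by
    intros; ring
  rw [e2] at h
  rw [e1]
  exact h

/-- Filters of `g̃` need not have finite support, so the downsampling rule is proved again for
square integrable symbols: each output entry is a Parseval pairing with a shifted signal, and the
even shift `2n` is insensitive to `k ↦ k + π`. -/
theorem decimate_fourierSeq {F G H : ℝ → ℂ} (hF : IsHermitianL2 F) (hG : IsHermitianL2 G)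
    (hH : IsHermitianL2 H) (pF : Function.Periodic F (2 * Real.pi))
    (pG : Function.Periodic G (2 * Real.pi)) (pH : Function.Periodic H (2 * Real.pi))
    (h : ∀ k, H (2 * k) = 1 / 2 * (conj (F k) * G k +
      conj (F (k + Real.pi)) * G (k + Real.pi))) :
    decimate (fourierSeq F) (fourierSeq G) = fourierSeq H := by
  ext n
  have hs : ∀ r : ℤ, fourierSeq G (2 * n + r) =
      fourierSeq (fun k => G k * Complex.exp (Complex.I * k * ((2 * n : ℤ) : ℂ))) r := fun r => by
    unfold fourierSeq
    congr 3; ext k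
    simp only
    rw [mul_assoc (G k), ← Complex.exp_add]
    push_cast; ring_nf
  unfold decimate
  simp_rw [hs]
  rw [(hasSum_fourierSeq_mul hF (hG.mul_exp (2 * n))).tsum_eq]
  have hexp : ∀ (k : ℝ) (n : ℤ), Complex.exp (Complex.I * ((k + 2 * Real.pi : ℝ) : ℂ) * n) =
      Complex.exp (Complex.I * k * n) := fun k n => by
    rw [show Complex.I * ((k + 2 * Real.pi : ℝ) : ℂ) * n =
      Complex.I * k * n + n * (2 * Real.pi * Complex.I) by push_cast; ring]
    exact Complex.exp_periodic.int_mul n _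
  have hexp' : ∀ k : ℝ, Complex.exp (Complex.I * ((k + Real.pi : ℝ) : ℂ) * ((2 * n : ℤ) : ℂ)) =
      Complex.exp (Complex.I * k * ((2 * n : ℤ) : ℂ)) := fun k => by
    rw [show Complex.I * ((k + Real.pi : ℝ) : ℂ) * ((2 * n : ℤ) : ℂ) =
      Complex.I * k * ((2 * n : ℤ) : ℂ) + n * (2 * Real.pi * Complex.I) by push_cast; ring]
    exact Complex.exp_periodic.int_mul n _
  have pP : Function.Periodic (fun k : ℝ => conj (F k) *
      (G k * Complex.exp (Complex.I * k * ((2 * n : ℤ) : ℂ)))) (2 * Real.pi) := fun k => by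
    simp only [pF k, pG k, hexp]
  have pQ : Function.Periodic (fun k : ℝ => H k * Complex.exp (Complex.I * k * n))
      (2 * Real.pi) := fun k => by simp only [pH k, hexp]
  have iP := hF.intervalIntegrable_conj_mul (hG.mul_exp (2 * n))
  have key : ∫ k in (-Real.pi)..Real.pi, conj (F k) *
      (G k * Complex.exp (Complex.I * k * ((2 * n : ℤ) : ℂ))) =
      ∫ k in (-Real.pi)..Real.pi, H k * Complex.exp (Complex.I * k * n) := by
    have iP' := intervalIntegrable_comp_add_pi pP iP
    rw [← integral_comp_two_mul pQ (hH.mul_exp n).intervalIntegrable]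
    have e1 := integral_comp_add_pi pP
    have e2 : ∫ k in (-Real.pi)..Real.pi, conj (F k) *
        (G k * Complex.exp (Complex.I * k * ((2 * n : ℤ) : ℂ))) = 1 / 2 *
        ((∫ k in (-Real.pi)..Real.pi, conj (F k) *
          (G k * Complex.exp (Complex.I * k * ((2 * n : ℤ) : ℂ)))) +
        ∫ k in (-Real.pi)..Real.pi, conj (F (k + Real.pi)) * (G (k + Real.pi) *
          Complex.exp (Complex.I * ((k + Real.pi : ℝ) : ℂ) * ((2 * n : ℤ) : ℂ)))) := by
      rw [e1]; ring
    rw [e2, ← intervalIntegral.integral_add iP iP', ← intervalIntegral.integral_const_mul]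
    refine intervalIntegral.integral_congr fun k _ => ?_
    simp only [hexp', h]
    push_cast
    rw [show Complex.I * (2 * (k : ℂ)) * n = Complex.I * k * (2 * n) by ring]
    ring
  rw [key, fourierSeq, show (1 : ℂ) / (2 * Real.pi) = ((1 / (2 * Real.pi) : ℝ) : ℂ) by
      push_cast; ring, Complex.re_ofReal_mul]

theorem energy_fourierSeq {F : ℝ → ℂ} (hF : IsHermitianL2 F) :
    energy (fourierSeq F) =
      ENNReal.ofReal (1 / (2 * Real.pi) * ∫ k in (-Real.pi)..Real.pi, ‖F k‖ ^ 2) := by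
  rw [energy, ← ENNReal.ofReal_tsum_of_nonneg (fun n => sq_nonneg _)
    (hasSum_fourierSeq_sq hF).summable, (hasSum_fourierSeq_sq hF).tsum_eq]

theorem memlp_fourierSeq {F : ℝ → ℂ} (hF : IsHermitianL2 F) : Memℓp (fourierSeq F) 2 :=
  memℓp_gen (by simpa using (hasSum_fourierSeq_sq hF).summable)

/-! ### Zeros of trigonometric polynomials -/

theorem abs_sin_nat_mul_le (n : ℕ) (x : ℝ) : |Real.sin (n * x)| ≤ n * |Real.sin x| := by
  induction n with
  | zero => simp
  | succ n ih =>
    push_cast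
    rw [add_mul, one_mul, Real.sin_add, add_mul, one_mul]
    refine (abs_add_le _ _).trans (add_le_add ?_ ?_)
    · rw [abs_mul]
      exact (mul_le_of_le_one_right (abs_nonneg _) (Real.abs_cos_le_one _)).trans ih
    · rw [abs_mul]
      exact mul_le_of_le_one_left (abs_nonneg _) (Real.abs_cos_le_one _)

theorem norm_exp_sub_exp (a b : ℝ) :
    ‖Complex.exp (Complex.I * a) - Complex.exp (Complex.I * b)‖ =
      2 * |Real.sin ((a - b) / 2)| := by
  have h : Complex.exp (Complex.I * a) - Complex.exp (Complex.I * b) =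
      Complex.exp (Complex.I * b) * (Complex.exp (Complex.I * ((a - b : ℝ) : ℂ)) - 1) := by
    rw [mul_sub, ← Complex.exp_add, mul_one]; push_cast; ring_nf
  rw [h, norm_mul, norm_exp_I_mul, one_mul, Complex.norm_exp_I_mul_ofReal_sub_one, norm_mul]
  simp

/-- Each frequency obeys `|e^{-ikn} - e^{-ik₀n}| = 2 |sin (n (k - k₀)/2)| ≤ 2 |n| |sin ((k -
k₀)/2)|`. Only finiteness of `C` matters: it makes the quotients by `|sin|` and `|cos|` bounded. -/
theorem exists_norm_freq_le_sin {a : ℤ → ℝ} (ha : (Function.support a).Finite) {k₀ : ℝ}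
    (h0 : freq a k₀ = 0) :
    ∃ C : ℝ, 0 ≤ C ∧ ∀ k, ‖freq a k‖ ≤ C * |Real.sin ((k - k₀) / 2)| := by
  obtain ⟨s, hs⟩ := exists_finset_of_finite ha
  refine ⟨∑ n ∈ s, |a n| * (2 * n.natAbs), Finset.sum_nonneg fun n _ => by positivity, fun k => ?_⟩
  rw [show freq a k = freq a k - freq a k₀ by rw [h0, sub_zero], freq_eq_sum hs, freq_eq_sum hs,
    ← Finset.sum_sub_distrib, Finset.sum_mul]
  refine norm_sum_le_of_le _ fun n _ => ?_
  rw [← mul_sub, norm_mul, Complex.norm_real, Real.norm_eq_abs, mul_assoc |a n|]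
  refine mul_le_mul_of_nonneg_left ?_ (abs_nonneg (a n))
  rw [show -(Complex.I * k * n) = Complex.I * ((-(k * n) : ℝ) : ℂ) by push_cast; ring,
    show -(Complex.I * k₀ * n) = Complex.I * ((-(k₀ * n) : ℝ) : ℂ) by push_cast; ring,
    norm_exp_sub_exp, mul_assoc]
  refine mul_le_mul_of_nonneg_left ?_ (zero_le_two (α := ℝ))
  rw [show (-(k * n) - -(k₀ * n)) / 2 = -(n * ((k - k₀) / 2)) by ring, Real.sin_neg, abs_neg]
  refine le_trans (le_of_eq ?_) (abs_sin_nat_mul_le n.natAbs _)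
  rcases Int.natAbs_eq n with h | h
  · rw [show (n.natAbs : ℝ) = n by rw [h]; simp]
  · rw [show (n.natAbs : ℝ) = -n by
      have : (n : ℝ) = ((-(n.natAbs : ℤ) : ℤ) : ℝ) := by exact_mod_cast h
      rw [this]; simp, neg_mul, Real.sin_neg, abs_neg]

/-! ### The massless chain: filters reproducing the dispersion relation exactly -/

theorem chainRenorm_massless_ratio_inv (l : ℕ) (k : ℝ) :
    chainRenorm 0 l Real.pi / chainRenorm 0 l (k + Real.pi) = |Real.cos (k / 2)|⁻¹ := by
  rw [← inv_div, chainRenorm_massless_ratio,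
    show (k + Real.pi) / 2 = k / 2 + Real.pi / 2 by ring, Real.sin_add_pi_div_two]

theorem tildeScalingSymbol_massless (l : ℕ) (h : ℤ → ℝ) (k : ℝ) :
    tildeScalingSymbol (chainRenorm 0 l) h k = ((|Real.cos (k / 2)|⁻¹ : ℝ) : ℂ) * freq h k := by
  rw [tildeScalingSymbol, chainRenorm_massless_ratio_inv]

theorem abs_cos_half_periodic : Function.Periodic (fun k : ℝ => |Real.cos (k / 2)|)
    (2 * Real.pi) := fun k => by
  simp only
  rw [show (k + 2 * Real.pi) / 2 = k / 2 + Real.pi by ring, Real.cos_add_pi, abs_neg]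

theorem abs_sin_half_periodic : Function.Periodic (fun k : ℝ => |Real.sin (k / 2)|)
    (2 * Real.pi) := fun k => by
  simp only
  rw [show (k + 2 * Real.pi) / 2 = k / 2 + Real.pi by ring, Real.sin_add_pi, abs_neg]

/-- The symbol is `h(k) / |cos (k/2)|`. A nonzero value of `h` at `π` would make it at least a
constant times `1 / |k - π|` near `π`, which is not integrable. -/
theorem freq_pi_eq_zero_of_memLp {l : ℕ} {h : ℤ → ℝ} (hh : (Function.support h).Finite)
    (H : MemLp (tildeScalingSymbol (chainRenorm 0 l) h) 2
      (volume.restrict (Set.Ioc (-Real.pi) Real.pi))) : freq h Real.pi = 0 := by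
  by_contra h0
  have hpi := Real.pi_pos
  set f := tildeScalingSymbol (chainRenorm 0 l) h with hf
  have hfk : ∀ k, f k = ((|Real.cos (k / 2)|⁻¹ : ℝ) : ℂ) * freq h k :=
    tildeScalingSymbol_massless l h
  have hi : IntervalIntegrable f volume (-Real.pi) Real.pi := by
    rw [intervalIntegrable_iff_integrableOn_Ioc_of_le neg_pi_le_pi]
    exact H.integrable one_le_two
  have hper : Function.Periodic f (2 * Real.pi) := fun k => by
    have := abs_cos_half_periodic k
    simp only at this
    rw [hfk, hfk, this, freq_add_two_pi]
  have hi' := intervalIntegrable_of_periodic hper hi 0 (2 * Real.pi)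
  refine not_intervalIntegrable_of_sub_inv_isBigO_punctured (c := Real.pi) ?_ (by positivity)
    (by rw [Set.uIcc_of_le (by positivity)]; constructor <;> linarith) hi'
  have hc0 : 0 < ‖freq h Real.pi‖ := norm_pos_iff.2 h0
  refine Asymptotics.IsBigO.of_bound (1 / ‖freq h Real.pi‖) ?_
  have e1 : ∀ᶠ x in 𝓝[≠] Real.pi, ‖freq h Real.pi‖ / 2 < ‖freq h x‖ :=
    ((continuous_freq hh).norm.continuousAt.eventually_const_lt (by linarith)).filter_mono
      nhdsWithin_le_nhds
  have e2 : ∀ᶠ x in 𝓝[≠] Real.pi, x ∈ Metric.ball Real.pi 1 :=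
    Filter.Eventually.filter_mono nhdsWithin_le_nhds (Metric.ball_mem_nhds _ one_pos)
  filter_upwards [e1, e2, self_mem_nhdsWithin] with x h1 h2 h3
  have h3' : 0 < |x - Real.pi| := abs_pos.2 (sub_ne_zero.2 h3)
  rw [Metric.mem_ball, Real.dist_eq] at h2
  have hcos : |Real.cos (x / 2)| = |Real.sin ((x - Real.pi) / 2)| := by
    rw [show (x - Real.pi) / 2 = x / 2 - Real.pi / 2 by ring, Real.sin_sub_pi_div_two, abs_neg]
  have hle : |Real.cos (x / 2)| ≤ |x - Real.pi| / 2 := by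
    rw [hcos]
    refine Real.abs_sin_le_abs.trans ?_
    rw [abs_div, abs_two]
  have hpos : 0 < |Real.cos (x / 2)| := by
    rw [hcos, abs_pos]
    intro hs
    have hab := abs_lt.1 h2
    have := (Real.sin_eq_zero_iff_of_lt_of_lt (x := (x - Real.pi) / 2)
      (by linarith [Real.pi_gt_three]) (by linarith [Real.pi_gt_three])).1 hs
    exact h3 (by simp only [Set.mem_singleton_iff]; linarith)
  rw [hfk, norm_mul, Complex.norm_real, norm_inv, Real.norm_eq_abs, norm_inv, Real.norm_eq_abs,
    abs_abs]
  have hinv : 2 * |x - Real.pi|⁻¹ ≤ |Real.cos (x / 2)|⁻¹ := by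
    have := inv_anti₀ hpos hle
    rwa [inv_div, div_eq_mul_inv] at this
  calc |x - Real.pi|⁻¹ = 1 / ‖freq h Real.pi‖ *
        (2 * |x - Real.pi|⁻¹ * (‖freq h Real.pi‖ / 2)) := by field_simp
    _ ≤ _ := by gcongr

theorem isHermitianL2_mul_freq {q : ℝ → ℝ} (hq : Measurable q) (hq' : ∀ k, q (-k) = q k)
    {a : ℤ → ℝ} (ha : (Function.support a).Finite) {C : ℝ} (hC : ∀ k, ‖(q k : ℂ) * freq a k‖ ≤ C) :
    IsHermitianL2 fun k => (q k : ℂ) * freq a k where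
  memLp := MemLp.of_bound ((Complex.measurable_ofReal.comp hq).mul
    (continuous_freq ha).measurable).aestronglyMeasurable C (Filter.Eventually.of_forall hC)
  neg_eq_conj k := by rw [hq', map_mul, Complex.conj_ofReal, conj_freq]

theorem isHermitianL2_tildeScalingSymbol {l : ℕ} {h : ℤ → ℝ} (hh : (Function.support h).Finite)
    (h0 : freq h Real.pi = 0) : IsHermitianL2 (tildeScalingSymbol (chainRenorm 0 l) h) := by
  obtain ⟨C, hC0, hC⟩ := exists_norm_freq_le_sin hh h0
  rw [show tildeScalingSymbol (chainRenorm 0 l) h = _ from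
    funext (tildeScalingSymbol_massless l h)]
  refine isHermitianL2_mul_freq (q := fun k => |Real.cos (k / 2)|⁻¹) (by fun_prop)
    (fun k => by rw [neg_div, Real.cos_neg]) hh (C := C) fun k => ?_
  have := hC k
  rw [show (k - Real.pi) / 2 = k / 2 - Real.pi / 2 by ring, Real.sin_sub_pi_div_two, abs_neg]
    at this
  rw [norm_mul, Complex.norm_real, norm_inv, Real.norm_eq_abs, abs_abs, inv_mul_eq_div]
  exact div_le_of_le_mul₀ (abs_nonneg _) hC0 this

/-- The Fourier transform of `f`, divided by the massless dispersion relation `|sin (k / 2)|`. -/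
def divDispersion (c : ℝ) (f : ℤ → ℝ) (k : ℝ) : ℂ :=
  ((c * |Real.sin (k / 2)|⁻¹ : ℝ) : ℂ) * freq f k

theorem isHermitianL2_divDispersion (c : ℝ) {f : ℤ → ℝ} (hf : (Function.support f).Finite)
    (h0 : freq f 0 = 0) : IsHermitianL2 (divDispersion c f) := by
  obtain ⟨C, hC0, hC⟩ := exists_norm_freq_le_sin hf h0
  refine isHermitianL2_mul_freq (q := fun k => c * |Real.sin (k / 2)|⁻¹) (by fun_prop)
    (fun k => by rw [neg_div, Real.sin_neg, abs_neg]) hf (C := |c| * C) fun k => ?_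
  have := hC k
  rw [sub_zero] at this
  rw [norm_mul, Complex.norm_real, norm_mul, norm_inv, Real.norm_eq_abs, Real.norm_eq_abs, abs_abs,
    mul_assoc, inv_mul_eq_div]
  gcongr
  exact div_le_of_le_mul₀ (abs_nonneg _) hC0 this

theorem divDispersion_periodic (c : ℝ) (f : ℤ → ℝ) :
    Function.Periodic (divDispersion c f) (2 * Real.pi) := fun k => by
  have := abs_sin_half_periodic k
  simp only at this
  rw [divDispersion, divDispersion, this, freq_add_two_pi]

theorem freq_decimate_zero {a f : ℤ → ℝ} (ha : (Function.support a).Finite)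
    (hf : (Function.support f).Finite) (h0 : freq f 0 = 0) (hπ : freq a Real.pi = 0) :
    freq (decimate a f) 0 = 0 := by
  have := freq_decimate ha hf 0
  rw [mul_zero, zero_add, h0, hπ] at this
  rw [this]; simp

/-- Since `|sin k| = 2 |sin (k/2)| |cos (k/2)|`, dividing the filter by `|cos (k/2)|` and the signal
by `|sin (k/2)|` amounts to dividing the output by `|sin k| / 2`; the shift by `π` exchanges the two
factors. -/
theorem decimate_tilde_divDispersion {l : ℕ} {c : ℝ} {h f : ℤ → ℝ}
    (hh : (Function.support h).Finite) (hf : (Function.support f).Finite) (h0 : freq f 0 = 0)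
    (hπ : freq h Real.pi = 0) :
    decimate (fourierSeq (tildeScalingSymbol (chainRenorm 0 l) h)) (fourierSeq (divDispersion c f))
      = fourierSeq (divDispersion (2 * c) (decimate h f)) := by
  refine decimate_fourierSeq (isHermitianL2_tildeScalingSymbol hh hπ)
    (isHermitianL2_divDispersion c hf h0)
    (isHermitianL2_divDispersion _ (support_decimate_finite hh hf)
      (freq_decimate_zero hh hf h0 hπ)) (fun k => ?_) (divDispersion_periodic _ _)
    (divDispersion_periodic _ _) fun k => ?_
  · have := abs_cos_half_periodic k
    simp only at this
    rw [tildeScalingSymbol_massless, tildeScalingSymbol_massless, this, freq_add_two_pi]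
  · have hs : |Real.sin (2 * k / 2)| = 2 * |Real.sin (k / 2)| * |Real.cos (k / 2)| := by
      rw [show 2 * k / 2 = 2 * (k / 2) by ring, Real.sin_two_mul, abs_mul, abs_mul, abs_two]
    rw [divDispersion, divDispersion, divDispersion, freq_decimate hh hf,
      tildeScalingSymbol_massless, tildeScalingSymbol_massless, hs,
      show (k + Real.pi) / 2 = k / 2 + Real.pi / 2 by ring, Real.cos_add_pi_div_two,
      Real.sin_add_pi_div_two, abs_neg, map_mul, map_mul, Complex.conj_ofReal, Complex.conj_ofReal,
      mul_inv, mul_inv]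
    push_cast
    ring

/-- For `j = i + N`, the transform of `δ_j - δ_i` is `e^{-ik} - 1` times that of the indicator `W`
of `N` consecutive sites. As `|e^{-ik} - 1| = 2 |sin (k/2)|`, the quotient is at most `2 |Ŵ|`, and
Parseval gives `4 · 2π N`. -/
theorem integral_divDispersion_sq_le (i j : ℤ) :
    ∫ k in (-Real.pi)..Real.pi, ‖divDispersion 1 (fun n => delta j n - delta i n) k‖ ^ 2 ≤
      8 * Real.pi * |(i : ℝ) - j| := by
  wlog hij : i ≤ j generalizing i j
  · have := this j i (by omega)
    rw [abs_sub_comm] at this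
    refine le_trans (le_of_eq ?_) this
    congr 1; ext k
    simp only [divDispersion, norm_mul]
    rw [freq_sub (support_delta_finite _) (support_delta_finite _),
      freq_sub (support_delta_finite _) (support_delta_finite _), norm_sub_rev]
  obtain ⟨N, rfl⟩ : ∃ N : ℕ, j = i + N := ⟨(j - i).toNat, by omega⟩
  set W : ℤ → ℝ := fun n => if i ≤ n ∧ n < i + N then 1 else 0 with hW
  have hWs : ∀ n, W n ≠ 0 → i ≤ n ∧ n < i + N := fun n hn => by
    by_contra h; exact hn (if_neg h)
  have hWf : (Function.support W).Finite :=
    SupportedIn.finite (N := N) ⟨i, hWs⟩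
  have hfac : ∀ k, freq (fun n => delta (i + N) n - delta i n) k =
      (Complex.exp (Complex.I * ((-k : ℝ) : ℂ)) - Complex.exp (Complex.I * ((0 : ℝ) : ℂ))) *
        freq W k := fun k => by
    rw [freq_sub (support_delta_finite _) (support_delta_finite _), freq_delta, freq_delta,
      freq_eq_sum_range hWs, Finset.mul_sum]
    have := Finset.sum_range_sub (fun r : ℕ => Complex.exp (-(Complex.I * k * ((i + r : ℤ) : ℂ)))) N
    simp only [Nat.cast_zero, add_zero] at this
    rw [← this]
    refine Finset.sum_congr rfl fun r hr => ?_
    have hr' := Finset.mem_range.1 hr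
    have hone : W (i + r) = 1 := if_pos (by omega)
    rw [hone, sub_mul]
    push_cast
    rw [one_mul, ← Complex.exp_add, mul_zero, Complex.exp_zero, one_mul]
    ring_nf
  have hnorm : ∀ k, ‖divDispersion 1 (fun n => delta (i + N) n - delta i n) k‖ ^ 2 ≤
      4 * ‖freq W k‖ ^ 2 := fun k => by
    rw [divDispersion, hfac, norm_mul, norm_mul, norm_exp_sub_exp, Complex.norm_real, one_mul,
      norm_inv, Real.norm_eq_abs, abs_abs, show (-k - 0) / 2 = -(k / 2) by ring, Real.sin_neg,
      abs_neg, show (4 : ℝ) * ‖freq W k‖ ^ 2 = (2 * ‖freq W k‖) ^ 2 by ring]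
    refine pow_le_pow_left₀ (by positivity) ?_ 2
    rw [show ∀ x y z : ℝ, x * (2 * y * z) = (x * y) * (2 * z) by intros; ring]
    refine mul_le_of_le_one_left (by positivity) ?_
    exact inv_mul_le_one
  have hpars : ∫ k in (-Real.pi)..Real.pi, ‖freq W k‖ ^ 2 = 2 * Real.pi * N := by
    have := integral_conj_freq_mul_freq hWf hWf
    have e1 : ∀ k, conj (freq W k) * freq W k = ((‖freq W k‖ ^ 2 : ℝ) : ℂ) := fun k => by
      rw [mul_comm, Complex.mul_conj, Complex.normSq_eq_norm_sq]
    simp_rw [e1] at this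
    rw [intervalIntegral.integral_ofReal] at this
    have e2 : ∑' n, W n * W n = N := by
      rw [tsum_eq_sum (s := Finset.Ico i (i + N)) fun n hn => by
        have : W n = 0 := by by_contra h; exact hn (Finset.mem_Ico.2 (hWs n h))
        simp [this], Finset.sum_congr rfl fun n hn => show W n * W n = 1 by
          rw [hW]; simp only; rw [if_pos (Finset.mem_Ico.1 hn), one_mul]]
      simp
    rw [e2] at this
    exact_mod_cast this
  have hcontW : Continuous fun k => ‖freq W k‖ ^ 2 := (continuous_freq hWf).norm.pow 2
  have hV := isHermitianL2_divDispersion 1 (f := fun n => delta (i + N) n - delta i n)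
    (((support_delta_finite (i + N)).union (support_delta_finite i)).subset
      (Function.support_sub _ _)) (by rw [hfac]; simp)
  calc _ ≤ ∫ k in (-Real.pi)..Real.pi, 4 * ‖freq W k‖ ^ 2 :=
        intervalIntegral.integral_mono_on neg_pi_le_pi hV.intervalIntegrable_sq
          ((hcontW.const_mul 4).intervalIntegrable _ _) fun k _ => hnorm k
    _ = 8 * Real.pi * N := by
        rw [intervalIntegral.integral_const_mul, hpars]; ring
    _ = _ := by
        push_cast
        rw [show (i : ℝ) - (i + N) = -N by ring, abs_neg, Nat.abs_cast]

theorem lowPart_tilde {g h : ℕ → ℤ → ℝ} {f : ℕ → ℤ → ℝ} {L : ℕ}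
    (hh : ∀ l, (Function.support (h l)).Finite) (hπ : ∀ l < L, freq (h l) Real.pi = 0)
    (hf : ∀ l, (Function.support (f l)).Finite) (hfs : ∀ l, f (l + 1) = decimate (h l) (f l))
    (h0 : freq (f 0) 0 = 0) {l : ℕ} (hl : l ≤ L) :
    freq (f l) 0 = 0 ∧
    lowPart (fun l => decompose (tildeBank (chainRenorm 0 l) (g l) (h l))) 0 l
      (fourierSeq (divDispersion 1 (f 0))) = fourierSeq (divDispersion (2 ^ l) (f l)) := by
  induction l with
  | zero => exact ⟨h0, by rw [lowPart, pow_zero]⟩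
  | succ l ih =>
    obtain ⟨ih0, ih⟩ := ih (by omega)
    refine ⟨by rw [hfs]; exact freq_decimate_zero (hh l) (hf l) ih0 (hπ l hl), ?_⟩
    rw [lowPart, ih, zero_add, pow_succ', hfs]
    exact decimate_tilde_divDispersion (hh l) (hf l) ih0 (hπ l hl)

theorem integral_sq_le_of_layersBounded {g h : ℕ → ℤ → ℝ} {f : ℕ → ℤ → ℝ} {L : ℕ} {D : ℝ}
    (hh : ∀ l, (Function.support (h l)).Finite) (hπ : ∀ l < L, freq (h l) Real.pi = 0)
    (hf : ∀ l, (Function.support (f l)).Finite) (hfs : ∀ l, f (l + 1) = decimate (h l) (f l))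
    (h0 : freq (f 0) 0 = 0)
    (hb : LayersBounded (fun l => decompose (tildeBank (chainRenorm 0 l) (g l) (h l))) L D)
    {l : ℕ} (hl : l ≤ L) :
    ∫ k in (-Real.pi)..Real.pi, ‖divDispersion (2 ^ l) (f l) k‖ ^ 2 ≤
      D ^ 2 * ∫ k in (-Real.pi)..Real.pi, ‖divDispersion 1 (f 0) k‖ ^ 2 := by
  obtain ⟨hl0, hlow⟩ := lowPart_tilde (g := g) hh hπ hf hfs h0 hl
  have hV0 := isHermitianL2_divDispersion 1 (hf 0) h0
  have hVl := isHermitianL2_divDispersion (2 ^ l) (hf l) hl0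
  have h1 := le_self_add.trans (hb 0 l (by omega) _ (memlp_fourierSeq hV0))
  have hnn : ∀ F : ℝ → ℂ, 0 ≤ ∫ k in (-Real.pi)..Real.pi, ‖F k‖ ^ 2 := fun F =>
    intervalIntegral.integral_nonneg neg_pi_le_pi fun k _ => sq_nonneg _
  rw [hlow, energy_fourierSeq hVl, energy_fourierSeq hV0,
    ← ENNReal.ofReal_mul (sq_nonneg D), ENNReal.ofReal_le_ofReal_iff
      (mul_nonneg (sq_nonneg D) (mul_nonneg (by positivity) (hnn _))),
    mul_left_comm] at h1
  exact le_of_mul_le_mul_left h1 (by positivity)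

/-- Cauchy–Schwarz, from nonnegativity of the variance. -/
theorem sq_integral_le {F : ℝ → ℝ} (hF : IntervalIntegrable F volume (-Real.pi) Real.pi)
    (hF2 : IntervalIntegrable (fun k => F k ^ 2) volume (-Real.pi) Real.pi) :
    (∫ k in (-Real.pi)..Real.pi, F k) ^ 2 ≤
      2 * Real.pi * ∫ k in (-Real.pi)..Real.pi, F k ^ 2 := by
  set A := ∫ k in (-Real.pi)..Real.pi, F k with hA
  have hpi := Real.pi_pos
  have h0 : 0 ≤ ∫ k in (-Real.pi)..Real.pi, (2 * Real.pi * F k - A) ^ 2 :=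
    intervalIntegral.integral_nonneg neg_pi_le_pi fun k _ => sq_nonneg _
  have e : ∀ k, (2 * Real.pi * F k - A) ^ 2 =
      (2 * Real.pi) ^ 2 * F k ^ 2 - 2 * (2 * Real.pi) * A * F k + A ^ 2 := fun k => by ring
  simp_rw [e] at h0
  rw [intervalIntegral.integral_add ((hF2.const_mul _).sub (hF.const_mul _))
    intervalIntegrable_const, intervalIntegral.integral_sub (hF2.const_mul _) (hF.const_mul _),
    intervalIntegral.integral_const_mul, intervalIntegral.integral_const_mul,
    intervalIntegral.integral_const, ← hA, smul_eq_mul] at h0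
  have h2 : 0 ≤ 2 * Real.pi * (2 * Real.pi * (∫ k in (-Real.pi)..Real.pi, F k ^ 2) - A ^ 2) := by
    refine h0.trans (le_of_eq ?_)
    ring
  have := nonneg_of_mul_nonneg_right h2 (by positivity)
  linarith

/-! ### The massless chain: regulated position correlations -/

/-- Discards the momenta where `|sin (k/2)|⁻¹` or `|cos (k/2)|⁻¹` takes the default value `0`. -/
theorem ae_sin_ne_zero : ∀ᵐ k : ℝ, Real.sin k ≠ 0 := by
  have : {k : ℝ | Real.sin k = 0} ⊆ Set.range fun n : ℤ => (n : ℝ) * Real.pi := fun k hk =>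
    Real.sin_eq_zero_iff.1 hk
  have h0 := ((Set.countable_range _).mono this).measure_zero volume
  rw [ae_iff]
  simpa using h0

theorem chainRenorm_massless_inv (l : ℕ) (k : ℝ) :
    (chainRenorm 0 l k)⁻¹ = (chainRenorm 0 l Real.pi)⁻¹ * |Real.sin (k / 2)|⁻¹ := by
  rw [← mul_inv, ← chainRenorm_massless_ratio l k, mul_div_cancel₀ _ (chainRenorm_pi_pos 0 l).ne']

/-- The half-angle polynomial needs one window for both filters. Perfect reconstruction yields `∑
h[n] g[n] = 1`, so the supports meet and `2M` sites contain both. -/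
theorem IsFilterFamily.exists_common_support {g h : ℤ → ℤ → ℝ} {M : ℕ} (hF : IsFilterFamily g h M)
    (l : ℤ) : ∃ s : ℤ, (∀ n, g l n ≠ 0 → s ≤ n ∧ n < s + (2 * M : ℕ)) ∧
      ∀ n, h l n ≠ 0 → s ≤ n ∧ n < s + (2 * M : ℕ) := by
  obtain ⟨s, hs⟩ := hF.support_g l
  obtain ⟨t, ht⟩ := hF.support_h l
  have h1 := decimate_eq_delta (SupportedIn.finite (hF.support_g l))
    (SupportedIn.finite (hF.support_h l)) (hF.perfect_reconstruction l) 0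
  rw [if_pos rfl] at h1
  obtain ⟨n, hn⟩ : ∃ n, h l n * g l (2 * 0 + n) ≠ 0 := by
    by_contra hc
    push Not at hc
    simp only [decimate, hc, tsum_zero] at h1
    exact zero_ne_one h1
  have hgn := hs _ (right_ne_zero_of_mul hn)
  have hhn := ht _ (left_ne_zero_of_mul hn)
  refine ⟨min s t, fun p hp => ?_, fun p hp => ?_⟩
  · have := hs p hp
    push_cast; omega
  · have := ht p hp
    push_cast; omega

/-- The ratio `1 / √2` is at most `3 / 4`, and a geometric series of ratio `3 / 4` sums to `4`. -/
theorem sum_inv_sqrt_two_pow_le (L : ℕ) : ∑ l ∈ Finset.range L, 1 / √2 ^ l ≤ 4 := by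
  have hs : (4 : ℝ) / 3 ≤ √2 := Real.le_sqrt_of_sq_le (by norm_num)
  have hx : 1 / √2 ≤ 3 / 4 := by
    rw [div_le_div_iff₀ (by positivity) (by norm_num)]; linarith
  have : ∑ l ∈ Finset.range L, 1 / √2 ^ l ≤ 4 - 4 * (1 / √2 ^ L) := by
    induction L with
    | zero => simp
    | succ L ih =>
      rw [Finset.sum_range_succ]
      have h1 : 1 / √2 ^ (L + 1) = 1 / √2 ^ L * (1 / √2) := by
        rw [pow_succ, one_div_mul_one_div]
      have h2 : (0 : ℝ) < 1 / √2 ^ L := by positivity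
      rw [h1]
      nlinarith
  have h2 : (0 : ℝ) < 1 / √2 ^ L := by positivity
  linarith

/-- The extra factor `|sin k|` in the deviations cancels the singular factor `(r * r')⁻¹ = 2 / |sin
k|` of the inverse-symbol bound. -/
theorem norm_layerDefect_massless_le {k S δ : ℝ} {a a' b b' : ℂ} (f f' F F' : ℂ)
    (hk : Real.sin k ≠ 0) (h : a * conj b + a' * conj b' = 2)
    (ha : ‖a‖ ≤ S) (ha' : ‖a'‖ ≤ S) (hb : ‖b‖ ≤ S) (hb' : ‖b'‖ ≤ S)
    (hd : ‖b - (|Real.cos (k / 2)| : ℝ) * a‖ ≤ δ * |Real.sin k|)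
    (hd' : ‖b' - (|Real.sin (k / 2)| : ℝ) * a'‖ ≤ δ * |Real.sin k|) :
    ‖layerDefect |Real.sin (k / 2)|⁻¹ |Real.cos (k / 2)|⁻¹ b b' a a' f f' F F'‖ ≤
      S * δ * ((‖f‖ + ‖f'‖) * (‖F‖ + ‖F'‖)) := by
  have e : Real.sin k = 2 * Real.sin (k / 2) * Real.cos (k / 2) := by
    rw [← Real.sin_two_mul, mul_div_cancel₀ _ two_ne_zero]
  rw [e] at hk
  have hs : 0 < |Real.sin (k / 2)| := abs_pos.2 fun h => hk (by rw [h]; ring)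
  have hc : 0 < |Real.cos (k / 2)| := abs_pos.2 fun h => hk (by rw [h]; ring)
  refine (norm_layerDefect_inv_le f f' F F' h hs (Real.abs_sin_le_one _) hc
    (Real.abs_cos_le_one _) ha ha' hb hb' hd hd').trans (le_of_eq ?_)
  rw [e, abs_mul, abs_mul, abs_two]
  field_simp

/-- The `L²` bound passes through the `g̃`-layers at the cost of `D`; Cauchy–Schwarz on a period
turns it into an `L¹` bound, with `(4πD)² = 2π · D² · 8π`. -/
theorem integral_norm_divDispersion_le {g h : ℕ → ℤ → ℝ} {f : ℕ → ℤ → ℝ} {L : ℕ} {D : ℝ}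
    (hD : 0 ≤ D) {i j : ℤ} (hh : ∀ l, (Function.support (h l)).Finite)
    (hπ : ∀ l < L, freq (h l) Real.pi = 0) (hf : ∀ l, (Function.support (f l)).Finite)
    (hfs : ∀ l, f (l + 1) = decimate (h l) (f l)) (hf0 : f 0 = fun n => delta j n - delta i n)
    (hb : LayersBounded (fun l => decompose (tildeBank (chainRenorm 0 l) (g l) (h l))) L D)
    {l : ℕ} (hl : l ≤ L) :
    freq (f l) 0 = 0 ∧ ∫ k in (-Real.pi)..Real.pi, ‖divDispersion (2 ^ l) (f l) k‖ ≤
      4 * Real.pi * D * √|(i : ℝ) - j| := by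
  have h0 : freq (f 0) 0 = 0 := by
    rw [hf0, freq_sub (support_delta_finite _) (support_delta_finite _), freq_delta, freq_delta]
    simp
  have hl0 := (lowPart_tilde (g := g) hh hπ hf hfs h0 hl).1
  have hV := isHermitianL2_divDispersion (2 ^ l) (hf l) hl0
  refine ⟨hl0, abs_le_of_sq_le_sq' ?_ (by positivity) |>.2⟩
  refine (sq_integral_le hV.intervalIntegrable.norm hV.intervalIntegrable_sq).trans ?_
  have h1 := integral_sq_le_of_layersBounded hh hπ hf hfs h0 hb hl
  rw [hf0] at h1
  calc _ ≤ 2 * Real.pi * (D ^ 2 * (8 * Real.pi * |(i : ℝ) - j|)) := by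
        gcongr
        exact h1.trans (mul_le_mul_of_nonneg_left (integral_divDispersion_sq_le i j) (sq_nonneg D))
    _ = _ := by
        rw [mul_pow, Real.sq_sqrt (abs_nonneg _)]; ring

theorem integral_norm_freq_le {f : ℤ → ℝ} (hf : (Function.support f).Finite)
    (h0 : freq f 0 = 0) {l : ℕ} {Q : ℝ}
    (hQ : ∫ k in (-Real.pi)..Real.pi, ‖divDispersion (2 ^ l) f k‖ ≤ Q) :
    (∫ k in (-Real.pi)..Real.pi, |Real.sin (k / 2)|⁻¹ * ‖freq f k‖ ≤ Q / 2 ^ l) ∧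
      ∫ k in (-Real.pi)..Real.pi, ‖freq f k‖ ≤ Q / 2 ^ l := by
  have e : ∀ c : ℝ, 0 ≤ c → ∀ k, ‖divDispersion c f k‖ =
      c * (|Real.sin (k / 2)|⁻¹ * ‖freq f k‖) := fun c hc k => by
    rw [divDispersion, norm_mul, Complex.norm_real, norm_mul, Real.norm_of_nonneg hc, norm_inv,
      Real.norm_eq_abs, abs_abs, mul_assoc]
  have h1 : ∫ k in (-Real.pi)..Real.pi, |Real.sin (k / 2)|⁻¹ * ‖freq f k‖ ≤ Q / 2 ^ l := by
    rw [le_div_iff₀ (by positivity), mul_comm, ← intervalIntegral.integral_const_mul]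
    simpa only [e _ (show (0 : ℝ) ≤ 2 ^ l by positivity)] using hQ
  refine ⟨h1, le_trans ?_ h1⟩
  have hi := (isHermitianL2_divDispersion 1 hf h0).intervalIntegrable.norm
  simp only [e 1 zero_le_one, one_mul] at hi
  refine intervalIntegral.integral_mono_ae neg_pi_le_pi
    ((continuous_freq hf).norm.intervalIntegrable _ _) hi ?_
  filter_upwards [ae_sin_ne_zero] with k hk
  have hs : 0 < |Real.sin (k / 2)| := abs_pos.2 fun h => hk (by
    rw [← mul_div_cancel₀ k (two_ne_zero (α := ℝ)), Real.sin_two_mul, h]; ring)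
  exact le_mul_of_one_le_left (norm_nonneg _) ((one_le_inv₀ hs).2 (Real.abs_sin_le_one _))

/-- By bilinearity the regulated function pairs `δ_i` with `δ_j - δ_i`, whose Fourier transform
vanishes at `k = 0`. -/
theorem gram_layerH_sub (m : ℝ) {g h : ℤ → ℤ → ℝ} {M : ℕ} (hF : IsFilterFamily g h M)
    (L : ℕ) (i j : ℤ) :
    gram (layerH (chainDispersion m) g h) L i j - gram (layerH (chainDispersion m) g h) L i i =
      (layerWeight m L)⁻¹ * (∑' n : ℤ, lowIter (fun l => h l) L (delta i) n *
        (lowIter (fun l => h l) L (delta j) n - lowIter (fun l => h l) L (delta i) n)) +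
      ∑ l ∈ Finset.range L, (layerWeight m (l + 1))⁻¹ *
        ∑' n : ℤ, decimate (waveletFilter (g l)) (lowIter (fun l => h l) l (delta i)) n *
          decimate (waveletFilter (g l)) (fun n => lowIter (fun l => h l) l (delta j) n -
            lowIter (fun l => h l) l (delta i) n) n := by
  have hf : ∀ l i, (Function.support (lowIter (fun l : ℕ => h l) l (delta i))).Finite :=
    fun l i => (supportedIn_lowIter (fun l => hF.support_h l) l i).finite
  have hw : ∀ l : ℤ, (Function.support (waveletFilter (g l))).Finite := fun l =>
    support_waveletFilter_finite (SupportedIn.finite (hF.support_g l))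
  have key : ∀ u v w : Signal, (Function.support u).Finite →
      ∑' n, u n * (v n - w n) = ∑' n, u n * v n - ∑' n, u n * w n := fun u v w hu => by
    have hs : ∀ v : Signal, Summable fun n => u n * v n := fun v =>
      summable_of_hasFiniteSupport (hu.subset fun n hn => left_ne_zero_of_mul hn)
    rw [← (hs v).tsum_sub (hs w)]
    simp only [mul_sub]
  rw [gram_layerH, gram_layerH]
  simp only [decimate_sub (hw _)]
  have key' := fun (l : ℕ) (v w : Signal) =>
    key _ v w (support_decimate_finite (hw l) (hf l i))
  simp only [key _ _ _ (hf L i), key']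
  simp only [mul_sub, Finset.sum_sub_distrib]
  ring

/-- Of the two signals in the telescoping bound, the one from `δ_i` is estimated uniformly by
`2^{-l/2}` and the one from `δ_j - δ_i` in `L¹` by `2 ^ (-l) √|i - j|`. The inverse weights grow at
most like `2 ^ l`, so layer `l` contributes `O(ε 2^{-l/2} √|i - j|)` and the coarsest scale
`O(2^{-L/2} √|i - j|)`. -/
theorem exists_groundQReg_bound (M : ℕ) : ∃ K : ℝ, 0 ≤ K ∧
    ∀ {g h : ℤ → ℤ → ℝ}, IsFilterFamily g h M → ∀ {L : ℕ}, 1 ≤ L → ∀ {B D ε : ℝ}, 0 ≤ D →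
    ScalingBounded g L B → ScalingBounded h L B →
    DecompositionBounded (chainDispersion 0) g h L D →
    ApproxDispersion (chainDispersion 0) g h L ε → ∀ i j : ℤ,
    |groundQReg (chainDispersion 0) i j - meraQReg (chainDispersion 0) g h L i j| ≤
      lowBound M B * D * (32 * (M * D) * (K * ε) + 2 * (1 / √2 ^ L)) * √|(i : ℝ) - j| := by
  obtain ⟨K, hK, hdefect⟩ := exists_massless_defect_bound (2 * M)
  refine ⟨K, hK, ?_⟩
  intro g h hF L hL B D ε hD hg hh hdec happ i j
  have hε : 0 ≤ ε := (norm_nonneg _).trans (happ 0 (by omega) 0)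
  have hlow := lowBound_nonneg M B
  have hsg : ∀ l : ℕ, (Function.support (g l)).Finite := fun l =>
    SupportedIn.finite (hF.support_g l)
  have hsh : ∀ l : ℕ, (Function.support (h l)).Finite := fun l =>
    SupportedIn.finite (hF.support_h l)
  set I : ℕ → Signal := fun l => lowIter (fun l : ℕ => h l) l (delta i) with hIdef
  set J : ℕ → Signal := fun l => lowIter (fun l : ℕ => h l) l (delta j) with hJdef
  set F : ℕ → Signal := fun l n => J l n - I l n with hFdef
  have hI : ∀ l, (Function.support (I l)).Finite := fun l =>
    (supportedIn_lowIter (fun l => hF.support_h l) l i).finite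
  have hJ : ∀ l, (Function.support (J l)).Finite := fun l =>
    (supportedIn_lowIter (fun l => hF.support_h l) l j).finite
  have hF' : ∀ l, (Function.support (F l)).Finite := fun l =>
    ((hJ l).union (hI l)).subset (Function.support_sub _ _)
  have hFs : ∀ l : ℕ, F (l + 1) = decimate (h l) (F l) := fun l =>
    (decimate_sub (hsh l) (J l) (I l)).symm
  have hIl : ∀ l ≤ L, ∀ k, ‖freq (I l) k‖ ≤ lowBound M B / √2 ^ l := fun l hl k =>
    norm_freq_lowIter_le hF.swap hh hg hl i k
  have hgS : ∀ l < L, ∀ k, ‖freq (g l) k‖ ≤ M * D := fun l hl k =>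
    norm_freq_scaling_le hF.support_g hD hdec.bound_g hl k
  have hhS : ∀ l < L, ∀ k, ‖freq (h l) k‖ ≤ M * D := fun l hl k =>
    norm_freq_scaling_le hF.support_h hD hdec.bound_h hl k
  have hπ : ∀ l < L, freq (h l) Real.pi = 0 := fun l hl =>
    freq_pi_eq_zero_of_memLp (hsh l) (hdec.tilde_memLp l hl)
  have hd : ∀ l < L, ∀ k, ‖freq (h l) k - (|Real.cos (k / 2)| : ℝ) * freq (g l) k‖ ≤
      K * ε * |Real.sin k| := fun l hl => by
    obtain ⟨s, hs, ht⟩ := hF.exists_common_support l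
    refine hdefect (g l) (h l) s ε hs ht (fun k => ?_) (hπ l hl)
      ((hF.normalized l).2.trans (hF.normalized l).1.symm)
    have := happ.norm_sub_le' hl k
    rwa [chainRenorm_massless_ratio, show (k + Real.pi) / 2 = k / 2 + Real.pi / 2 by ring,
      Real.sin_add_pi_div_two] at this
  set Q : ℝ := 4 * Real.pi * D * √|(i : ℝ) - j| with hQ
  have hQ0 : 0 ≤ Q := by positivity
  have hdiv := fun l (hl : l ≤ L) => integral_norm_divDispersion_le (g := fun l : ℕ => g l)
    (h := fun l : ℕ => h l) hD (i := i) (j := j) hsh hπ hF' hFs rfl hdec.bound_tilde hl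
  have hint := fun l (hl : l ≤ L) => integral_norm_freq_le (hF' l) (hdiv l hl).1 (hdiv l hl).2
  have hi : ∀ l ≤ L, IntervalIntegrable (fun k => ((chainRenorm 0 l k)⁻¹ : ℝ) *
      (conj (freq (I l) k) * freq (F l) k)) volume (-Real.pi) Real.pi := fun l hl => by
    have h1 := (isHermitianL2_divDispersion (chainRenorm 0 l Real.pi)⁻¹ (hF' l)
      (hdiv l hl).1).intervalIntegrable.continuousOn_mul
        (Complex.continuous_conj.comp (continuous_freq (hI l))).continuousOn
    refine h1.congr fun k _ => ?_
    simp only [Function.comp, divDispersion, ← chainRenorm_massless_inv]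
    ring
  have main := norm_integral_sub_layers_le (a := fun l => h l) (b := fun l => g l) (f := I)
    (F := F) (W := fun l => (layerWeight 0 l)⁻¹) (τ := fun l k => (chainRenorm 0 l k)⁻¹)
    (ρ := fun l k => (chainRenorm 0 l k / chainRenorm 0 l Real.pi)⁻¹) (L := L)
    hsh hsg hI hF' (fun l => rfl) hFs (fun l => inv_pos.2 (layerWeight_pos 0 l))
    (fun l k => by simp only [chainRenorm_periodic 0 l k])
    (fun l k => layerWeight_inv_mul 0 l k)
    (fun l k => by rw [chainRenorm_succ_two_mul 0 l k, mul_inv]) hi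
    (e := fun l => 4 * (M * D * (K * ε)) * (lowBound M B / √2 ^ l) * (Q / 2 ^ l))
    (e' := 2 * (lowBound M B / √2 ^ L) * (Q / 2 ^ L))
    (fun l hl => by
      have hFc := (continuous_freq (hF' l)).norm
      have hFi := hFc.intervalIntegrable (μ := volume) (-Real.pi) Real.pi
      have hFp : Function.Periodic (fun k => ‖freq (F l) k‖) (2 * Real.pi) := fun k => by
        simp only [freq_add_two_pi]
      have hFi' := intervalIntegrable_comp_add_pi hFp hFi
      have hbound : ∀ᵐ k : ℝ, k ∈ Set.Ioc (-Real.pi) Real.pi →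
          ‖layerDefect (chainRenorm 0 l k / chainRenorm 0 l Real.pi)⁻¹
            (chainRenorm 0 l (k + Real.pi) / chainRenorm 0 l Real.pi)⁻¹ (freq (h l) k)
            (freq (h l) (k + Real.pi)) (freq (g l) k) (freq (g l) (k + Real.pi))
            (freq (I l) k) (freq (I l) (k + Real.pi)) (freq (F l) k)
            (freq (F l) (k + Real.pi))‖ ≤ 2 * (M * D * (K * ε)) * (lowBound M B / √2 ^ l) *
              (‖freq (F l) k‖ + ‖freq (F l) (k + Real.pi)‖) := by
        filter_upwards [ae_sin_ne_zero] with k hk _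
        have hd' := hd l hl (k + Real.pi)
        rw [show (k + Real.pi) / 2 = k / 2 + Real.pi / 2 by ring, Real.cos_add_pi_div_two,
          abs_neg, Real.sin_add_pi, abs_neg] at hd'
        rw [chainRenorm_massless_ratio, chainRenorm_massless_ratio,
          show (k + Real.pi) / 2 = k / 2 + Real.pi / 2 by ring, Real.sin_add_pi_div_two]
        refine (norm_layerDefect_massless_le _ _ _ _ hk (hF.perfect_reconstruction l k)
          (hgS l hl k) (hgS l hl _) (hhS l hl k) (hhS l hl _) (hd l hl k) hd').trans ?_
        rw [show 2 * (M * D * (K * ε)) * (lowBound M B / √2 ^ l) *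
          (‖freq (F l) k‖ + ‖freq (F l) (k + Real.pi)‖) = M * D * (K * ε) *
            ((lowBound M B / √2 ^ l + lowBound M B / √2 ^ l) *
              (‖freq (F l) k‖ + ‖freq (F l) (k + Real.pi)‖)) by ring]
        gcongr
        exacts [hIl l hl.le _, hIl l hl.le _]
      refine (intervalIntegral.norm_integral_le_of_norm_le neg_pi_le_pi hbound
        ((hFi.add hFi').const_mul _)).trans ?_
      rw [intervalIntegral.integral_const_mul, intervalIntegral.integral_add hFi hFi',
        integral_comp_add_pi hFp, ← two_mul]
      calc _ = 4 * (M * D * (K * ε)) * (lowBound M B / √2 ^ l) *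
            ∫ k in (-Real.pi)..Real.pi, ‖freq (F l) k‖ := by ring
        _ ≤ _ := by
          gcongr
          exact (hint l hl.le).2)
    (by
      have hFi := (isHermitianL2_divDispersion 1 (hF' L) (hdiv L le_rfl).1).intervalIntegrable.norm
      have e : ∀ k, ‖divDispersion 1 (F L) k‖ = |Real.sin (k / 2)|⁻¹ * ‖freq (F L) k‖ :=
        fun k => by
          rw [divDispersion, norm_mul, Complex.norm_real, one_mul, norm_inv, Real.norm_eq_abs,
            abs_abs]
      simp only [e] at hFi
      have hbound : ∀ᵐ k : ℝ, k ∈ Set.Ioc (-Real.pi) Real.pi →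
          ‖(((chainRenorm 0 L k)⁻¹ - 1 : ℝ) : ℂ) * (conj (freq (I L) k) * freq (F L) k)‖ ≤
            2 * (lowBound M B / √2 ^ L) * (|Real.sin (k / 2)|⁻¹ * ‖freq (F L) k‖) := by
        filter_upwards [ae_sin_ne_zero] with k hk _
        have hs : 0 < |Real.sin (k / 2)| := abs_pos.2 fun h => hk (by
          rw [← mul_div_cancel₀ k (two_ne_zero (α := ℝ)), Real.sin_two_mul, h]; ring)
        -- For `L ≥ 1` the massless dispersion relation is `|sin (k/2)| / 2`. The remaining
        -- singularity is absorbed by the `L¹` bound on the quotient of `F L` by `|sin (k/2)|`.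
        have h1 : ‖(chainRenorm 0 L k)⁻¹ - 1‖ ≤ 2 * |Real.sin (k / 2)|⁻¹ := by
          obtain ⟨L', rfl⟩ : ∃ L', L = L' + 1 := ⟨L - 1, by omega⟩
          have h2 := (one_le_inv₀ hs).2 (Real.abs_sin_le_one _)
          rw [chainRenorm_massless_succ, mul_inv, one_div, inv_inv, Real.norm_eq_abs, abs_le]
          constructor <;> linarith
        rw [norm_mul, norm_mul, RCLike.norm_conj, Complex.norm_real,
          show 2 * (lowBound M B / √2 ^ L) * (|Real.sin (k / 2)|⁻¹ * ‖freq (F L) k‖) =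
            2 * |Real.sin (k / 2)|⁻¹ * (lowBound M B / √2 ^ L * ‖freq (F L) k‖) by ring]
        gcongr
        exact hIl L le_rfl k
      refine (intervalIntegral.norm_integral_le_of_norm_le neg_pi_le_pi hbound
        (hFi.const_mul _)).trans ?_
      rw [intervalIntegral.integral_const_mul]
      gcongr
      exact (hint L le_rfl).1)
  have hgram := gram_layerH_sub 0 hF L i j
  rw [← hgram] at main
  have re := abs_re_le_of_norm_sub_le main
  have hE : ((((layerWeight 0 0)⁻¹ : ℝ) : ℂ) * ∫ k in (-Real.pi)..Real.pi,
      (((chainRenorm 0 0 k)⁻¹ : ℝ) : ℂ) * (conj (freq (I 0) k) * freq (F 0) k)).re =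
        4 * Real.pi * groundQReg (chainDispersion 0) i j := by
    have e : ∀ k, (conj (freq (I 0) k) * freq (F 0) k).re =
        Real.cos (k * ((i : ℝ) - j)) - 1 := fun k => by
      simp only [hFdef]
      rw [freq_sub (hJ 0) (hI 0), mul_sub, Complex.sub_re]
      simp only [hIdef, hJdef, lowIter, re_conj_freq_delta_mul, sub_self, mul_zero, Real.cos_zero]
    rw [Complex.re_ofReal_mul, re_integral_mul (hi 0 (Nat.zero_le _))]
    simp only [e, layerWeight, Finset.range_zero,
      Finset.prod_empty, inv_one, one_mul, groundQReg, chainRenorm, renormDispersion]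
    simp_rw [one_div_two_mul_mul]
    rw [intervalIntegral.integral_div]
    refine (four_pi_mul _).symm.trans ?_
    ring
  rw [hE] at re
  have hw : ∀ l, (layerWeight 0 l)⁻¹ ≤ 2 ^ l := fun l => by
    have := inv_anti₀ (by positivity) (layerWeight_massless l)
    rwa [one_div, inv_pow, inv_inv] at this
  have hsum : ∑ l ∈ Finset.range L, (layerWeight 0 (l + 1))⁻¹ *
      (4 * (M * D * (K * ε)) * (lowBound M B / √2 ^ l) * (Q / 2 ^ l)) +
      (layerWeight 0 L)⁻¹ * (2 * (lowBound M B / √2 ^ L) * (Q / 2 ^ L)) ≤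
      4 * Real.pi * (lowBound M B * D * (32 * (M * D) * (K * ε) + 2 * (1 / √2 ^ L)) *
        √|(i : ℝ) - j|) := by
    calc _ ≤ ∑ l ∈ Finset.range L, 2 ^ (l + 1) *
          (4 * (M * D * (K * ε)) * (lowBound M B / √2 ^ l) * (Q / 2 ^ l)) +
          2 ^ L * (2 * (lowBound M B / √2 ^ L) * (Q / 2 ^ L)) := by
          gcongr <;> exact hw _
      _ = 8 * (M * D * (K * ε)) * lowBound M B * Q * ∑ l ∈ Finset.range L, 1 / √2 ^ l +
          2 * lowBound M B * Q * (1 / √2 ^ L) := by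
          rw [Finset.mul_sum]
          congr 1
          · refine Finset.sum_congr rfl fun l _ => ?_
            rw [pow_succ]; field_simp; ring
          · field_simp
      _ ≤ 8 * (M * D * (K * ε)) * lowBound M B * Q * 4 +
          2 * lowBound M B * Q * (1 / √2 ^ L) := by
          gcongr
          exact sum_inv_sqrt_two_pow_le L
      _ = _ := by rw [hQ]; ring
  have fin := re.trans hsum
  rw [show 4 * Real.pi * groundQReg (chainDispersion 0) i j -
    2 * Real.pi * (gram (layerH (chainDispersion 0) g h) L i j -
      gram (layerH (chainDispersion 0) g h) L i i) = 4 * Real.pi *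
      (groundQReg (chainDispersion 0) i j - meraQReg (chainDispersion 0) g h L i j) by
      unfold meraQReg meraQ; ring, abs_mul, abs_of_pos (show 0 < 4 * Real.pi by positivity)] at fin
  exact le_of_mul_le_mul_left fin (by positivity)

/-! ### Comparison with the error terms `ε log (1/ε)` and `2^{-L/2}`. -/

/-- For `ε ≤ 1/2` the logarithm is at least `log 2 > 1/2`. -/
theorem le_two_mul_mul_log {ε : ℝ} (hε : 0 < ε) (hε' : ε ≤ 1 / 2) :
    ε ≤ 2 * (ε * Real.log (1 / ε)) := by
  have h1 : Real.log 2 ≤ Real.log (1 / ε) :=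
    Real.log_le_log zero_lt_two ((le_div_iff₀ hε).2 (by linarith))
  have h2 := Real.log_two_gt_d9
  nlinarith

theorem two_rpow_neg_half (L : ℕ) : (2 : ℝ) ^ (-(L : ℝ) / 2) = 1 / √2 ^ L := by
  rw [neg_div, Real.rpow_neg zero_le_two, one_div, Real.sqrt_eq_rpow, ← Real.rpow_natCast,
    ← Real.rpow_mul zero_le_two]
  congr 2; ring

theorem half_pow_le_inv_sqrt_two_pow (L : ℕ) : (1 / 2 : ℝ) ^ L ≤ 1 / √2 ^ L := by
  rw [one_div_pow]
  refine one_div_le_one_div_of_le (by positivity) (pow_le_pow_left₀ (by positivity) ?_ L)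
  exact Real.sqrt_le_iff.2 (by norm_num)

end BosonicMERA

end

theorem mainTheorem2 (M : ℕ) (B D : ℝ) (hD : 1 ≤ D) :
    ∃ C : ℝ, 0 < C ∧
      ∀ (m : ℝ), 0 ≤ m → ∀ (ε : ℝ), 0 < ε → ε ≤ 1 / 2 → ∀ (L : ℕ), 1 ≤ L →
      ∀ (g h : ℤ → ℤ → ℝ),
        IsFilterFamily g h M →
        ScalingBounded g L B →
        ScalingBounded h L B →
        DecompositionBounded (chainDispersion m) g h L D →
        ApproxDispersion (chainDispersion m) g h L ε →
        (∀ i j : ℤ,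
          |groundP (chainDispersion m) i j - meraP (chainDispersion m) g h L i j| ≤
            (C * (2 : ℝ) ^ (-(L : ℝ) / 2) + C * (ε * Real.log (1 / ε))) * √(m ^ 2 + 1)) ∧
        (0 < m → ∀ i j : ℤ,
          |groundQ (chainDispersion m) i j - meraQ (chainDispersion m) g h L i j| ≤
            (C * (2 : ℝ) ^ (-(L : ℝ) / 2) + C * (ε * Real.log (1 / ε))) * (1 / m)) ∧
        (m = 0 → ∀ i j : ℤ,
          |groundQReg (chainDispersion m) i j - meraQReg (chainDispersion m) g h L i j| ≤
            (C * (2 : ℝ) ^ (-(L : ℝ) / 2) + C * (ε * Real.log (1 / ε))) *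
              √|(i : ℝ) - j|) := by
  obtain ⟨K, hK, hreg⟩ := exists_groundQReg_bound M
  have hD0 : 0 ≤ D := by linarith
  have hl := lowBound_nonneg M B
  set C₁ := lowBound M B ^ 2 * (4 * (M * D) + 1) with hC₁
  set C₂ := lowBound M B * D * (64 * (M * D) * K + 2) with hC₂
  have h₁ : 0 ≤ C₁ := by positivity
  have h₂ : 0 ≤ C₂ := by positivity
  -- `C₁` serves the momenta and the massive positions, `C₂` the regulated positions. Both arise
  -- from `ε ≤ 2E` and `2 ^ (-L) ≤ T`; the summand `1` makes the constant positive.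
  refine ⟨C₁ + C₂ + 1, by positivity, ?_⟩
  intro m hm ε hε hε' L hL g h hF hg hh hdec happ
  have hlog := le_two_mul_mul_log hε hε'
  have hhalf := half_pow_le_inv_sqrt_two_pow L
  rw [two_rpow_neg_half]
  set E := ε * Real.log (1 / ε) with hE
  set T := 1 / √2 ^ L with hT
  have hE0 : 0 ≤ E := by linarith
  have hT0 : 0 ≤ T := by positivity
  have b₁ : lowBound M B ^ 2 * (2 * (M * D) * ε + (1 / 2) ^ L) ≤
      (C₁ + C₂ + 1) * T + (C₁ + C₂ + 1) * E := by
    calc _ ≤ lowBound M B ^ 2 * (2 * (M * D) * (2 * E) + T) := by gcongr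
      _ ≤ lowBound M B ^ 2 * ((4 * (M * D) + 1) * E + (4 * (M * D) + 1) * T) := by
          gcongr lowBound M B ^ 2 * ?_
          nlinarith [show 0 ≤ (M : ℝ) * D * T by positivity]
      _ = C₁ * T + C₁ * E := by rw [hC₁]; ring
      _ ≤ _ := by gcongr <;> linarith
  have b₂ : lowBound M B * D * (32 * (M * D) * (K * ε) + 2 * T) ≤
      (C₁ + C₂ + 1) * T + (C₁ + C₂ + 1) * E := by
    calc _ ≤ lowBound M B * D * (32 * (M * D) * (K * (2 * E)) + 2 * T) := by gcongr
      _ ≤ lowBound M B * D * ((64 * (M * D) * K + 2) * E + (64 * (M * D) * K + 2) * T) := by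
          gcongr lowBound M B * D * ?_
          nlinarith [show 0 ≤ (M : ℝ) * D * K * T by positivity]
      _ = C₂ * T + C₂ * E := by rw [hC₂]; ring
      _ ≤ _ := by gcongr <;> linarith
  refine ⟨fun i j => ?_, fun hm i j => ?_, fun hm i j => ?_⟩
  · refine (abs_groundP_sub_meraP_le hF hL hD0 hg hh hdec happ i j).trans ?_
    rw [mul_comm]
    gcongr
  · refine (abs_groundQ_sub_meraQ_le hm hF hL hD0 hg hh hdec happ i j).trans ?_
    rw [mul_comm]
    gcongr
  · subst hm
    refine (hreg hF hL hD0 hg hh hdec happ i j).trans ?_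
    gcongr
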